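/- Let $\Omega\subset\mathbb R^2$ be a bounded connected open set with Lipschitz boundary $\Gamma$, let $k\ge 1$ be an integer, and let $\sigma,\tau>0$ and $C_\delta,C_n$ be real constants. Then there is a constant $C>0$, depending only on $\Omega,k,\sigma,\tau,C_\delta,C_n$ (in particular not on the mesh size $h$), such that the following holds. Let $\mathcal T_h$ be a conforming finite triangular mesh of a polygonal domain (connected open set) $\Omega_h$ with boundary $\Gamma_h$, such that all mesh vertices on $\Gamma_h$ lie on $\Gamma$. Put $h_K=\operatorname{diam}K$, $h=\max_K h_K$, let $\rho_K$ be the diameter of the largest ball inscribed in $K$, and suppose $\max_K h_K/\rho_K\le\sigma$ and $\min_K h_K\ge\tau h$. Let $\mathcal E_h^o$ and $\mathcal E_h^b$ be the sets of interior and boundary edges, and $\boldsymbol n$, $\boldsymbol n_h$ the outward unit normals on $\Gamma$, $\Gamma_h$. Let $M_h:\Gamma_h\to\Gamma$ be a measurable map of the form $M_h(x)=x+\delta_h(x)\boldsymbol\nu_h(x)$ with $\boldsymbol\nu_h$ a measurable unit vector field on $\Gamma_h$ and $\delta_h(x)=|M_h(x)-x|$, such that $\widetilde{\boldsymbol n}=\boldsymbol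 n\circ M_h$ is defined almost everywhere on $\Gamma_h$ and measurable, and $$\sup_{x\in\Gamma_h}\delta_h(x)\le C_\delta h^2,\qquad \|\widetilde{\boldsymbol n}-\boldsymbol n_h\|_{L^\infty(\Gamma_h)}\le C_n h .$$ Let $$V_h=\{\boldsymbol v\in H(\mathrm{div},\Omega_h):\boldsymbol v|_K\in RT_k(K)\ \forall K\in\mathcal T_h\},\qquad RT_k(K)=P_k(K)^2+\boldsymbol x\,P_k(K),$$ $$Q_{0h}=\Big\{q\in L^2(\Omega_h): q|_K\in P_k(K)\ \forall K\in\mathcal T_h,\ \int_{\Omega_h}q\,dx=0\Big\},$$ and, on a boundary edge $e\subset\partial K$, let $T^k\boldsymbol v=\sum_{j=0}^k\frac{\delta_h^j}{j!}\,\partial_{\boldsymbol\nu_h}^j(\boldsymbol v|_K)$. Define $$a_h(\boldsymbol u,\boldsymbol v)=(\boldsymbol u,\boldsymbol v)_{\Omega_h}+\sum_{e\in\mathcal E_h^b}\langle h_K^{-1}T^k\boldsymbol u\cdot\widetilde{\boldsymbol n},T^k\boldsymbol v\cdot\widetilde{\boldsymbol n}\rangle_e,$$ $$b_{h1}(\boldsymbol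 v,q)=-(\mathrm{div}\,\boldsymbol v,q)_{\Omega_h}+\sum_{e\in\mathcal E_h^b}\langle\boldsymbol v\cdot\boldsymbol n_h,q\rangle_e,\qquad b_{h0}(\boldsymbol v,q)=-(\mathrm{div}\,\boldsymbol v,q)_{\Omega_h},$$ $$\|\boldsymbol v\|_{0,h}=\Big(\|\boldsymbol v\|_{0,\Omega_h}^2+\sum_{e\in\mathcal E_h^b}\|h_K^{-1/2}T^k\boldsymbol v\cdot\widetilde{\boldsymbol n}\|_{0,e}^2\Big)^{1/2},\qquad \|q\|_{1,h}=\Big(\sum_{K\in\mathcal T_h}\|\nabla q\|_{0,K}^2+\sum_{e\in\mathcal E_h^o}h^{-1}\|[q]\|_{0,e}^2\Big)^{1/2},$$ where $(\cdot,\cdot)_{\Omega_h}$ and $\langle\cdot,\cdot\rangle_e$ are the $L^2$ inner products on $\Omega_h$ and $e$, $\|\cdot\|_{0,S}$ is the $L^2(S)$ norm, and $[q]=q|_{K_1}-q|_{K_2}$ is the jump across the edge shared by $K_1,K_2$. Then for all $\boldsymbol u_h,\boldsymbol v_h\in V_h$ and $q_h\in Q_{0h}$: $$|a_h(\boldsymbol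 u_h,\boldsymbol v_h)|\le\|\boldsymbol u_h\|_{0,h}\|\boldsymbol v_h\|_{0,h},\qquad a_h(\boldsymbol v_h,\boldsymbol v_h)=\|\boldsymbol v_h\|_{0,h}^2,$$ $$|b_{h1}(\boldsymbol v_h,q_h)|\le C\,\|\boldsymbol v_h\|_{0,h}\|q_h\|_{1,h},\qquad |b_{h0}(\boldsymbol v_h,q_h)|\le C\,\|\boldsymbol v_h\|_{0,h}\|q_h\|_{1,h}.$$ -/

import Mathlib

open MeasureTheory
open scoped ContDiff

noncomputable section

namespace BVC

/-- The Euclidean plane. -/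
abbrev Plane : Type := EuclideanSpace ℝ (Fin 2)

/-- Arc length (one-dimensional Hausdorff measure) in the plane. -/
def arcLength : Measure Plane := Measure.hausdorffMeasure 1

/-! ### Domains and normals -/

/-- `Ω` has a Lipschitz boundary: near each boundary point, in suitable orthonormal coordinates,
`Ω` is the region below the graph of a Lipschitz function. -/
def HasLipschitzBoundary (Ω : Set Plane) : Prop :=
  ∀ x ∈ frontier Ω, ∃ (R : Plane ≃ₗᵢ[ℝ] Plane) (ψ : ℝ → ℝ) (L : NNReal) (ε : ℝ),
    LipschitzWith L ψ ∧ 0 < ε ∧ ∀ y ∈ Metric.ball x ε, (y ∈ Ω ↔ (R y) 1 < ψ ((R y) 0))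

/-- `n` is the outward unit normal of `Ω` at the boundary point `x`: up to angles that become
arbitrarily small near `x`, the set `Ω` is the half plane `{y | ⟪y - x, n⟫ < 0}`. (For a Lipschitz
domain this says that the graph function is differentiable there, with normal `n`.) -/
def IsOutwardUnitNormal (Ω : Set Plane) (x n : Plane) : Prop :=
  x ∈ frontier Ω ∧ ‖n‖ = 1 ∧ ∀ ε : ℝ, 0 < ε → ∃ r : ℝ, 0 < r ∧ ∀ y ∈ Metric.ball x r,
    (inner ℝ (y - x) n < -(ε * ‖y - x‖) → y ∈ Ω) ∧
    (ε * ‖y - x‖ < inner ℝ (y - x) n → y ∉ Ω)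

open Classical in
/-- The outward unit normal field of `Ω` (`0` where there is no normal). -/
def outwardNormal (Ω : Set Plane) (x : Plane) : Plane :=
  if h : ∃ n, IsOutwardUnitNormal Ω x n then h.choose else 0

/-! ### `L²`, weak divergence, `H(div)` -/

/-- `w` is the weak divergence of `v` on the open set `U`. -/
def HasWeakDiv (U : Set Plane) (v : Plane → Plane) (w : Plane → ℝ) : Prop :=
  ∀ φ : Plane → ℝ, ContDiff ℝ ∞ φ → HasCompactSupport φ → tsupport φ ⊆ U →
    ∫ x in U, inner ℝ (v x) (gradient φ x) = -∫ x in U, w x * φ x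

/-- `v ∈ H(div, U)`. -/
def MemHDiv (U : Set Plane) (v : Plane → Plane) : Prop :=
  MemLp v 2 (volume.restrict U) ∧
    ∃ w : Plane → ℝ, MemLp w 2 (volume.restrict U) ∧ HasWeakDiv U v w

open Classical in
/-- The divergence in `L²(U)` of `v ∈ H(div, U)` (unique almost everywhere). -/
def weakDiv (U : Set Plane) (v : Plane → Plane) : Plane → ℝ :=
  if h : ∃ w : Plane → ℝ, MemLp w 2 (volume.restrict U) ∧ HasWeakDiv U v w then h.choose else 0

/-! ### Polynomial spaces -/

/-- Polynomial functions of total degree at most `k`. -/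
def polySpace (k : ℕ) : Set (Plane → ℝ) :=
  {f | ∃ p : MvPolynomial (Fin 2) ℝ, p.totalDegree ≤ k ∧
    ∀ x : Plane, f x = MvPolynomial.eval (fun i => x i) p}

/-- Vector fields whose components are polynomials of degree at most `k`. -/
def vecPolySpace (k : ℕ) : Set (Plane → Plane) :=
  {f | ∀ i : Fin 2, (fun x => f x i) ∈ polySpace k}

/-- The Raviart-Thomas space `RT_k = P_k² + x P_k`. -/
def rtSpace (k : ℕ) : Set (Plane → Plane) :=
  {f | ∃ a ∈ vecPolySpace k, ∃ b ∈ polySpace k, ∀ x : Plane, f x = a x + b x • x}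

/-- The closed simplex (here: triangle or edge) with the given vertices. -/
def simplex (s : Finset Plane) : Set Plane := convexHull ℝ (s : Set Plane)

/-- `f` restricted to the triangle `K` is (almost everywhere) an element of `P`. -/
def RestrictsTo {F : Type} (P : Set (Plane → F)) (f : Plane → F) (K : Finset Plane) : Prop :=
  ∃ p ∈ P, f =ᵐ[volume.restrict (simplex K)] p

open Classical in
/-- The element of the polynomial space `P` that `f` coincides with on the triangle `K`. It gives
the values and derivatives of `f|_K` up to the boundary of `K`. -/
def piece {F : Type} [Zero F] (P : Set (Plane → F)) (f : Plane → F) (K : Finset Plane) :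
    Plane → F :=
  if h : RestrictsTo P f K then h.choose else 0

/-! ### Triangular meshes -/

/-- A conforming finite triangular mesh; a triangle is given by its set of vertices. -/
structure TriMesh where
  elems : Finset (Finset Plane)
  nonempty : elems.Nonempty
  card_eq : ∀ K ∈ elems, K.card = 3
  indep : ∀ K ∈ elems, AffineIndependent ℝ ((↑) : K → Plane)
  conforming : ∀ K ∈ elems, ∀ L ∈ elems,
    simplex K ∩ simplex L = convexHull ℝ ((K : Set Plane) ∩ (L : Set Plane))

/-- The diameter `h_K`. -/
def hK (K : Finset Plane) : ℝ := Metric.diam (simplex K)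

/-- The diameter `ρ_K` of the largest ball inscribed in `K`. -/
def rhoK (K : Finset Plane) : ℝ :=
  sSup {d : ℝ | ∃ (c : Plane) (r : ℝ), 0 ≤ r ∧ Metric.closedBall c r ⊆ simplex K ∧ d = 2 * r}

namespace TriMesh

/-- The polygonal domain `Ω_h` covered by the mesh. -/
def domain (M : TriMesh) : Set Plane := interior (⋃ K ∈ M.elems, simplex K)

/-- The mesh size `h = max_K h_K`. -/
def h (M : TriMesh) : ℝ := M.elems.sup' M.nonempty hK

open Classical in
/-- All edges of the mesh, as two-point sets. -/
def edges (M : TriMesh) : Finset (Finset Plane) :=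
  M.elems.biUnion fun K => K.powersetCard 2

/-- The edge `e` is shared by two different elements. -/
def IsInterior (M : TriMesh) (e : Finset Plane) : Prop :=
  ∃ s : Finset Plane × Finset Plane,
    s.1 ∈ M.elems ∧ s.2 ∈ M.elems ∧ s.1 ≠ s.2 ∧ e ⊆ s.1 ∧ e ⊆ s.2

open Classical in
/-- The interior edges. -/
def intEdges (M : TriMesh) : Finset (Finset Plane) := M.edges.filter fun e => M.IsInterior e

open Classical in
/-- The boundary edges. -/
def bdryEdges (M : TriMesh) : Finset (Finset Plane) := M.edges.filter fun e => ¬ M.IsInterior e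

/-- The boundary `Γ_h` of the polygonal domain: the union of the boundary edges. -/
def bdry (M : TriMesh) : Set Plane := ⋃ e ∈ M.bdryEdges, simplex e

open Classical in
/-- The two elements that share an interior edge, in some order. -/
def sides (M : TriMesh) (e : Finset Plane) : Finset Plane × Finset Plane :=
  if h : M.IsInterior e then h.choose else (∅, ∅)

open Classical in
/-- An element with edge `e`; for a boundary edge there is only one. -/
def elem (M : TriMesh) (e : Finset Plane) : Finset Plane :=
  if h : ∃ K ∈ M.elems, e ⊆ K then h.choose else ∅

open Classical in
/-- The outward unit normal `n_h` along a boundary edge `e` of `Ω_h`: the unit vector normal to `e`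
that points away from the element with edge `e`. -/
def normal (M : TriMesh) (e : Finset Plane) : Plane :=
  if h : ∃ n : Plane, ‖n‖ = 1 ∧ (∀ x ∈ e, ∀ y ∈ e, inner ℝ (y - x) n = 0) ∧
      (∀ x ∈ e, ∀ y ∈ M.elem e, inner ℝ (y - x) n ≤ 0)
  then h.choose else 0

/-- `Ω_h` is a polygonal domain (connected), and all mesh vertices on `Γ_h` lie on `Γ = ∂Ω`. -/
structure IsBodyFitted (M : TriMesh) (Ω : Set Plane) : Prop where
  connected : IsConnected M.domain
  vertices : ∀ K ∈ M.elems, ∀ x ∈ K, x ∈ M.bdry → x ∈ frontier Ω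

/-- `max_K h_K / ρ_K ≤ σ`. -/
def ShapeRegular (M : TriMesh) (σ : ℝ) : Prop := ∀ K ∈ M.elems, hK K / rhoK K ≤ σ

/-- `min_K h_K ≥ τ h`. -/
def QuasiUniform (M : TriMesh) (τ : ℝ) : Prop := ∀ K ∈ M.elems, τ * M.h ≤ hK K

/-! ### The boundary map and the Taylor operator -/

/-- The distance `δ_h(x) = |M_h(x) - x|`. -/
def delta (Mh : Plane → Plane) (x : Plane) : ℝ := ‖Mh x - x‖

/-- The pulled back normal `ñ = n ∘ M_h`. -/
def pullNormal (Ω : Set Plane) (Mh : Plane → Plane) (x : Plane) : Plane := outwardNormal Ω (Mh x)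

/-- `M_h : Γ_h → Γ`, `M_h(x) = x + δ_h(x) ν_h(x)` with a unit vector field `ν_h`, where
`δ_h ≤ Cδ h²` on `Γ_h`, and `ñ = n ∘ M_h` is defined almost everywhere on `Γ_h` with
`‖ñ - n_h‖_{L^∞(Γ_h)} ≤ Cn h`. Values off `Γ_h` are irrelevant. -/
structure IsBoundaryMap (M : TriMesh) (Ω : Set Plane) (Mh ν : Plane → Plane) (Cδ Cn : ℝ) :
    Prop where
  measurable_map : Measurable Mh
  measurable_dir : Measurable ν
  measurable_normal : AEStronglyMeasurable (pullNormal Ω Mh) (arcLength.restrict M.bdry)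
  maps_to : ∀ x ∈ M.bdry, Mh x ∈ frontier Ω
  norm_dir : ∀ x ∈ M.bdry, ‖ν x‖ = 1
  map_eq : ∀ x ∈ M.bdry, Mh x = x + delta Mh x • ν x
  delta_le : ∀ x ∈ M.bdry, delta Mh x ≤ Cδ * M.h ^ 2
  normal_le : ∀ e ∈ M.bdryEdges, ∀ᵐ x ∂(arcLength.restrict (simplex e)),
    (∃ n, IsOutwardUnitNormal Ω (Mh x) n) ∧ ‖pullNormal Ω Mh x - M.normal e‖ ≤ Cn * M.h

/-- The Taylor operator `T^m v (x) = ∑_{j ≤ m} δ_h(x)^j / j! ∂_{ν_h}^j v (x)`. -/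
def taylor (Mh ν : Plane → Plane) (m : ℕ) (v : Plane → Plane) (x : Plane) : Plane :=
  ∑ j ∈ Finset.range (m + 1),
    (delta Mh x ^ j / (j.factorial : ℝ)) • iteratedDeriv j (fun t : ℝ => v (x + t • ν x)) 0

/-! ### Discrete spaces, forms and norms -/

/-- `V_h`: fields in `H(div, Ω_h)` that are in `RT_k(K)` on each element `K`. -/
def V (M : TriMesh) (k : ℕ) : Set (Plane → Plane) :=
  {v | MemHDiv M.domain v ∧ ∀ K ∈ M.elems, RestrictsTo (rtSpace k) v K}

/-- `Q_{0h}`: mean value free functions in `L²(Ω_h)` that are in `P_k(K)` on each element `K`. -/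
def Q0 (M : TriMesh) (k : ℕ) : Set (Plane → ℝ) :=
  {q | MemLp q 2 (volume.restrict M.domain) ∧ (∀ K ∈ M.elems, RestrictsTo (polySpace k) q K) ∧
    ∫ x in M.domain, q x = 0}

/-- `T^k v · ñ` on the boundary edge `e`. -/
def taylorFlux (M : TriMesh) (Ω : Set Plane) (Mh ν : Plane → Plane) (k : ℕ)
    (v : Plane → Plane) (e : Finset Plane) (x : Plane) : ℝ :=
  inner ℝ (taylor Mh ν k (piece (rtSpace k) v (M.elem e)) x) (pullNormal Ω Mh x)

/-- `a_h(u, v) = (u, v)_{Ω_h} + ∑_{e ∈ E_h^b} ⟨h_K⁻¹ T^k u · ñ, T^k v · ñ⟩_e`. -/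
def a (M : TriMesh) (Ω : Set Plane) (Mh ν : Plane → Plane) (k : ℕ) (u v : Plane → Plane) : ℝ :=
  (∫ x in M.domain, inner ℝ (u x) (v x)) +
    ∑ e ∈ M.bdryEdges, ∫ x in simplex e, (hK (M.elem e))⁻¹ *
      M.taylorFlux Ω Mh ν k u e x * M.taylorFlux Ω Mh ν k v e x ∂arcLength

/-- `b_{h0}(v, q) = -(div v, q)_{Ω_h}`. -/
def b0 (M : TriMesh) (v : Plane → Plane) (q : Plane → ℝ) : ℝ :=
  -∫ x in M.domain, weakDiv M.domain v x * q x

/-- `b_{h1}(v, q) = -(div v, q)_{Ω_h} + ∑_{e ∈ E_h^b} ⟨v · n_h, q⟩_e`. -/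
def b1 (M : TriMesh) (k : ℕ) (v : Plane → Plane) (q : Plane → ℝ) : ℝ :=
  (-∫ x in M.domain, weakDiv M.domain v x * q x) +
    ∑ e ∈ M.bdryEdges, ∫ x in simplex e,
      inner ℝ (piece (rtSpace k) v (M.elem e) x) (M.normal e) *
        piece (polySpace k) q (M.elem e) x ∂arcLength

/-- `‖v‖_{0,h}`. -/
def normV (M : TriMesh) (Ω : Set Plane) (Mh ν : Plane → Plane) (k : ℕ) (v : Plane → Plane) : ℝ :=
  √((∫ x in M.domain, ‖v x‖ ^ 2) +
    ∑ e ∈ M.bdryEdges, ∫ x in simplex e,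
      ((√(hK (M.elem e)))⁻¹ * M.taylorFlux Ω Mh ν k v e x) ^ 2 ∂arcLength)

/-- The jump `[q] = q|_{K₁} - q|_{K₂}` on an interior edge. -/
def jump (M : TriMesh) (k : ℕ) (q : Plane → ℝ) (e : Finset Plane) (x : Plane) : ℝ :=
  piece (polySpace k) q (M.sides e).1 x - piece (polySpace k) q (M.sides e).2 x

/-- `‖q‖_{1,h}`. -/
def normQ (M : TriMesh) (k : ℕ) (q : Plane → ℝ) : ℝ :=
  √((∑ K ∈ M.elems, ∫ x in simplex K, ‖gradient (piece (polySpace k) q K) x‖ ^ 2) +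
    ∑ e ∈ M.intEdges, M.h⁻¹ * ∫ x in simplex e, M.jump k q e x ^ 2 ∂arcLength)

end TriMesh

end BVC

end

/-!
The identity `a_h(v, v) = ‖v‖_{0,h}²` is the definition of the norm, and the bound for `a_h` is the
Cauchy-Schwarz inequality, once the fluxes `T^k v · ñ` are known to be square integrable on the
boundary edges (`TriMesh.memLp_taylorFlux`).

For `b_{h1}`, elementwise integration by parts cancels the boundary terms. A field in `H(div)` that
is smooth on each element has the elementwise divergence as its weak divergence and a normal
component that is continuous across interior edges (`TriMesh.weakDiv_ae_eq`,
`TriMesh.normal_continuity`), so that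
`b_{h1}(v, q) = ∑_K (v, ∇q)_K - ∑_e ⟨v · n, [q]⟩_e` with the sum over the interior edges
(`TriMesh.green_identity`). The inverse estimate `sup_K |v| ≤ C h⁻¹ ‖v‖_{0,K}` and the
Cauchy-Schwarz inequality then give the bound (`TriMesh.exists_abs_b1_le`).

The forms `b_{h0}` and `b_{h1}` differ by `∑_e ⟨v · n_h, q⟩_e` over the boundary edges. Here
`v · n_h` is replaced by `T^k v · ñ`: because `δ_h = O(h²)` and `ñ - n_h = O(h)`, the inverse
estimate bounds the difference by `C ‖v‖_{0,K}` pointwise (`TriMesh.exists_taylor_edge_le`). No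
trace or Poincaré inequality on the mesh-dependent domain is used for `q`. Instead, `|q|` is bounded
by `C h^{-1/2} ‖q‖_{1,h}` everywhere (`TriMesh.exists_sq_le_brokenSq`): two point values of `q` are
compared along a chain of `O(1/h)` neighbouring elements, the Cauchy-Schwarz inequality bounds the
sum of the differences, and `q` takes values of both signs because its mean is zero. There are
`O(1/h)` boundary edges of length at most `h`, so that the powers of `h` cancel
(`TriMesh.exists_abs_sum_bdry_le`).

That any two elements are joined by a chain of `O(1/h)` neighbours (`TriMesh.exists_walk_length_le`)
is where the Lipschitz property of `Γ` and the closeness of the normals enter. Along a segment inside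
the polygonal domain, the elements form a chain of the required length, by a packing argument. From a
point near the boundary one moves by a fixed distance in the downward direction of a chart of `Γ`;
the boundary edges cannot be crossed on the way, since their normals, like those of `Γ`, point
upwards (`TriMesh.mem_domain_of_segment`). The end points have a fixed distance from the boundary,
so that finitely many balls, independent of the mesh, sort the elements into classes with short
chains inside each class, and a shortest chain between two elements visits each class only on a short
stretch (`TriMesh.exists_walk_of_colouring`). Coarse meshes have boundedly many elements, and
connectedness suffices.
-/

noncomputable section

namespace BVC

/-! ### Triangles and edges in coordinates -/

/-- The determinant of two plane vectors. -/
def cross (u w : Plane) : ℝ := u 0 * w 1 - u 1 * w 0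

lemma inner_coord (x y : Plane) : inner ℝ x y = x 0 * y 0 + x 1 * y 1 := by
  simp [PiLp.inner_apply, Fin.sum_univ_two, mul_comm]

lemma norm_sq_coord (x : Plane) : ‖x‖ ^ 2 = x 0 ^ 2 + x 1 ^ 2 := by
  simp [EuclideanSpace.real_norm_sq_eq, Fin.sum_univ_two]

/-- The linear map sending the standard basis to `u`, `w`. -/
def frameMap (u w : Plane) : Plane →L[ℝ] Plane :=
  (EuclideanSpace.proj (0 : Fin 2)).smulRight u + (EuclideanSpace.proj (1 : Fin 2)).smulRight w

lemma frameMap_apply (u w x : Plane) : frameMap u w x = x 0 • u + x 1 • w := by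
  simp [frameMap]

lemma det_frameMap (u w : Plane) : (frameMap u w).det = cross u w := by
  rw [ContinuousLinearMap.det,
    ← LinearMap.det_toMatrix (EuclideanSpace.basisFun (Fin 2) ℝ).toBasis, Matrix.det_fin_two]
  simp [LinearMap.toMatrix_apply, frameMap_apply, cross, mul_comm]

lemma frameMap_injective {u w : Plane} (h : cross u w ≠ 0) :
    Function.Injective (frameMap u w) := by
  refine (injective_iff_map_eq_zero _).2 fun x hx => ?_
  have h0 := congrArg (fun y : Plane => y 0) hx
  have h1 := congrArg (fun y : Plane => y 1) hx
  simp only [frameMap_apply, PiLp.add_apply, PiLp.smul_apply, smul_eq_mul, PiLp.zero_apply] at h0 h1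
  unfold cross at h
  ext i
  fin_cases i
  · refine (mul_eq_zero.1 (?_ : (u 0 * w 1 - u 1 * w 0) * x 0 = 0)).resolve_left h
    linear_combination w 1 * h0 - w 0 * h1
  · refine (mul_eq_zero.1 (?_ : (u 0 * w 1 - u 1 * w 0) * x 1 = 0)).resolve_left h
    linear_combination u 0 * h1 - u 1 * h0

/-- The reference triangle, with vertices at the origin and at the standard basis vectors. -/
def refTri : Set Plane := {x | 0 ≤ x 0 ∧ 0 ≤ x 1 ∧ x 0 + x 1 ≤ 1}

lemma mem_triangle {a b c y : Plane} : y ∈ convexHull ℝ {a, b, c} ↔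
    ∃ s t : ℝ, 0 ≤ s ∧ 0 ≤ t ∧ s + t ≤ 1 ∧ y = a + s • (b - a) + t • (c - a) := by
  constructor
  · intro hy
    have hsub : convexHull ℝ {a, b, c} ⊆
        {y : Plane | ∃ s t : ℝ, 0 ≤ s ∧ 0 ≤ t ∧ s + t ≤ 1 ∧ y = a + s • (b - a) + t • (c - a)} := by
      refine convexHull_min ?_ ?_
      · rintro x (rfl | rfl | rfl)
        · exact ⟨0, 0, by norm_num, by norm_num, by norm_num, by simp⟩
        · exact ⟨1, 0, by norm_num, by norm_num, by norm_num, by simp⟩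
        · exact ⟨0, 1, by norm_num, by norm_num, by norm_num, by simp⟩
      · rintro x ⟨s, t, hs, ht, hst, rfl⟩ y ⟨s', t', hs', ht', hst', rfl⟩ α β hα hβ hαβ
        refine ⟨α * s + β * s', α * t + β * t', by positivity, by positivity, ?_, ?_⟩
        · nlinarith
        · have : β = 1 - α := by linarith
          subst this
          module
    exact hsub hy
  · rintro ⟨s, t, hs, ht, hst, rfl⟩
    have := (convex_convexHull ℝ ({a, b, c} : Set Plane)).sum_mem (t := Finset.univ)
      (w := ![1 - s - t, s, t]) (z := ![a, b, c]) ?_ ?_ ?_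
    · convert this using 1
      simp only [Fin.sum_univ_three, Matrix.cons_val_zero, Matrix.cons_val_one, Matrix.cons_val]
      module
    · intro i _
      fin_cases i
      · simp; linarith
      · simpa
      · simpa
    · simp only [Fin.sum_univ_three, Matrix.cons_val_zero, Matrix.cons_val_one, Matrix.cons_val]
      ring
    · intro i _
      refine subset_convexHull ℝ _ ?_
      fin_cases i <;> simp

lemma image_refTri (a b c : Plane) :
    (fun x => a + frameMap (b - a) (c - a) x) '' refTri = convexHull ℝ {a, b, c} := by
  ext y
  simp only [mem_triangle, Set.mem_image, refTri, Set.mem_ofPred_eq, frameMap_apply]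
  constructor
  · rintro ⟨x, ⟨h0, h1, h2⟩, rfl⟩
    exact ⟨x 0, x 1, h0, h1, h2, by abel⟩
  · rintro ⟨s, t, hs, ht, hst, rfl⟩
    exact ⟨!₂[s, t], by simpa using ⟨hs, ht, hst⟩, by simp; abel⟩

lemma isClosed_refTri : IsClosed refTri := by
  have h0 : Continuous fun x : Plane => x 0 := by fun_prop
  have h1 : Continuous fun x : Plane => x 1 := by fun_prop
  exact (isClosed_le continuous_const h0).inter
    ((isClosed_le continuous_const h1).inter (isClosed_le (h0.add h1) continuous_const))

lemma isBounded_refTri : Bornology.IsBounded refTri := by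
  refine (Metric.isBounded_closedBall (x := (0 : Plane)) (r := 1)).subset ?_
  rintro x ⟨h0, h1, h2⟩
  rw [mem_closedBall_zero_iff]
  have := norm_sq_coord x
  nlinarith [norm_nonneg x, mul_nonneg h0 h1]

lemma integral_refTri {g : Plane → ℝ} (hg : Continuous g) :
    ∫ x in refTri, g x = ∫ s in (0 : ℝ)..1, ∫ t in (0 : ℝ)..(1 - s), g !₂[s, t] := by
  have hcpt : IsCompact refTri := Metric.isCompact_of_isClosed_isBounded isClosed_refTri
    isBounded_refTri
  have hint : IntegrableOn g refTri := hg.continuousOn.integrableOn_compact hcpt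
  set Φ : ℝ × ℝ → Plane := fun p => !₂[p.1, p.2] with hΦ
  have hΦe : Φ = (MeasurableEquiv.toLp 2 (Fin 2 → ℝ)) ∘
      (MeasurableEquiv.finTwoArrow (α := ℝ)).symm := by
    funext p; ext i; fin_cases i <;> simp [hΦ]
  have hmp : MeasurePreserving Φ := by
    rw [hΦe]
    exact (PiLp.volume_preserving_toLp (Fin 2)).comp (volume_preserving_finTwoArrow ℝ).symm
  have hemb : MeasurableEmbedding Φ := by
    rw [hΦe]
    exact (MeasurableEquiv.measurableEmbedding _).comp (MeasurableEquiv.measurableEmbedding _)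
  have hI : Integrable (fun p => refTri.indicator g (Φ p)) :=
    (hmp.integrable_comp_emb hemb).2 ((integrable_indicator_iff isClosed_refTri.measurableSet).2 hint)
  calc ∫ x in refTri, g x = ∫ x, refTri.indicator g x :=
        (integral_indicator isClosed_refTri.measurableSet).symm
    _ = ∫ p, refTri.indicator g (Φ p) := (hmp.integral_comp hemb _).symm
    _ = ∫ s, ∫ t, refTri.indicator g (Φ (s, t)) := integral_prod _ hI
    _ = ∫ s, (Set.Icc (0 : ℝ) 1).indicator
          (fun s => ∫ t in (0 : ℝ)..(1 - s), g !₂[s, t]) s := by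
        congr 1; funext s
        by_cases hs : s ∈ Set.Icc (0 : ℝ) 1
        · rw [Set.indicator_of_mem hs, intervalIntegral.integral_of_le (by linarith [hs.2]),
            ← integral_Icc_eq_integral_Ioc, ← integral_indicator measurableSet_Icc]
          congr 1; funext t
          by_cases ht : t ∈ Set.Icc (0 : ℝ) (1 - s)
          · rw [Set.indicator_of_mem ht, Set.indicator_of_mem]
            exact ⟨hs.1, ht.1, by simp [hΦ]; linarith [ht.2]⟩
          · rw [Set.indicator_of_notMem ht, Set.indicator_of_notMem]
            rintro ⟨-, h1, h2⟩
            simp only [hΦ] at h1 h2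
            exact ht ⟨by simpa using h1, by have : s + t ≤ 1 := by simpa using h2
                                            linarith⟩
        · rw [Set.indicator_of_notMem hs]
          have : ∀ t, refTri.indicator g (Φ (s, t)) = 0 := fun t => by
            rw [Set.indicator_of_notMem]
            rintro ⟨h0, h1, h2⟩
            have h0' : 0 ≤ s := by simpa [hΦ] using h0
            have h1' : 0 ≤ t := by simpa [hΦ] using h1
            have h2' : s + t ≤ 1 := by simpa [hΦ] using h2
            exact hs ⟨h0', by linarith⟩
          simp [this]
    _ = _ := by
        rw [integral_indicator measurableSet_Icc, integral_Icc_eq_integral_Ioc,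
          ← intervalIntegral.integral_of_le zero_le_one]

/-- Evaluation of integrals over a triangle by iterated integrals in affine coordinates. -/
lemma integral_triangle {a b c : Plane} (h : cross (b - a) (c - a) ≠ 0) {f : Plane → ℝ}
    (hf : Continuous f) :
    ∫ x in convexHull ℝ {a, b, c}, f x = |cross (b - a) (c - a)| *
      ∫ s in (0 : ℝ)..1, ∫ t in (0 : ℝ)..(1 - s), f (a + s • (b - a) + t • (c - a)) := by
  rw [← image_refTri, integral_image_eq_integral_abs_det_fderiv_smul volume
    isClosed_refTri.measurableSet (f' := fun _ => frameMap (b - a) (c - a))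
    (fun x _ => ((frameMap (b - a) (c - a)).hasFDerivAt.const_add a).hasFDerivWithinAt)
    (fun x _ y _ hxy => frameMap_injective h (by simpa using hxy))]
  simp only [det_frameMap, smul_eq_mul]
  rw [integral_const_mul, integral_refTri (by fun_prop)]
  simp [frameMap_apply, add_assoc]

lemma isCompact_simplex (K : Finset Plane) : IsCompact (simplex K) :=
  K.finite_toSet.isCompact_convexHull (𝕜 := ℝ)

lemma simplex_pair [DecidableEq Plane] (a b : Plane) :
    simplex {a, b} = AffineMap.lineMap a b '' Set.Icc (0 : ℝ) 1 := by
  simp [simplex, convexHull_pair, segment_eq_image_lineMap]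

lemma mem_simplex_pair [DecidableEq Plane] {a b x : Plane} :
    x ∈ simplex {a, b} ↔ ∃ t ∈ Set.Icc (0 : ℝ) 1, x = a + t • (b - a) := by
  simp only [simplex_pair, Set.mem_image, AffineMap.lineMap_apply, vsub_eq_sub, vadd_eq_add]
  exact ⟨fun ⟨t, ht, h⟩ => ⟨t, ht, by rw [← h]; abel⟩, fun ⟨t, ht, h⟩ => ⟨t, ht, by rw [h]; abel⟩⟩

lemma arcLength_restrict_pair [DecidableEq Plane] {a b : Plane} (hab : a ≠ b) :
    arcLength.restrict (simplex {a, b}) = (‖b - a‖₊ : ENNReal) •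
      (volume.restrict (Set.Icc (0 : ℝ) 1)).map (AffineMap.lineMap a b) := by
  have hemb : MeasurableEmbedding (AffineMap.lineMap a b : ℝ → Plane) :=
    Continuous.measurableEmbedding (by fun_prop) (AffineMap.lineMap_injective ℝ hab)
  ext s hs
  rw [Measure.restrict_apply hs, Measure.smul_apply, hemb.map_apply,
    Measure.restrict_apply (hemb.measurable hs), simplex_pair, arcLength,
    Set.inter_comm s, ← Set.image_inter_preimage, hausdorffMeasure_lineMap_image,
    nndist_comm, nndist_eq_nnnorm, Set.inter_comm, hausdorffMeasure_real]
  rfl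

lemma integral_edge [DecidableEq Plane] {a b : Plane} (hab : a ≠ b) (f : Plane → ℝ) :
    ∫ x in simplex {a, b}, f x ∂arcLength =
      ‖b - a‖ * ∫ t in (0 : ℝ)..1, f (a + t • (b - a)) := by
  have hemb : MeasurableEmbedding (AffineMap.lineMap a b : ℝ → Plane) :=
    Continuous.measurableEmbedding (by fun_prop) (AffineMap.lineMap_injective ℝ hab)
  rw [arcLength_restrict_pair hab, integral_smul_measure, hemb.integral_map,
    integral_Icc_eq_integral_Ioc, ← intervalIntegral.integral_of_le zero_le_one]
  simp [AffineMap.lineMap_apply, add_comm]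

lemma cross_ne_zero [DecidableEq Plane] {a b c : Plane} (hab : a ≠ b) (hac : a ≠ c) (hbc : b ≠ c)
    (h : AffineIndependent ℝ ((↑) : ({a, b, c} : Finset Plane) → Plane)) :
    cross (b - a) (c - a) ≠ 0 := by
  intro h0
  have hc : ¬ Collinear ℝ {a, b, c} := by
    rw [← affineIndependent_iff_not_collinear_set]
    let f : Fin 3 ↪ ({a, b, c} : Finset Plane) :=
      ⟨![⟨a, by simp⟩, ⟨b, by simp⟩, ⟨c, by simp⟩], by
        intro i j hij
        fin_cases i <;> fin_cases j <;>
          simp [hab, hac, hbc, hab.symm, hac.symm, hbc.symm] at hij ⊢⟩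
    have hf : (fun i => (f i : Plane)) = ![a, b, c] := by
      funext i; fin_cases i <;> rfl
    rw [← hf]
    exact h.comp_embedding f
  apply hc
  rw [collinear_iff_of_mem (p₀ := a) (by simp)]
  refine ⟨b - a, ?_⟩
  have hd : ‖b - a‖ ^ 2 ≠ 0 := by simpa [sub_eq_zero] using hab.symm
  rintro p (rfl | rfl | rfl)
  · exact ⟨0, by simp⟩
  · exact ⟨1, by simp⟩
  · refine ⟨inner ℝ (p - a) (b - a) / ‖b - a‖ ^ 2, ?_⟩
    rw [norm_sq_coord] at hd ⊢
    rw [inner_coord]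
    unfold cross at h0
    rw [vadd_eq_add, ← sub_eq_iff_eq_add]
    ext i
    simp only [PiLp.smul_apply, smul_eq_mul]
    rw [div_mul_eq_mul_div, eq_div_iff hd]
    fin_cases i
    · simp only [Fin.zero_eta]
      linear_combination -((b - a) 1) * h0
    · simp only [Fin.mk_one]
      linear_combination ((b - a) 0) * h0

/-- `n` is the unit vector normal to the edge `e` that points away from `K`. -/
def IsOutN (K e : Finset Plane) (n : Plane) : Prop :=
  ‖n‖ = 1 ∧ (∀ x ∈ e, ∀ y ∈ e, inner ℝ (y - x) n = 0) ∧ (∀ x ∈ e, ∀ y ∈ K, inner ℝ (y - x) n ≤ 0)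

open Classical in
/-- The outward unit normal of the triangle `K` along its edge `e` (`0` if there is none). By
definition, `M.normal e` is `outN (M.elem e) e`. -/
def outN (K e : Finset Plane) : Plane := if h : ∃ n, IsOutN K e n then h.choose else 0

lemma exists_isOutN [DecidableEq Plane] {a b c : Plane} (h : cross (b - a) (c - a) ≠ 0) :
    ∃ n, IsOutN {a, b, c} {a, b} n := by
  have hd : 0 < ‖b - a‖ := by
    rw [norm_pos_iff]; intro h0; simp [h0, cross] at h
  set D := cross (b - a) (c - a) with hD
  set u := b - a
  refine ⟨(SignType.sign D : ℝ) • ‖u‖⁻¹ • !₂[u 1, -u 0], ?_, ?_, ?_⟩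
  · have h1 : ‖(!₂[u 1, -u 0] : Plane)‖ = ‖u‖ := by
      rw [← sq_eq_sq₀ (norm_nonneg _) (norm_nonneg _), norm_sq_coord, norm_sq_coord]
      simp; ring
    rw [norm_smul, norm_smul, h1, norm_inv, norm_norm, inv_mul_cancel₀ hd.ne', mul_one]
    rcases lt_or_gt_of_ne h with h | h <;> simp [h]
  · intro x hx y hy
    simp only [Finset.mem_insert, Finset.mem_singleton] at hx hy
    rcases hx with rfl | rfl <;> rcases hy with rfl | rfl <;>
      simp [inner_coord, u] <;> ring
  · have key : ∀ w : Plane, inner ℝ w ((SignType.sign D : ℝ) • ‖u‖⁻¹ • (!₂[u 1, -u 0] : Plane)) =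
        -(‖u‖⁻¹ * (SignType.sign D * cross u w)) := by
      intro w; simp [inner_coord, cross]; ring
    intro x hx y hy
    simp only [Finset.mem_insert, Finset.mem_singleton] at hx hy
    rw [key, neg_nonpos]
    refine mul_nonneg (by positivity) ?_
    rcases hx with rfl | rfl <;> rcases hy with rfl | rfl | rfl
    · simp [cross]
    · simp [cross, u, mul_comm]
    · rw [← hD, sign_mul_self]; positivity
    · have : cross u (y - x) = 0 := by simp [cross, u]; ring
      simp [this]
    · simp [cross]
    · have : cross u (y - x) = D := by simp [cross, u, hD]; ring
      rw [this, sign_mul_self]; positivity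

lemma outN_spec [DecidableEq Plane] {a b c : Plane} (h : cross (b - a) (c - a) ≠ 0) :
    IsOutN {a, b, c} {a, b} (outN {a, b, c} {a, b}) := by
  have := exists_isOutN h
  rw [outN, dif_pos this]
  exact this.choose_spec

/-- The flux weight `⟪w, n⟫ |e|` of a triangle edge, in terms of determinants. -/
lemma inner_isOutN [DecidableEq Plane] {a b c n : Plane} (h : cross (b - a) (c - a) ≠ 0)
    (hn : IsOutN {a, b, c} {a, b} n) (w : Plane) :
    ‖b - a‖ * inner ℝ w n =
      -(SignType.sign (cross (b - a) (c - a)) * cross (b - a) w) := by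
  obtain ⟨h1, h2, h3⟩ := hn
  have hd : 0 < ‖b - a‖ := by
    rw [norm_pos_iff]; intro h0; simp [h0, cross] at h
  have e0 : inner ℝ (b - a) n = 0 := h2 a (by simp) b (by simp)
  have e1 : inner ℝ (c - a) n ≤ 0 := h3 a (by simp) c (by simp)
  set u := b - a
  have hn2 := norm_sq_coord n
  have hu2 := norm_sq_coord u
  rw [h1] at hn2
  have key : ∀ w : Plane, inner ℝ w n * ‖u‖ ^ 2 = cross u w * cross u n := by
    intro w
    rw [hu2]
    rw [inner_coord] at e0 ⊢
    unfold cross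
    linear_combination (u 0 * w 0 + u 1 * w 1) * e0
  have hsq : cross u n ^ 2 = ‖u‖ ^ 2 := by
    rw [hu2]
    rw [inner_coord] at e0
    unfold cross
    linear_combination (- u 0 ^ 2 - u 1 ^ 2) * hn2 - (u 0 * n 0 + u 1 * n 1) * e0
  have hcr : cross u n = -(SignType.sign (cross u (c - a)) * ‖u‖) := by
    have hle : cross u (c - a) * cross u n ≤ 0 := by
      rw [← key]; exact mul_nonpos_of_nonpos_of_nonneg e1 (by positivity)
    rcases sq_eq_sq_iff_eq_or_eq_neg.1 hsq with h' | h' <;>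
    rcases lt_or_gt_of_ne h with hs | hs
    · simp [hs, h']
    · exfalso; rw [h'] at hle; nlinarith
    · exfalso; rw [h'] at hle; nlinarith
    · simp [hs, h']
  have := key w
  rw [hcr] at this
  have h4 : ‖u‖ * (‖u‖ * inner ℝ w n + SignType.sign (cross u (c - a)) * cross u w) = 0 := by
    linear_combination this
  have := (mul_eq_zero.1 h4).resolve_left hd.ne'
  linarith

lemma IsOutN.unique [DecidableEq Plane] {a b c n n' : Plane} (h : cross (b - a) (c - a) ≠ 0)
    (hn : IsOutN {a, b, c} {a, b} n) (hn' : IsOutN {a, b, c} {a, b} n') : n = n' := by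
  have hd : 0 < ‖b - a‖ := by
    rw [norm_pos_iff]; intro h0; simp [h0, cross] at h
  refine ext_inner_left ℝ fun w => mul_left_cancel₀ hd.ne' ?_
  rw [inner_isOutN h hn, inner_isOutN h hn']

lemma cross_rotate (a b c : Plane) : cross (c - b) (a - b) = cross (b - a) (c - a) := by
  simp [cross]; ring

lemma integral_reverse (f : Plane → ℝ) (a b : Plane) :
    ∫ t in (0 : ℝ)..1, f (a + t • (b - a)) = ∫ t in (0 : ℝ)..1, f (b + t • (a - b)) := by
  have := intervalIntegral.integral_comp_sub_left (fun t : ℝ => f (a + t • (b - a))) (1 : ℝ)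
    (a := 0) (b := 1)
  simp only [sub_self, sub_zero] at this
  rw [← this]
  congr 1; funext t; congr 1; module

/-- The derivative of `g` along one side, integrated over all chords parallel to that side, leaves
the values of `g` on the other two sides. -/
lemma integral_fderiv_side {a b c : Plane} (h : cross (b - a) (c - a) ≠ 0) {g : Plane → ℝ}
    (hg : ContDiff ℝ 1 g) :
    ∫ x in convexHull ℝ {a, b, c}, fderiv ℝ g x (c - a) = |cross (b - a) (c - a)| *
      ((∫ t in (0 : ℝ)..1, g (b + t • (c - b))) - ∫ t in (0 : ℝ)..1, g (a + t • (b - a))) := by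
  have hc : Continuous fun x => fderiv ℝ g x (c - a) :=
    (hg.continuous_fderiv one_ne_zero).clm_apply continuous_const
  rw [integral_triangle h hc, integral_reverse g b c, ← intervalIntegral.integral_sub]
  · congr 2
    funext s
    have hder : ∀ t ∈ Set.uIcc (0 : ℝ) (1 - s),
        HasDerivAt (fun t : ℝ => g (a + s • (b - a) + t • (c - a)))
          (fderiv ℝ g (a + s • (b - a) + t • (c - a)) (c - a)) t := by
      intro t _
      have h1 : HasDerivAt (fun t : ℝ => a + s • (b - a) + t • (c - a)) (c - a) t := by
        simpa using ((hasDerivAt_id t).smul_const (c - a)).const_add (a + s • (b - a))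
      exact ((hg.differentiable one_ne_zero) _).hasFDerivAt.comp_hasDerivAt t h1
    rw [intervalIntegral.integral_eq_sub_of_hasDerivAt hder
      (Continuous.intervalIntegrable (by fun_prop) _ _)]
    congr 2
    · module
    · simp
  · have := hg.continuous
    exact Continuous.intervalIntegrable (by fun_prop) _ _
  · have := hg.continuous
    exact Continuous.intervalIntegrable (by fun_prop) _ _

lemma powersetCard_two_triple [DecidableEq Plane] {a b c : Plane} (hab : a ≠ b) (hac : a ≠ c)
    (hbc : b ≠ c) :
    ({a, b, c} : Finset Plane).powersetCard 2 = {{a, b}, {b, c}, {c, a}} := by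
  have h1 : ({a, b} : Finset Plane) ≠ {b, c} := fun h => by
    have : a ∈ ({b, c} : Finset Plane) := h ▸ by simp
    simp [hab, hac] at this
  have h2 : ({a, b} : Finset Plane) ≠ {c, a} := fun h => by
    have : b ∈ ({c, a} : Finset Plane) := h ▸ by simp
    simp [hab.symm, hbc] at this
  have h3 : ({b, c} : Finset Plane) ≠ {c, a} := fun h => by
    have : b ∈ ({c, a} : Finset Plane) := h ▸ by simp
    simp [hab.symm, hbc] at this
  symm
  refine Finset.eq_of_subset_of_card_le ?_ ?_
  · intro e he
    simp only [Finset.mem_insert, Finset.mem_singleton] at he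
    rw [Finset.mem_powersetCard]
    rcases he with rfl | rfl | rfl
    · exact ⟨by intro x; simp; tauto, Finset.card_pair hab⟩
    · exact ⟨by intro x; simp; tauto, Finset.card_pair hbc⟩
    · exact ⟨by intro x; simp; tauto, Finset.card_pair hac.symm⟩
  · rw [Finset.card_powersetCard, Finset.card_eq_three.2 ⟨a, b, c, hab, hac, hbc, rfl⟩,
      Finset.card_eq_three.2 ⟨_, _, _, h1, h2, h3, rfl⟩]
    decide

lemma triple_rotate [DecidableEq Plane] (a b c : Plane) :
    ({a, b, c} : Finset Plane) = {b, c, a} := by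
  ext x; simp; tauto

lemma integral_edge_flux [DecidableEq Plane] {a b c : Plane} (h : cross (b - a) (c - a) ≠ 0)
    (g : Plane → ℝ) (w : Plane) :
    ∫ x in simplex {a, b}, g x * inner ℝ w (outN {a, b, c} {a, b}) ∂arcLength =
      -(SignType.sign (cross (b - a) (c - a)) * cross (b - a) w) *
        ∫ t in (0 : ℝ)..1, g (a + t • (b - a)) := by
  have hab : a ≠ b := by rintro rfl; simp [cross] at h
  rw [integral_mul_const, integral_edge hab, ← inner_isOutN h (outN_spec h)]
  ring

/-- The vertices of a nondegenerate triangle, listed. -/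
lemma exists_vertices [DecidableEq Plane] {K : Finset Plane} (hcard : K.card = 3)
    (hind : AffineIndependent ℝ ((↑) : K → Plane)) :
    ∃ a b c, a ≠ b ∧ a ≠ c ∧ b ≠ c ∧ K = {a, b, c} ∧ cross (b - a) (c - a) ≠ 0 := by
  obtain ⟨a, b, c, hab, hac, hbc, rfl⟩ := Finset.card_eq_three.1 hcard
  exact ⟨a, b, c, hab, hac, hbc, rfl, cross_ne_zero hab hac hbc hind⟩

lemma eq_frame_combination {u v : Plane} (h : cross u v ≠ 0) (w : Plane) :
    w = (cross w v / cross u v) • u + (cross u w / cross u v) • v := by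
  have e : cross u v • w = cross w v • u + cross u w • v := by
    ext i
    fin_cases i <;> simp [cross] <;> ring
  rw [div_eq_inv_mul, div_eq_inv_mul, mul_smul, mul_smul, ← smul_add, ← e, inv_smul_smul₀ h]

/-- The divergence theorem on a triangle, for a field with constant direction `w`. The vector `w` is
decomposed along two sides of the triangle. -/
theorem integral_fderiv_triangle {K : Finset Plane} (hcard : K.card = 3)
    (hind : AffineIndependent ℝ ((↑) : K → Plane)) {g : Plane → ℝ} (hg : ContDiff ℝ 1 g)
    (w : Plane) :
    ∫ x in simplex K, fderiv ℝ g x w =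
      ∑ e ∈ K.powersetCard 2, ∫ x in simplex e, g x * inner ℝ w (outN K e) ∂arcLength := by
  classical
  obtain ⟨a, b, c, hab, hac, hbc, rfl, h⟩ := exists_vertices hcard hind
  have hK : simplex {a, b, c} = convexHull ℝ {a, b, c} := by simp [simplex]
  have hK' : convexHull ℝ {a, b, c} = convexHull ℝ {a, c, b} := by
    congr 1; ext x; simp; tauto
  have h2 : cross (c - b) (a - b) ≠ 0 := by rwa [cross_rotate]
  have h3 : cross (a - c) (b - c) ≠ 0 := by rwa [cross_rotate]
  have hX := integral_fderiv_side (a := a) (b := c) (c := b) (g := g)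
    (fun h' => h (by unfold cross at h' ⊢; linarith)) hg
  have hY := integral_fderiv_side h hg
  rw [← hK', ← hK] at hX
  rw [← hK] at hY
  have hint : ∀ v, IntegrableOn (fun x => fderiv ℝ g x v) (simplex {a, b, c}) := fun v => by
    refine ContinuousOn.integrableOn_compact ?_ ?_
    · exact isCompact_simplex _
    · exact ((hg.continuous_fderiv one_ne_zero).clm_apply continuous_const).continuousOn
  set D := cross (b - a) (c - a) with hD
  have hw : w = (cross w (c - a) / D) • (b - a) + (cross (b - a) w / D) • (c - a) :=
    eq_frame_combination h w
  have hLHS : ∫ x in simplex {a, b, c}, fderiv ℝ g x w =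
      cross w (c - a) / D * (∫ x in simplex {a, b, c}, fderiv ℝ g x (b - a)) +
      cross (b - a) w / D * ∫ x in simplex {a, b, c}, fderiv ℝ g x (c - a) := by
    rw [← integral_const_mul, ← integral_const_mul, ← integral_add
      ((hint _).const_mul _) ((hint _).const_mul _)]
    congr 1; funext x
    conv_lhs => rw [hw]
    simp
  have hne : ({a, b} : Finset Plane) ≠ {b, c} := fun h => by
    have : a ∈ ({b, c} : Finset Plane) := h ▸ by simp
    simp [hab, hac] at this
  have hne2 : ({a, b} : Finset Plane) ≠ {c, a} := fun h => by
    have : b ∈ ({c, a} : Finset Plane) := h ▸ by simp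
    simp [hab.symm, hbc] at this
  have hne3 : ({b, c} : Finset Plane) ≠ {c, a} := fun h => by
    have : b ∈ ({c, a} : Finset Plane) := h ▸ by simp
    simp [hab.symm, hbc] at this
  rw [powersetCard_two_triple hab hac hbc, Finset.sum_insert (by simp [hne, hne2]),
    Finset.sum_insert (by simp [hne3]), Finset.sum_singleton, integral_edge_flux h]
  have e2 := integral_edge_flux h2 g w
  have e3 := integral_edge_flux h3 g w
  rw [← triple_rotate, cross_rotate] at e2
  rw [← triple_rotate, ← triple_rotate, cross_rotate, cross_rotate] at e3
  rw [e2, e3, hLHS, hX, hY, ← hD]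
  rw [show cross (c - a) (b - a) = -D by simp [hD, cross]; ring, abs_neg,
    integral_reverse g c b, integral_reverse g a c]
  have hs : |D| = SignType.sign D * D := (sign_mul_self D).symm
  rw [hs, show cross (c - b) w = cross (c - a) w - cross (b - a) w by simp [cross]; ring,
    show cross (a - c) w = -cross (c - a) w by simp [cross]; ring,
    show cross w (c - a) = -cross (c - a) w by simp [cross]; ring]
  field_simp
  ring

/-- The classical divergence of a plane vector field. -/
def divg (F : Plane → Plane) (x : Plane) : ℝ :=
  fderiv ℝ (fun y => F y 0) x (EuclideanSpace.single 0 1) +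
    fderiv ℝ (fun y => F y 1) x (EuclideanSpace.single 1 1)

lemma ContDiff.coord {n : WithTop ℕ∞} {F : Plane → Plane} (hF : ContDiff ℝ n F) (i : Fin 2) :
    ContDiff ℝ n (fun y => F y i) := by
  fun_prop

lemma continuous_divg {F : Plane → Plane} (hF : ContDiff ℝ 1 F) : Continuous (divg F) :=
  (((ContDiff.coord hF 0).continuous_fderiv one_ne_zero).clm_apply continuous_const).add
    (((ContDiff.coord hF 1).continuous_fderiv one_ne_zero).clm_apply continuous_const)

lemma integrableOn_edge_of_continuous [DecidableEq Plane] {e : Finset Plane} (he : e.card = 2)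
    {f : Plane → ℝ} (hf : Continuous f) : IntegrableOn f (simplex e) arcLength := by
  obtain ⟨a, b, hab, rfl⟩ := Finset.card_eq_two.1 he
  have hfin : arcLength (simplex {a, b}) < ⊤ := by
    simp [simplex, convexHull_pair, arcLength, hausdorffMeasure_segment, edist_lt_top]
  obtain ⟨C, hC⟩ := (isCompact_simplex {a, b}).exists_bound_of_continuousOn hf.continuousOn
  exact IntegrableOn.of_bound hfin hf.aestronglyMeasurable C
    ((ae_restrict_iff' (isCompact_simplex _).measurableSet).2 (.of_forall hC))

/-- The divergence theorem on a triangle. -/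
theorem integral_divg_triangle {K : Finset Plane} (hcard : K.card = 3)
    (hind : AffineIndependent ℝ ((↑) : K → Plane)) {F : Plane → Plane} (hF : ContDiff ℝ 1 F) :
    ∫ x in simplex K, divg F x =
      ∑ e ∈ K.powersetCard 2, ∫ x in simplex e, inner ℝ (F x) (outN K e) ∂arcLength := by
  classical
  have hint : ∀ (i : Fin 2) (v : Plane),
      IntegrableOn (fun x => fderiv ℝ (fun y => F y i) x v) (simplex K) := fun i v =>
    ContinuousOn.integrableOn_compact (isCompact_simplex K)
      (((ContDiff.coord hF i).continuous_fderiv one_ne_zero).clm_apply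
        continuous_const).continuousOn
  unfold divg
  rw [integral_add (hint _ _) (hint _ _),
    integral_fderiv_triangle hcard hind (ContDiff.coord hF 0),
    integral_fderiv_triangle hcard hind (ContDiff.coord hF 1), ← Finset.sum_add_distrib]
  refine Finset.sum_congr rfl fun e he => ?_
  have hc := (Finset.mem_powersetCard.1 he).2
  have hi : ∀ (i : Fin 2) (r : ℝ), IntegrableOn (fun x => F x i * r) (simplex e) arcLength :=
    fun i r => integrableOn_edge_of_continuous hc
      ((ContDiff.coord hF i).continuous.mul continuous_const)
  rw [← integral_add (hi _ _) (hi _ _)]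
  congr 1; funext x
  simp [inner_coord]

/-! ### Combinatorics and measure of conforming meshes -/

/-- The vertices of a triangle, with those of a given edge listed first. -/
lemma exists_label [DecidableEq Plane] {K e : Finset Plane} (hcard : K.card = 3)
    (hind : AffineIndependent ℝ ((↑) : K → Plane)) (he : e ⊆ K) (he2 : e.card = 2) :
    ∃ a b c, e = {a, b} ∧ K = {a, b, c} ∧ cross (b - a) (c - a) ≠ 0 := by
  obtain ⟨a, b, hab, rfl⟩ := Finset.card_eq_two.1 he2
  have h1 : (K \ {a, b}).card = 1 := by
    rw [Finset.card_sdiff_of_subset he, hcard, he2]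
  obtain ⟨c, hc⟩ := Finset.card_eq_one.1 h1
  have hcK : c ∈ K \ {a, b} := by rw [hc]; simp
  simp only [Finset.mem_sdiff, Finset.mem_insert, Finset.mem_singleton, not_or] at hcK
  have hK : K = {a, b, c} := by
    rw [← Finset.sdiff_union_of_subset he, hc]
    ext x; simp; tauto
  subst hK
  exact ⟨a, b, c, rfl, rfl, cross_ne_zero hab (Ne.symm hcK.2.1) (Ne.symm hcK.2.2) hind⟩

lemma isOutN_neg [DecidableEq Plane] {a b c d n : Plane}
    (h : cross (b - a) (c - a) * cross (b - a) (d - a) < 0) (hn : IsOutN {a, b, c} {a, b} n) :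
    IsOutN {a, b, d} {a, b} (-n) := by
  have hc : cross (b - a) (c - a) ≠ 0 := by rintro h0; simp [h0] at h
  have hab : 0 < ‖b - a‖ := by
    rw [norm_pos_iff]; intro h0; simp [h0, cross] at h
  have hw := inner_isOutN hc hn
  refine ⟨by simpa using hn.1, fun x hx y hy => by simpa using hn.2.1 x hx y hy, ?_⟩
  have hd : 0 ≤ inner ℝ (d - a) n := by
    refine nonneg_of_mul_nonneg_right ?_ hab
    rw [hw]
    rcases lt_or_gt_of_ne hc with h' | h'
    · simp [h']; nlinarith
    · simp [h']; nlinarith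
  intro x hx y hy
  have hxa : inner ℝ (x - a) n = 0 := hn.2.1 a (by simp) x hx
  have hya : 0 ≤ inner ℝ (y - a) n := by
    simp only [Finset.mem_insert, Finset.mem_singleton] at hy
    rcases hy with rfl | rfl | rfl
    · simp
    · exact (hn.2.1 a (by simp) _ (by simp)).ge
    · exact hd
  rw [show y - x = (y - a) - (x - a) by abel, inner_neg_right, inner_sub_left, hxa]
  linarith

namespace TriMesh
variable (M : TriMesh)

open Classical in
/-- Two elements sharing an edge lie on opposite sides of it: otherwise they would overlap near the
midpoint of the edge, against conformity. -/
lemma opposite_sides {a b c d : Plane} (hK : {a, b, c} ∈ M.elems) (hL : {a, b, d} ∈ M.elems)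
    (hc : cross (b - a) (c - a) ≠ 0) (hd : cross (b - a) (d - a) ≠ 0) (hcd : c ≠ d) :
    cross (b - a) (c - a) * cross (b - a) (d - a) < 0 := by
  by_contra! hcon
  set u := b - a with hu
  set D := cross u (c - a) with hD
  set D' := cross u (d - a) with hD'
  have hpos : 0 < D * D' := lt_of_le_of_ne hcon (mul_ne_zero hc hd).symm
  set α := cross (c - a) (d - a) / D'
  set β := D / D'
  have hβ : 0 < β := by
    rw [show β = D * D' / D' ^ 2 by simp only [β]; field_simp]; positivity
  have hca : c - a = α • u + β • (d - a) := eq_frame_combination hd _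
  set s := 1 / (2 * (1 + |α| + β)) with hs
  have hden : 0 < 1 + |α| + β := by positivity
  have hs0 : 0 < s := by positivity
  have hs1 : s * (1 + |α| + β) = 1 / 2 := by rw [hs]; field_simp
  have hsα : |s * α| = s * |α| := by rw [abs_mul, abs_of_pos hs0]
  have hα := abs_le.1 hsα.le
  have hsp : 0 ≤ s * |α| := by positivity
  have hsb : 0 < s * β := by positivity
  -- For this small `s`, the point `p` close to the midpoint of the edge lies in both triangles.
  set p := a + (1 / 2 : ℝ) • u + s • (c - a) with hp
  have hpK : p ∈ simplex {a, b, c} := by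
    simp only [simplex, Finset.coe_insert, Finset.coe_singleton, mem_triangle]
    exact ⟨1 / 2, s, by norm_num, hs0.le, by linarith, rfl⟩
  have hpL : p ∈ simplex {a, b, d} := by
    simp only [simplex, Finset.coe_insert, Finset.coe_singleton, mem_triangle]
    refine ⟨1 / 2 + s * α, s * β, by linarith, hsb.le, by linarith, ?_⟩
    rw [hp, hca]; module
  have hpe : p ∈ simplex {a, b} := by
    have := (M.conforming _ hK _ hL).subset (⟨hpK, hpL⟩ : p ∈ simplex {a, b, c} ∩ simplex {a, b, d})
    refine convexHull_mono ?_ this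
    rintro x ⟨hx1, hx2⟩
    simp only [Finset.coe_insert, Finset.coe_singleton, Set.mem_insert_iff,
      Set.mem_singleton_iff] at hx1 hx2 ⊢
    rcases hx1 with h | h | h
    · exact Or.inl h
    · exact Or.inr h
    · rcases hx2 with h' | h' | h'
      · exact Or.inl h'
      · exact Or.inr h'
      · exact absurd (h.symm.trans h') hcd
  obtain ⟨t, -, ht⟩ := mem_simplex_pair.1 hpe
  have h0 : s • (c - a) = (t - 1 / 2) • u := by
    rw [sub_smul, eq_sub_iff_add_eq, add_comm]
    rw [hp, add_assoc] at ht
    exact add_left_cancel ht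
  have h1 : s * D = 0 := by
    rw [hD, show s * cross u (c - a) = cross u (s • (c - a)) by simp [cross]; ring, h0]
    simp [cross]; ring
  exact (mul_ne_zero hs0.ne' hc) h1

variable {M}

lemma mem_edges {e : Finset Plane} :
    e ∈ M.edges ↔ ∃ K ∈ M.elems, e ⊆ K ∧ e.card = 2 := by
  simp [edges, Finset.mem_powersetCard]

lemma sides_spec {e : Finset Plane} (h : M.IsInterior e) :
    (M.sides e).1 ∈ M.elems ∧ (M.sides e).2 ∈ M.elems ∧ (M.sides e).1 ≠ (M.sides e).2 ∧
      e ⊆ (M.sides e).1 ∧ e ⊆ (M.sides e).2 := by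
  rw [sides, dif_pos h]; exact h.choose_spec

lemma elem_spec {e : Finset Plane} (h : e ∈ M.edges) : M.elem e ∈ M.elems ∧ e ⊆ M.elem e := by
  obtain ⟨K, hK, heK, -⟩ := mem_edges.1 h
  have h : ∃ K ∈ M.elems, e ⊆ K := ⟨K, hK, heK⟩
  rw [elem, dif_pos h]; exact h.choose_spec

lemma isOutN_outN {K e : Finset Plane} (hK : K ∈ M.elems) (he : e ⊆ K) (he2 : e.card = 2) :
    IsOutN K e (outN K e) := by
  classical
  obtain ⟨a, b, c, rfl, rfl, h⟩ := exists_label (M.card_eq K hK) (M.indep K hK) he he2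
  exact outN_spec h

lemma outN_opposite {K L e : Finset Plane} (hK : K ∈ M.elems) (hL : L ∈ M.elems) (hKL : K ≠ L)
    (heK : e ⊆ K) (heL : e ⊆ L) (he2 : e.card = 2) : outN L e = -outN K e := by
  classical
  obtain ⟨a, b, c, rfl, rfl, h⟩ := exists_label (M.card_eq K hK) (M.indep K hK) heK he2
  obtain ⟨a', b', d, hab, rfl, h'⟩ := exists_label (M.card_eq L hL) (M.indep L hL) heL he2
  have hL' : ({a', b', d} : Finset Plane) = {a, b, d} := by
    rw [show ({a', b', d} : Finset Plane) = {a', b'} ∪ {d} by ext x; simp, ← hab]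
    ext x; simp
  have h'' : cross (b - a) (d - a) ≠ 0 := by
    refine cross_ne_zero ?_ ?_ ?_ (hL' ▸ M.indep _ hL)
    · rintro rfl; simp [cross] at h
    · rintro rfl
      have := M.card_eq _ hL
      rw [hL'] at this
      have h3 : ({a, b, a} : Finset Plane).card ≤ 2 := by
        rw [show ({a, b, a} : Finset Plane) = {a, b} by ext x; simp; tauto]
        exact Finset.card_le_two
      omega
    · rintro rfl
      have := M.card_eq _ hL
      rw [hL'] at this
      have h3 : ({a, b, b} : Finset Plane).card ≤ 2 := by
        rw [show ({a, b, b} : Finset Plane) = {a, b} by ext x; simp]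
        exact Finset.card_le_two
      omega
  rw [hL'] at hL hKL ⊢
  have hcd : c ≠ d := by rintro rfl; exact hKL rfl
  exact (isOutN_neg (M.opposite_sides hK hL h h'' hcd) (outN_spec h)).unique h'' (outN_spec h'') |>.symm

/-- An edge belongs to at most two elements, since three unit normals cannot be pairwise opposite. -/
lemma eq_or_eq_of_edge {K L T e : Finset Plane} (hK : K ∈ M.elems) (hL : L ∈ M.elems)
    (hT : T ∈ M.elems) (hKL : K ≠ L) (heK : e ⊆ K) (heL : e ⊆ L) (heT : e ⊆ T)
    (he2 : e.card = 2) : T = K ∨ T = L := by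
  by_contra! hcon
  have h1 := outN_opposite hK hL hKL heK heL he2
  have h2 := outN_opposite hT hK hcon.1 heT heK he2
  have h3 := outN_opposite hT hL hcon.2 heT heL he2
  have h4 : outN K e = 0 := by
    have : outN K e = -outN K e := by rw [← h1, h3, h2]
    simpa [← two_smul ℝ] using eq_neg_iff_add_eq_zero.1 this
  have := (isOutN_outN hK heK he2).1
  simp [h4] at this

lemma mem_intEdges {e : Finset Plane} : e ∈ M.intEdges ↔ e.card = 2 ∧ M.IsInterior e := by
  classical
  rw [intEdges, Finset.mem_filter, mem_edges]
  constructor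
  · rintro ⟨⟨K, -, -, h⟩, h'⟩; exact ⟨h, h'⟩
  · rintro ⟨h, h'⟩
    obtain ⟨s, h1, -, -, h2, -⟩ := id h'
    exact ⟨⟨s.1, h1, h2, h⟩, h'⟩

lemma mem_bdryEdges {e : Finset Plane} : e ∈ M.bdryEdges ↔ e ∈ M.edges ∧ ¬ M.IsInterior e := by
  classical
  rw [bdryEdges, Finset.mem_filter]

lemma card_of_mem_edges {e : Finset Plane} (h : e ∈ M.edges) : e.card = 2 := by
  obtain ⟨-, -, -, h⟩ := mem_edges.1 h; exact h

/-- A sum over the edges of all elements has one term for each boundary edge and two for each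
interior edge. -/
lemma sum_elems_edges (I : Finset Plane → Finset Plane → ℝ) :
    ∑ K ∈ M.elems, ∑ e ∈ K.powersetCard 2, I K e =
      ∑ e ∈ M.bdryEdges, I (M.elem e) e +
        ∑ e ∈ M.intEdges, (I (M.sides e).1 e + I (M.sides e).2 e) := by
  classical
  have h1 : ∑ K ∈ M.elems, ∑ e ∈ K.powersetCard 2, I K e =
      ∑ e ∈ M.edges, ∑ K ∈ M.elems.filter (e ⊆ ·), I K e := by
    refine Finset.sum_comm' fun K e => ?_
    rw [Finset.mem_powersetCard, Finset.mem_filter, mem_edges]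
    exact ⟨fun ⟨hK, he, h2⟩ => ⟨⟨hK, he⟩, K, hK, he, h2⟩,
      fun ⟨⟨hK, he⟩, L, hL, _, h2⟩ => ⟨hK, he, h2⟩⟩
  rw [h1, ← Finset.sum_filter_not_add_sum_filter M.edges (fun e => M.IsInterior e)]
  congr 1
  · refine Finset.sum_congr rfl fun e he => ?_
    obtain ⟨he, hi⟩ := mem_bdryEdges.1 he
    obtain ⟨hE, heE⟩ := elem_spec he
    have : M.elems.filter (e ⊆ ·) = {M.elem e} := by
      ext T
      rw [Finset.mem_filter, Finset.mem_singleton]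
      constructor
      · rintro ⟨hT, heT⟩
        by_contra hne
        exact hi ⟨(T, M.elem e), hT, hE, hne, heT, heE⟩
      · rintro rfl; exact ⟨hE, heE⟩
    rw [this, Finset.sum_singleton]
  · refine Finset.sum_congr rfl fun e he => ?_
    obtain ⟨he2, hi⟩ := mem_intEdges.1 he
    obtain ⟨h1, h2, hne, he1, he2'⟩ := sides_spec hi
    have : M.elems.filter (e ⊆ ·) = {(M.sides e).1, (M.sides e).2} := by
      ext T
      rw [Finset.mem_filter, Finset.mem_insert, Finset.mem_singleton]
      constructor
      · rintro ⟨hT, heT⟩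
        exact eq_or_eq_of_edge h1 h2 hT hne he1 he2' heT he2
      · rintro (rfl | rfl)
        exacts [⟨h1, he1⟩, ⟨h2, he2'⟩]
    rw [this, Finset.sum_pair hne]

/-- The divergence theorem for a piecewise smooth field on a mesh. -/
theorem sum_integral_divg {G : Finset Plane → Plane → Plane}
    (hG : ∀ K ∈ M.elems, ContDiff ℝ 1 (G K)) :
    ∑ K ∈ M.elems, ∫ x in simplex K, divg (G K) x =
      ∑ e ∈ M.bdryEdges, ∫ x in simplex e, inner ℝ (G (M.elem e) x) (M.normal e) ∂arcLength +
      ∑ e ∈ M.intEdges, ∫ x in simplex e,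
        inner ℝ (G (M.sides e).1 x - G (M.sides e).2 x) (outN (M.sides e).1 e) ∂arcLength := by
  classical
  rw [Finset.sum_congr rfl fun K hK =>
    integral_divg_triangle (M.card_eq K hK) (M.indep K hK) (hG K hK), sum_elems_edges]
  congr 1
  refine Finset.sum_congr rfl fun e he => ?_
  obtain ⟨he2, hi⟩ := mem_intEdges.1 he
  obtain ⟨h1, h2, hne, he1, he2'⟩ := sides_spec hi
  have c1 := (hG _ h1).continuous
  have c2 := (hG _ h2).continuous
  rw [outN_opposite h1 h2 hne he1 he2' he2, ← integral_add
    (integrableOn_edge_of_continuous he2 (c1.inner continuous_const))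
    (integrableOn_edge_of_continuous he2 (c2.inner continuous_const))]
  congr 1; funext x
  rw [inner_sub_left, inner_neg_right, sub_eq_add_neg]

variable (M)

/-- The closed set covered by the mesh. -/
def cover : Set Plane := ⋃ K ∈ M.elems, simplex K

lemma isClosed_cover : IsClosed M.cover :=
  M.elems.finite_toSet.isClosed_biUnion fun K _ => (isCompact_simplex K).isClosed

lemma isCompact_cover : IsCompact M.cover :=
  M.elems.finite_toSet.isCompact_biUnion fun K _ => isCompact_simplex K

lemma domain_subset_cover : M.domain ⊆ M.cover := interior_subset

lemma isOpen_domain : IsOpen M.domain := isOpen_interior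

variable {M}

lemma simplex_subset_cover {K : Finset Plane} (hK : K ∈ M.elems) : simplex K ⊆ M.cover :=
  Set.subset_biUnion_of_mem (u := fun K => simplex K) hK

lemma interior_simplex_subset_domain {K : Finset Plane} (hK : K ∈ M.elems) :
    interior (simplex K) ⊆ M.domain := interior_mono (simplex_subset_cover hK)

lemma inter_subset_edge {K L : Finset Plane} [DecidableEq Plane] (hK : K ∈ M.elems)
    (hL : L ∈ M.elems) (hKL : K ≠ L) :
    ∃ e, K ∩ L ⊆ e ∧ e ⊆ K ∧ e.card = 2 := by
  have h1 := M.card_eq K hK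
  have h2 := M.card_eq L hL
  refine Finset.exists_subsuperset_card_eq Finset.inter_subset_left ?_ (by omega)
  by_contra! hcon
  have e1 : K ∩ L = K := Finset.eq_of_subset_of_card_le Finset.inter_subset_left (by omega)
  have e2 : K ∩ L = L := Finset.eq_of_subset_of_card_le Finset.inter_subset_right (by omega)
  exact hKL (e1.symm.trans e2)

lemma volume_edge {e : Finset Plane} (he : e.card = 2) : volume (simplex e) = 0 := by
  classical
  obtain ⟨a, b, hab, rfl⟩ := Finset.card_eq_two.1 he
  have h1 : simplex {a, b} ⊆ (affineSpan ℝ ({a, b} : Set Plane) : Set Plane) := by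
    simpa [simplex] using convexHull_subset_affineSpan (𝕜 := ℝ) ({a, b} : Set Plane)
  refine measure_mono_null h1 (Measure.addHaar_affineSubspace _ _ fun htop => ?_)
  have h2 := (collinear_iff_finrank_le_one (k := ℝ)).1 (collinear_pair ℝ a b)
  rw [← direction_affineSpan, htop, AffineSubspace.direction_top, finrank_top] at h2
  simp at h2

lemma volume_inter {K L : Finset Plane} (hK : K ∈ M.elems) (hL : L ∈ M.elems) (hKL : K ≠ L) :
    volume (simplex K ∩ simplex L) = 0 := by
  classical
  obtain ⟨e, h1, -, h2⟩ := inter_subset_edge hK hL hKL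
  rw [M.conforming K hK L hL]
  refine measure_mono_null (convexHull_mono ?_) (volume_edge h2)
  exact_mod_cast h1

lemma restrict_cover : (volume : Measure Plane).restrict M.cover =
    ∑ K ∈ M.elems, volume.restrict (simplex K) := by
  classical
  have h1 : M.cover = ⋃ K : M.elems, simplex K := by
    simp [cover, Set.iUnion_subtype]
  rw [h1, Measure.restrict_iUnion_ae, Measure.sum_fintype,
    Finset.sum_coe_sort M.elems (fun K => (volume : Measure Plane).restrict (simplex K))]
  · intro K L hKL
    exact volume_inter K.2 L.2 fun h => hKL (Subtype.ext h)
  · exact fun K => (isCompact_simplex _).measurableSet.nullMeasurableSet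

lemma domain_ae_eq_cover : M.domain =ᵐ[volume] M.cover := by
  refine M.domain_subset_cover.eventuallyLE.antisymm ?_
  rw [ae_le_set]
  refine measure_mono_null (t := ⋃ K ∈ M.elems, frontier (simplex K)) ?_ ?_
  · rintro x ⟨hx, hxD⟩
    simp only [cover, Set.mem_iUnion] at hx ⊢
    obtain ⟨K, hK, hxK⟩ := hx
    exact ⟨K, hK, subset_closure hxK, fun h => hxD (interior_simplex_subset_domain hK h)⟩
  · exact (measure_biUnion_null_iff M.elems.countable_toSet).2
      fun K _ => (convex_convexHull ℝ _).addHaar_frontier volume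

lemma restrict_domain : (volume : Measure Plane).restrict M.domain =
    ∑ K ∈ M.elems, volume.restrict (simplex K) := by
  rw [Measure.restrict_congr_set domain_ae_eq_cover, restrict_cover]

lemma integral_domain {f : Plane → ℝ} (hf : ∀ K ∈ M.elems, IntegrableOn f (simplex K)) :
    ∫ x in M.domain, f x = ∑ K ∈ M.elems, ∫ x in simplex K, f x := by
  rw [restrict_domain, integral_finsetSum_measure hf]

/-- Two elements that share a point that is no vertex share an edge. -/
lemma edge_of_common_point {K L : Finset Plane} (hK : K ∈ M.elems) (hL : L ∈ M.elems)
    (hKL : K ≠ L) {x : Plane} (hxK : x ∈ simplex K) (hxL : x ∈ simplex L) (hx : x ∉ K) :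
    ∃ e ∈ M.intEdges, e ⊆ K ∧ e ⊆ L := by
  classical
  have hx' : x ∈ convexHull ℝ ((K : Set Plane) ∩ L) := M.conforming K hK L hL ▸ ⟨hxK, hxL⟩
  rw [← Finset.coe_inter] at hx'
  have h2 : 2 ≤ (K ∩ L).card := by
    by_contra! hcon
    have hsub : ((K ∩ L : Finset Plane) : Set Plane).Subsingleton := by
      rw [← Set.encard_le_one_iff_subsingleton, Set.encard_coe_eq_coe_finsetCard]
      exact_mod_cast Nat.lt_succ_iff.1 hcon
    have hx'' : x ∈ ((K ∩ L : Finset Plane) : Set Plane) := by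
      rcases hsub.eq_empty_or_singleton with h | ⟨y, h⟩
      · rw [h, convexHull_empty] at hx'; exact hx'.elim
      · rw [h, convexHull_singleton] at hx'; rwa [h]
    exact hx (Finset.mem_inter.1 (by exact_mod_cast hx'')).1
  obtain ⟨e, he, he2⟩ := Finset.exists_subset_card_eq h2
  have h3 := he.trans Finset.inter_subset_left
  have h4 := he.trans Finset.inter_subset_right
  exact ⟨e, mem_intEdges.2 ⟨he2, (K, L), hK, hL, hKL, h3, h4⟩, h3, h4⟩

end TriMesh

/-! ### Moving inside the polygonal domain -/

lemma divg_smul {φ : Plane → ℝ} {F : Plane → Plane} (hφ : ContDiff ℝ 1 φ) (hF : ContDiff ℝ 1 F)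
    (x : Plane) : divg (fun y => φ y • F y) x = φ x * divg F x + fderiv ℝ φ x (F x) := by
  have h1 := (hφ.differentiable one_ne_zero) x
  have h2 : ∀ i, DifferentiableAt ℝ (fun y => F y i) x := fun i =>
    ((ContDiff.coord hF i).differentiable one_ne_zero) x
  have h3 : F x = F x 0 • EuclideanSpace.single 0 (1 : ℝ) + F x 1 • EuclideanSpace.single 1 1 := by
    ext i; fin_cases i <;> simp
  unfold divg
  simp only [PiLp.smul_apply, smul_eq_mul]
  rw [fderiv_fun_mul h1 (h2 0), fderiv_fun_mul h1 (h2 1)]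
  conv_rhs => rw [h3]
  simp only [add_apply, smul_apply, smul_eq_mul, map_add,
    map_smul]
  ring

lemma divg_smul_const {φ : Plane → ℝ} (hφ : ContDiff ℝ 1 φ) (w x : Plane) :
    divg (fun y => φ y • w) x = fderiv ℝ φ x w := by
  rw [divg_smul hφ contDiff_const]
  simp [divg]

namespace TriMesh
variable {M : TriMesh}

lemma hasDerivAt_integral_translate (K : Finset Plane) {g : Plane → ℝ} (hg : ContDiff ℝ 1 g)
    (hgc : HasCompactSupport g) (w : Plane) (s : ℝ) :
    HasDerivAt (fun s : ℝ => ∫ y in simplex K, g (y + s • w))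
      (∫ y in simplex K, fderiv ℝ g (y + s • w) w) s := by
  have hfin : IsFiniteMeasure ((volume : Measure Plane).restrict (simplex K)) :=
    ⟨by simpa using (isCompact_simplex K).measure_lt_top⟩
  have hc1 : Continuous fun y => fderiv ℝ g y w :=
    (hg.continuous_fderiv one_ne_zero).clm_apply continuous_const
  have hc := hg.continuous
  obtain ⟨C, hC⟩ := (hgc.fderiv (𝕜 := ℝ)).exists_bound_of_continuous
    (hg.continuous_fderiv one_ne_zero)
  refine (hasDerivAt_integral_of_dominated_loc_of_deriv_le (bound := fun _ => C * ‖w‖)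
    (F := fun s y => g (y + s • w)) (F' := fun s y => fderiv ℝ g (y + s • w) w)
    Filter.univ_mem (.of_forall fun s => ?_) ?_ ?_ ?_ ?_ ?_).2
  · exact Continuous.aestronglyMeasurable (by fun_prop)
  · exact (Continuous.continuousOn (by fun_prop)).integrableOn_compact (isCompact_simplex K)
  · exact Continuous.aestronglyMeasurable (by fun_prop)
  · exact .of_forall fun y s _ => (ContinuousLinearMap.le_opNorm _ _).trans (by gcongr; exact hC _)
  · exact integrable_const _
  · refine .of_forall fun y s _ => ?_
    have h1 : HasDerivAt (fun s : ℝ => y + s • w) w s := by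
      simpa using ((hasDerivAt_id s).smul_const w).const_add y
    exact ((hg.differentiable one_ne_zero) _).hasFDerivAt.comp_hasDerivAt s h1

/-- If the outward normal of the mesh does not point against `w` anywhere in the open set `U`, then
a segment inside `U` that starts in the domain and runs in direction `-w` stays in the domain. The
reason is that `∂_w 1_D = -⟪n_h, w⟫ dH¹ ≤ 0` on `U` as distributions. -/
theorem mem_domain_of_segment {U : Set Plane} (hUo : IsOpen U) {w : Plane}
    (hU : ∀ e ∈ M.bdryEdges, ∀ᵐ x ∂(arcLength.restrict (simplex e)),
      x ∈ U → 0 ≤ inner ℝ w (M.normal e))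
    {x : Plane} (hx : x ∈ M.domain) {t : ℝ} (ht : 0 ≤ t)
    (hseg : ∀ s ∈ Set.Icc (0 : ℝ) t, x - s • w ∈ U) : x - t • w ∈ M.domain := by
  obtain ⟨r₁, hr₁, hb₁⟩ := Metric.isOpen_iff.1 M.isOpen_domain x hx
  have hcpt : IsCompact ((fun s : ℝ => x - s • w) '' Set.Icc 0 t) :=
    isCompact_Icc.image (by fun_prop)
  obtain ⟨r₂, hr₂, hb₂⟩ := hcpt.exists_thickening_subset_open hUo
    (by rintro _ ⟨s, hs, rfl⟩; exact hseg s hs)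
  set r := min r₁ r₂
  have hr : 0 < r := lt_min hr₁ hr₂
  let g : ContDiffBump x := ⟨r / 2, r, by positivity, by linarith⟩
  have hg : ContDiff ℝ 1 g := g.contDiff
  have hgc : HasCompactSupport g := g.hasCompactSupport
  have hgcont := hg.continuous
  have hsupp : ∀ y, y ∉ Metric.ball x r → g y = 0 := fun y hy => by
    rw [← Function.notMem_support, g.support_eq]; exact hy
  -- `I s` is the integral over the mesh of the bump function translated by `-s w`.
  set I : ℝ → ℝ := fun s => ∑ K ∈ M.elems, ∫ y in simplex K, g (y + s • w) with hI
  have hder : ∀ s, HasDerivAt I (∑ K ∈ M.elems, ∫ y in simplex K, fderiv ℝ g (y + s • w) w) s :=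
    fun s => HasDerivAt.fun_sum fun K _ => hasDerivAt_integral_translate K hg hgc w s
  have hnn : ∀ s ∈ Set.Icc 0 t,
      0 ≤ ∑ K ∈ M.elems, ∫ y in simplex K, fderiv ℝ g (y + s • w) w := by
    intro s hs
    have hφ : ContDiff ℝ 1 fun y => g (y + s • w) := hg.comp (contDiff_id.add contDiff_const)
    have := sum_integral_divg (M := M) (G := fun _ y => g (y + s • w) • w)
      fun K _ => hφ.smul contDiff_const
    simp only [divg_smul_const hφ, fderiv_comp_add_right, sub_self, inner_zero_left,
      integral_zero, Finset.sum_const_zero, add_zero] at this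
    rw [this]
    refine Finset.sum_nonneg fun e he => integral_nonneg_of_ae ?_
    filter_upwards [hU e he] with y hy
    rw [real_inner_smul_left]
    by_cases hyU : y ∈ U
    · exact mul_nonneg g.nonneg (hy hyU)
    · rw [hsupp, zero_mul]
      · rfl
      · intro hyb
        apply hyU
        apply hb₂
        rw [Metric.mem_thickening_iff]
        refine ⟨x - s • w, ⟨s, hs, rfl⟩, ?_⟩
        rw [Metric.mem_ball, dist_eq_norm] at hyb
        rw [dist_eq_norm, show y - (x - s • w) = y + s • w - x by abel]
        exact hyb.trans_le (min_le_right _ _)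
  have hmono : I 0 ≤ I t := by
    refine monotoneOn_of_deriv_nonneg (convex_Icc 0 t)
      (fun s _ => (hder s).continuousAt.continuousWithinAt)
      (fun s _ => (hder s).differentiableAt.differentiableWithinAt)
      (fun s hs => ?_) (Set.left_mem_Icc.2 ht) (Set.right_mem_Icc.2 ht) ht
    rw [(hder s).deriv]
    exact hnn s (interior_subset hs)
  have hgi : Integrable g := hgcont.integrable_of_hasCompactSupport hgc
  have hgi' : Integrable fun y => g (y + t • w) := hgi.comp_add_right _
  have hIeq : ∀ s, I s = ∫ y in M.cover, g (y + s • w) := by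
    intro s
    rw [restrict_cover, integral_finsetSum_measure]
    exact fun K _ => (hgi.comp_add_right _).integrableOn
  have h0 : I 0 = ∫ y, g y := by
    rw [hIeq]
    simp only [zero_smul, add_zero]
    refine setIntegral_eq_integral_of_forall_compl_eq_zero fun y hy => hsupp y fun hyb => hy ?_
    exact M.domain_subset_cover (hb₁ (Metric.ball_subset_ball (min_le_left _ _) hyb))
  -- The bump starts inside the mesh and `I` does not decrease, so no mass of it leaves the mesh.
  have h1 : ∫ y in M.coverᶜ, g (y + t • w) ≤ 0 := by
    have e1 := integral_add_compl M.isClosed_cover.measurableSet hgi'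
    rw [integral_add_right_eq_self (μ := volume) (fun y => g y), ← h0, ← hIeq] at e1
    linarith
  have hsub : Metric.ball (x - t • w) r ⊆ M.cover := by
    intro y hy
    by_contra hyc
    have hpos : 0 < ∫ y in M.coverᶜ, g (y + t • w) := by
      rw [setIntegral_pos_iff_support_of_nonneg_ae (.of_forall fun y => g.nonneg) hgi'.integrableOn]
      refine IsOpen.measure_pos _ (IsOpen.inter ?_ M.isClosed_cover.isOpen_compl) ⟨y, ?_, hyc⟩
      · exact (by fun_prop : Continuous fun y => g (y + t • w)).isOpen_support
      · rw [Function.mem_support, ← Function.mem_support, g.support_eq]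
        rw [Metric.mem_ball, dist_eq_norm] at hy ⊢
        rwa [show y + t • w - x = y - (x - t • w) by abel]
    linarith
  exact interior_maximal hsub Metric.isOpen_ball (Metric.mem_ball_self hr)

/-- A segment that starts in the domain and avoids the boundary edges stays in the domain. -/
lemma mem_domain_of_avoids {x y : Plane} (hx : x ∈ M.domain)
    (h : ∀ z ∈ segment ℝ x y, z ∉ M.bdry) : y ∈ M.domain := by
  have hcl : IsClosed M.bdry :=
    M.bdryEdges.finite_toSet.isClosed_biUnion fun e _ => (isCompact_simplex e).isClosed
  have := mem_domain_of_segment (M := M) hcl.isOpen_compl (w := x - y) ?_ hx zero_le_one ?_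
  · simpa using this
  · intro e he
    rw [ae_restrict_iff' (isCompact_simplex e).measurableSet]
    exact .of_forall fun z hz hz' => absurd (Set.mem_biUnion he hz) hz'
  · intro s hs
    refine h _ ?_
    rw [segment_eq_image']
    exact ⟨s, hs, by module⟩

lemma interior_simplex_nonempty {K : Finset Plane} (hK : K ∈ M.elems) :
    (interior (simplex K)).Nonempty := by
  have h : affineSpan ℝ (Set.range ((↑) : K → Plane)) = ⊤ := by
    rw [(M.indep K hK).affineSpan_eq_top_iff_card_eq_finrank_add_one]
    simp [M.card_eq K hK]
  rw [Subtype.range_coe] at h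
  exact interior_convexHull_nonempty_iff_affineSpan_eq_top.2 h

lemma simplex_eq_closure_interior {K : Finset Plane} (hK : K ∈ M.elems) :
    simplex K = closure (interior (simplex K)) := by
  have := (convex_convexHull ℝ (K : Set Plane)).closure_interior_eq_closure_of_nonempty_interior
    (interior_simplex_nonempty hK)
  exact ((isCompact_simplex K).isClosed.closure_eq.symm.trans this.symm)

/-- A ball that avoids the boundary edges and is centred on the mesh is inside the domain. -/
lemma ball_subset_domain {x : Plane} (hx : x ∈ M.cover) {r : ℝ} (hr : 0 < r)
    (h : ∀ z ∈ Metric.ball x r, z ∉ M.bdry) : Metric.ball x r ⊆ M.domain := by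
  obtain ⟨K, hK, hxK⟩ := Set.mem_iUnion₂.1 hx
  rw [simplex_eq_closure_interior hK] at hxK
  obtain ⟨y, hyK, hy⟩ := Metric.mem_closure_iff.1 hxK r hr
  have hyD := interior_simplex_subset_domain hK hyK
  intro z hz
  refine mem_domain_of_avoids hyD fun p hp => h p ?_
  exact (convex_ball x r).segment_subset (Metric.mem_ball'.2 hy) hz hp

end TriMesh

/-! ### Weak divergence and normal continuity -/

lemma inner_gradient_eq (φ : Plane → ℝ) (x v : Plane) :
    inner ℝ v (gradient φ x) = fderiv ℝ φ x v := by
  rw [real_inner_comm, gradient, InnerProductSpace.toDual_symm_apply]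

lemma inner_le_zero_of_simplex {K e : Finset Plane} {n : Plane} (hn : IsOutN K e n) {x y : Plane}
    (hx : x ∈ simplex e) (hy : y ∈ simplex K) : inner ℝ (y - x) n ≤ 0 := by
  have h1 : ∀ x ∈ e, simplex K ⊆ {y | inner ℝ y n ≤ inner ℝ x n} := by
    intro x hx
    refine convexHull_min (fun y hy => ?_) ?_
    · have := hn.2.2 x hx y hy
      rw [inner_sub_left] at this
      exact sub_nonpos.1 this
    · exact convex_halfSpace_le ⟨fun a b => inner_add_left a b n,
        fun c a => real_inner_smul_left a n c⟩ _
  have h2 : simplex e ⊆ {x | inner ℝ y n ≤ inner ℝ x n} := by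
    refine convexHull_min (fun x hx => h1 x hx hy) ?_
    exact convex_halfSpace_ge ⟨fun a b => inner_add_left a b n,
        fun c a => real_inner_smul_left a n c⟩ _
  rw [inner_sub_left, sub_nonpos]
  exact h2 hx

lemma edge_disjoint_interior {K e : Finset Plane} {n : Plane} (hn : IsOutN K e n) {x : Plane}
    (hx : x ∈ simplex e) : x ∉ interior (simplex K) := by
  intro hxi
  obtain ⟨r, hr, hb⟩ := Metric.mem_nhds_iff.1 (mem_interior_iff_mem_nhds.1 hxi)
  have hy : x + (r / 2) • n ∈ simplex K := hb (by
    rw [Metric.mem_ball, dist_eq_norm, add_sub_cancel_left, norm_smul, hn.1, mul_one,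
      Real.norm_of_nonneg (by positivity)]
    linarith)
  have := inner_le_zero_of_simplex hn hx hy
  rw [add_sub_cancel_left, real_inner_smul_left, real_inner_self_eq_norm_sq, hn.1] at this
  linarith

/-- A point in the relative interior of a triangle side lies in no face that omits an endpoint of
that side. -/
lemma endpoints_mem_of_mem_hull {a b c : Plane} (h : cross (b - a) (c - a) ≠ 0) {t : ℝ}
    (ht : t ∈ Set.Ioo (0 : ℝ) 1) {S : Set Plane} (hS : S ⊆ {a, b, c})
    (hx : a + t • (b - a) ∈ convexHull ℝ S) : a ∈ S ∧ b ∈ S := by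
  constructor
  · by_contra ha
    have hsub : S ⊆ {b, c} := fun y hy => by
      rcases hS hy with rfl | h
      · exact absurd hy ha
      · exact h
    have := convexHull_mono hsub hx
    rw [convexHull_pair, segment_eq_image'] at this
    obtain ⟨s, -, hs⟩ := this
    have e1 : cross (c - b) (a + t • (b - a) - b) = 0 := by
      rw [← hs]; simp [cross]; ring
    apply h
    have e2 : (1 - t) * cross (b - a) (c - a) = 0 := by
      rw [← e1]; simp [cross]; ring
    exact (mul_eq_zero.1 e2).resolve_left (by linarith [ht.2])
  · by_contra hb
    have hsub : S ⊆ {a, c} := fun y hy => by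
      rcases hS hy with rfl | rfl | h
      · exact Or.inl rfl
      · exact absurd hy hb
      · exact Or.inr h
    have := convexHull_mono hsub hx
    rw [convexHull_pair, segment_eq_image'] at this
    obtain ⟨s, -, hs⟩ := this
    have e1 : cross (c - a) (a + t • (b - a) - a) = 0 := by
      rw [← hs]; simp [cross]; ring
    apply h
    have e2 : -t * cross (b - a) (c - a) = 0 := by
      rw [← e1]; simp [cross]; ring
    exact (mul_eq_zero.1 e2).resolve_left (by linarith [ht.1])

namespace TriMesh
variable {M : TriMesh}

open Classical in
/-- Relative interiors of edges meet no other edge. -/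
lemma edge_eq_of_mem {a b : Plane} (he : {a, b} ∈ M.edges) {t : ℝ} (ht : t ∈ Set.Ioo (0 : ℝ) 1)
    {e' : Finset Plane} (he' : e' ∈ M.edges) (hx : a + t • (b - a) ∈ simplex e') :
    e' = {a, b} := by
  obtain ⟨K, hK, heK, he2⟩ := mem_edges.1 he
  obtain ⟨L, hL, heL, he2'⟩ := mem_edges.1 he'
  have hab : a ≠ b := by rintro rfl; simp at he2
  have label : ∀ T ∈ M.elems, {a, b} ⊆ T → ∃ c, T = {a, b, c} ∧ cross (b - a) (c - a) ≠ 0 := by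
    intro T hT heT
    obtain ⟨c, hc⟩ : ∃ c, T \ {a, b} = {c} := by
      rw [← Finset.card_eq_one, Finset.card_sdiff_of_subset heT, M.card_eq T hT, he2]
    have hcK : c ∈ T \ {a, b} := by rw [hc]; simp
    simp only [Finset.mem_sdiff, Finset.mem_insert, Finset.mem_singleton, not_or] at hcK
    have hT' : T = {a, b, c} := by
      rw [← Finset.sdiff_union_of_subset heT, hc]; ext x; simp; tauto
    refine ⟨c, hT', cross_ne_zero hab (Ne.symm hcK.2.1) (Ne.symm hcK.2.2) ?_⟩
    rw [← hT']; exact M.indep T hT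
  obtain ⟨c, hKc, hc⟩ := label K hK heK
  have hxe : a + t • (b - a) ∈ simplex {a, b} :=
    mem_simplex_pair.2 ⟨t, Set.Ioo_subset_Icc_self ht, rfl⟩
  have hxK : a + t • (b - a) ∈ simplex K := convexHull_mono (by exact_mod_cast heK) hxe
  have hxL : a + t • (b - a) ∈ simplex L := convexHull_mono (by exact_mod_cast heL) hx
  have hKL := (M.conforming K hK L hL).subset ⟨hxK, hxL⟩
  have h1 := endpoints_mem_of_mem_hull hc ht (S := (K : Set Plane) ∩ L)
    (by rw [hKc]; intro y hy; simpa using hy.1) hKL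
  have habL : {a, b} ⊆ L := by
    intro y hy
    simp only [Finset.mem_insert, Finset.mem_singleton] at hy
    rcases hy with rfl | rfl
    · exact_mod_cast h1.1.2
    · exact_mod_cast h1.2.2
  obtain ⟨d, hLd, hd⟩ := label L hL habL
  have h2 := endpoints_mem_of_mem_hull hd ht (S := (e' : Set Plane))
    (by intro y hy; have := heL (by exact_mod_cast hy : y ∈ e'); rw [hLd] at this; simpa using this) hx
  symm
  refine Finset.eq_of_subset_of_card_le ?_ (by omega)
  intro y hy
  simp only [Finset.mem_insert, Finset.mem_singleton] at hy
  rcases hy with rfl | rfl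
  · exact_mod_cast h2.1
  · exact_mod_cast h2.2

section weak
variable {v : Plane → Plane} {w : Plane → ℝ} {p : Finset Plane → Plane → Plane}

lemma MemLp.on_simplex {E : Type*} [NormedAddCommGroup E] {f : Plane → E}
    (hf : MemLp f 2 (volume.restrict M.domain)) {K : Finset Plane} (hK : K ∈ M.elems) :
    MemLp f 2 (volume.restrict (simplex K)) := by
  refine hf.mono_measure ?_
  rw [restrict_domain]
  exact Finset.single_le_sum (f := fun K => (volume : Measure Plane).restrict (simplex K))
    (fun _ _ => Measure.zero_le _) hK

lemma MemLp.integrable_simplex {f : Plane → ℝ} (hf : MemLp f 2 (volume.restrict M.domain))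
    {K : Finset Plane} (hK : K ∈ M.elems) : IntegrableOn f (simplex K) := by
  have hfin : IsFiniteMeasure ((volume : Measure Plane).restrict (simplex K)) :=
    ⟨by simpa using (isCompact_simplex K).measure_lt_top⟩
  exact (MemLp.on_simplex hf hK).integrable (by norm_num)

/-- A weak divergence of a piecewise smooth field is its classical divergence on each element. -/
lemma weakDiv_ae_eq (hp : ∀ K ∈ M.elems, ContDiff ℝ 1 (p K))
    (hv : ∀ K ∈ M.elems, v =ᵐ[volume.restrict (simplex K)] p K)
    (hw : MemLp w 2 (volume.restrict M.domain)) (hdiv : HasWeakDiv M.domain v w)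
    {K : Finset Plane} (hK : K ∈ M.elems) :
    w =ᵐ[volume.restrict (simplex K)] divg (p K) := by
  have hwi := MemLp.integrable_simplex hw hK
  have hdi : IntegrableOn (divg (p K)) (simplex K) :=
    (continuous_divg (hp K hK)).continuousOn.integrableOn_compact (isCompact_simplex K)
  have hres : (volume : Measure Plane).restrict (simplex K) =
      volume.restrict (interior (simplex K)) := by
    refine (Measure.restrict_congr_set ?_).symm
    refine interior_subset.eventuallyLE.antisymm ?_
    rw [ae_le_set]
    refine measure_mono_null ?_ ((convex_convexHull ℝ (K : Set Plane)).addHaar_frontier volume)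
    exact fun x hx => ⟨subset_closure hx.1, hx.2⟩
  have key : ∀ φ : Plane → ℝ, ContDiff ℝ ∞ φ → HasCompactSupport φ →
      tsupport φ ⊆ interior (simplex K) → ∫ x, φ x • (divg (p K) x - w x) = 0 := by
    intro φ hφ hφc hφs
    have hφ1 : ContDiff ℝ 1 φ := hφ.of_le (by exact_mod_cast le_top)
    have h0 : ∀ x, x ∉ interior (simplex K) → φ x = 0 := fun x hx =>
      image_eq_zero_of_notMem_tsupport fun h => hx (hφs h)
    have h0' : ∀ x, x ∉ interior (simplex K) → fderiv ℝ φ x = 0 := fun x hx =>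
      image_eq_zero_of_notMem_tsupport fun h => hx (hφs (tsupport_fderiv_subset ℝ h))
    have hsub := interior_simplex_subset_domain hK
    have e1 := hdiv φ hφ hφc (hφs.trans hsub)
    simp only [inner_gradient_eq] at e1
    have e2 : ∫ x in M.domain, fderiv ℝ φ x (v x) = ∫ x in simplex K, fderiv ℝ φ x (p K x) := by
      rw [setIntegral_eq_of_subset_of_forall_sdiff_eq_zero M.isOpen_domain.measurableSet hsub
        fun x hx => by rw [h0' x hx.2]; rfl, ← hres]
      refine integral_congr_ae ?_
      filter_upwards [hv K hK] with x hx
      rw [hx]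
    have e3 : ∫ x in M.domain, w x * φ x = ∫ x in simplex K, w x * φ x := by
      rw [setIntegral_eq_of_subset_of_forall_sdiff_eq_zero M.isOpen_domain.measurableSet hsub
        fun x hx => by rw [h0 x hx.2, mul_zero], ← hres]
    have e4 := integral_divg_triangle (M.card_eq K hK) (M.indep K hK) (hφ1.smul (hp K hK))
    rw [Finset.sum_eq_zero] at e4
    swap
    · intro e he
      obtain ⟨he, he2⟩ := Finset.mem_powersetCard.1 he
      rw [setIntegral_congr_fun (g := fun _ => 0) (isCompact_simplex e).measurableSet]
      · simp
      · intro x hx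
        simp only [Pi.smul_apply']
        rw [h0 x (edge_disjoint_interior (isOutN_outN hK he he2) hx), zero_smul, inner_zero_left]
    have e5 : ∀ x, divg (φ • p K) x = φ x * divg (p K) x + fderiv ℝ φ x (p K x) :=
      divg_smul hφ1 (hp K hK)
    simp only [e5] at e4
    have hφcont := hφ1.continuous
    obtain ⟨C, hC⟩ := hφc.exists_bound_of_continuous hφcont
    have i1 : IntegrableOn (fun x => φ x * divg (p K) x) (simplex K) :=
      hdi.bdd_mul hφcont.aestronglyMeasurable (.of_forall hC)
    have i2 : IntegrableOn (fun x => φ x * w x) (simplex K) :=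
      hwi.bdd_mul hφcont.aestronglyMeasurable (.of_forall hC)
    have i3 : IntegrableOn (fun x => fderiv ℝ φ x (p K x)) (simplex K) :=
      ((hφ1.continuous_fderiv one_ne_zero).clm_apply (hp K hK).continuous).continuousOn
        |>.integrableOn_compact (isCompact_simplex K)
    rw [integral_add i1 i3] at e4
    rw [← setIntegral_eq_integral_of_forall_compl_eq_zero (s := simplex K)]
    · simp only [smul_eq_mul, mul_sub]
      rw [integral_sub i1 i2]
      simp only [mul_comm (φ _) (w _)]
      rw [← e3, ← neg_eq_iff_eq_neg.2 e1, e2]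
      linarith
    · intro x hx
      rw [h0 x fun h => hx (interior_subset h), zero_smul]
  have := isOpen_interior.ae_eq_zero_of_integral_contDiff_smul_eq_zero (μ := volume)
    ((hdi.sub hwi).mono_set interior_subset).locallyIntegrableOn
    (fun φ h1 h2 h3 => key φ h1 h2 h3)
  rw [hres, Filter.EventuallyEq, ae_restrict_iff' isOpen_interior.measurableSet]
  filter_upwards [this] with x hx hxi
  have := hx hxi
  simp only [Pi.sub_apply] at this
  linarith

/-- The normal component of a piecewise smooth field with a weak divergence in `L²` is continuous
across interior edges. Otherwise a bump function around a point of an edge, supported in the two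
elements that share the edge, would violate the definition of the weak divergence. -/
lemma normal_continuity (hp : ∀ K ∈ M.elems, ContDiff ℝ 1 (p K))
    (hv : ∀ K ∈ M.elems, v =ᵐ[volume.restrict (simplex K)] p K)
    (hw : MemLp w 2 (volume.restrict M.domain)) (hdiv : HasWeakDiv M.domain v w)
    {e : Finset Plane} (he : e ∈ M.intEdges) {x : Plane} (hx : x ∈ simplex e) :
    inner ℝ (p (M.sides e).1 x - p (M.sides e).2 x) (outN (M.sides e).1 e) = 0 := by
  classical
  obtain ⟨he2, hi⟩ := mem_intEdges.1 he
  obtain ⟨h1, h2, hne, he1, he2'⟩ := sides_spec hi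
  have heE : e ∈ M.edges := mem_edges.2 ⟨_, h1, he1, he2⟩
  have c1 := (hp _ h1).continuous
  have c2 := (hp _ h2).continuous
  set J : Plane → ℝ := fun y =>
    inner ℝ (p (M.sides e).1 y - p (M.sides e).2 y) (outN (M.sides e).1 e) with hJ
  have hJc : Continuous J := (c1.sub c2).inner continuous_const
  obtain ⟨a, b, hab, rfl⟩ := Finset.card_eq_two.1 he2
  have main : ∀ t ∈ Set.Ioo (0 : ℝ) 1, J (a + t • (b - a)) = 0 := by
    intro t ht
    by_contra hJx
    set x := a + t • (b - a) with hxdef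
    have hxe : x ∈ simplex {a, b} := mem_simplex_pair.2 ⟨t, Set.Ioo_subset_Icc_self ht, rfl⟩
    -- a ball around `x` that meets no other edge and on which `J` keeps its sign
    have hopen : IsOpen ((⋃ e' ∈ M.edges.erase {a, b}, simplex e')ᶜ ∩ {y | 0 < J x * J y}) := by
      refine IsOpen.inter (isOpen_compl_iff.2 ?_) (isOpen_lt continuous_const (by fun_prop))
      exact (M.edges.erase {a, b}).finite_toSet.isClosed_biUnion fun e' _ =>
        (isCompact_simplex e').isClosed
    obtain ⟨r, hr, hb⟩ := Metric.isOpen_iff.1 hopen x ⟨by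
      simp only [Set.mem_compl_iff, Set.mem_iUnion, not_exists]
      intro e' he' hxe'
      obtain ⟨hne', he''⟩ := Finset.mem_erase.1 he'
      exact hne' (edge_eq_of_mem heE ht he'' hxe'), by
      simpa using mul_self_pos.2 hJx⟩
    have hother : ∀ e' ∈ M.edges, e' ≠ {a, b} → ∀ y ∈ simplex e', y ∉ Metric.ball x r := by
      intro e' he' hne' y hy hyb
      exact (hb hyb).1 (Set.mem_biUnion (Finset.mem_erase.2 ⟨hne', he'⟩) hy)
    have hballD : Metric.ball x r ⊆ M.domain := by
      refine ball_subset_domain (simplex_subset_cover h1 ?_) hr ?_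
      · exact convexHull_mono (by exact_mod_cast he1) hxe
      · intro z hz hzb
        obtain ⟨e', he', hze'⟩ := Set.mem_iUnion₂.1 hzb
        obtain ⟨he'', hni⟩ := mem_bdryEdges.1 he'
        exact hother e' he'' (fun h => hni (h ▸ hi)) z hze' hz
    let φ : ContDiffBump x := ⟨r / 4, r / 2, by positivity, by linarith⟩
    have hφ1 : ContDiff ℝ 1 φ := φ.contDiff
    have hφc : HasCompactSupport φ := φ.hasCompactSupport
    have hφs : tsupport φ ⊆ Metric.ball x r := by
      rw [φ.tsupport_eq]; exact Metric.closedBall_subset_ball (by simp only [φ]; linarith)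
    have hφ0 : ∀ y, y ∉ Metric.ball x r → φ y = 0 := fun y hy =>
      image_eq_zero_of_notMem_tsupport fun h => hy (hφs h)
    have e1 := hdiv φ φ.contDiff hφc (hφs.trans hballD)
    simp only [inner_gradient_eq] at e1
    have hφcont := hφ1.continuous
    obtain ⟨C, hC⟩ := hφc.exists_bound_of_continuous hφcont
    have i3 : ∀ K ∈ M.elems, IntegrableOn (fun x => fderiv ℝ φ x (p K x)) (simplex K) :=
      fun K hK => ((hφ1.continuous_fderiv one_ne_zero).clm_apply
        (hp K hK).continuous).continuousOn.integrableOn_compact (isCompact_simplex K)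
    have i1 : ∀ K ∈ M.elems, IntegrableOn (fun x => w x * φ x) (simplex K) := fun K hK =>
      (MemLp.integrable_simplex hw hK).mul_bdd (c := C) hφcont.aestronglyMeasurable (.of_forall hC)
    have hvK : ∀ K ∈ M.elems, (fun x => fderiv ℝ φ x (v x)) =ᵐ[volume.restrict (simplex K)]
        fun x => fderiv ℝ φ x (p K x) := fun K hK => by
      filter_upwards [hv K hK] with y hy
      rw [hy]
    rw [integral_domain fun K hK => (i3 K hK).congr (hvK K hK).symm,
      integral_domain i1] at e1
    have e2 := sum_integral_divg (M := M) (G := fun K y => φ y • p K y)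
      fun K hK => hφ1.smul (hp K hK)
    have e3 : ∑ K ∈ M.elems, ∫ y in simplex K, divg (fun z => φ z • p K z) y = 0 := by
      rw [← sub_eq_zero.2 e1, sub_neg_eq_add, ← Finset.sum_add_distrib]
      refine Finset.sum_congr rfl fun K hK => ?_
      rw [← integral_add ((i3 K hK).congr (hvK K hK).symm) (i1 K hK)]
      refine integral_congr_ae ?_
      filter_upwards [hvK K hK, weakDiv_ae_eq hp hv hw hdiv hK] with y hy hy'
      rw [divg_smul hφ1 (hp K hK), hy, hy']
      ring
    rw [e3, Finset.sum_eq_zero, Finset.sum_eq_single {a, b}, zero_add] at e2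
    · have hc : Continuous fun s : ℝ => J x * (J (a + s • (b - a)) * φ (a + s • (b - a))) := by
        fun_prop
      have hpos : 0 < ∫ s in (0 : ℝ)..1, J x * (J (a + s • (b - a)) * φ (a + s • (b - a))) := by
        refine intervalIntegral.integral_pos zero_lt_one hc.continuousOn (fun s _ => ?_)
          ⟨t, Set.Ioo_subset_Icc_self ht, ?_⟩
        · by_cases hs : a + s • (b - a) ∈ Metric.ball x r
          · rw [← mul_assoc]
            exact mul_nonneg (hb hs).2.le φ.nonneg
          · rw [hφ0 _ hs, mul_zero, mul_zero]
        · rw [← mul_assoc]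
          exact mul_pos (mul_self_pos.2 hJx) (φ.pos_of_mem_ball (by
            rw [← hxdef]; exact Metric.mem_ball_self φ.rOut_pos))
      rw [intervalIntegral.integral_const_mul] at hpos
      have e4 : ∫ y in simplex {a, b}, J y * φ y ∂arcLength = 0 := by
        rw [e2]
        congr 1; funext y
        simp only [hJ, ← smul_sub, real_inner_smul_left]
        ring
      rw [integral_edge hab] at e4
      rcases mul_eq_zero.1 e4 with h | h
      · exact hab (sub_eq_zero.1 (norm_eq_zero.1 h)).symm
      · rw [h, mul_zero] at hpos; exact lt_irrefl _ hpos
    · intro e' he' hne'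
      obtain ⟨he'2, hi'⟩ := mem_intEdges.1 he'
      obtain ⟨h1', -, -, he1', -⟩ := sides_spec hi'
      rw [setIntegral_congr_fun (g := fun _ => 0) (isCompact_simplex e').measurableSet]
      · simp
      · intro y hy
        have := hφ0 y (hother e' (mem_edges.2 ⟨_, h1', he1', he'2⟩) hne' y hy)
        simp [this]
    · exact fun h => absurd he h
    · intro e' he'
      obtain ⟨he'', hni⟩ := mem_bdryEdges.1 he'
      rw [setIntegral_congr_fun (g := fun _ => 0) (isCompact_simplex e').measurableSet]
      · simp
      · intro y hy
        have := hφ0 y (hother e' he'' (fun h => hni (h ▸ hi)) y hy)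
        simp [this]
  obtain ⟨t, ht, rfl⟩ := mem_simplex_pair.1 hx
  have hcl : Set.EqOn (fun t : ℝ => J (a + t • (b - a))) (fun _ => 0) (closure (Set.Ioo 0 1)) :=
    Set.EqOn.closure main (by fun_prop) continuous_const
  rw [closure_Ioo zero_ne_one] at hcl
  exact hcl ht

/-- Elementwise integration by parts for the form `b_{h1}`. -/
lemma green_identity (hp : ∀ K ∈ M.elems, ContDiff ℝ 1 (p K))
    (hv : ∀ K ∈ M.elems, v =ᵐ[volume.restrict (simplex K)] p K)
    (hw : MemLp w 2 (volume.restrict M.domain)) (hdiv : HasWeakDiv M.domain v w)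
    {q : Plane → ℝ} {ρ : Finset Plane → Plane → ℝ} (hρ : ∀ K ∈ M.elems, ContDiff ℝ 1 (ρ K))
    (hq : ∀ K ∈ M.elems, q =ᵐ[volume.restrict (simplex K)] ρ K) :
    (-∫ x in M.domain, w x * q x) + ∑ e ∈ M.bdryEdges, ∫ x in simplex e,
        inner ℝ (p (M.elem e) x) (M.normal e) * ρ (M.elem e) x ∂arcLength =
      (∑ K ∈ M.elems, ∫ x in simplex K, fderiv ℝ (ρ K) x (p K x)) -
        ∑ e ∈ M.intEdges, ∫ x in simplex e, inner ℝ (p (M.sides e).1 x) (outN (M.sides e).1 e) *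
          (ρ (M.sides e).1 x - ρ (M.sides e).2 x) ∂arcLength := by
  have e1 := sum_integral_divg (M := M) (G := fun K y => ρ K y • p K y)
    fun K hK => (hρ K hK).smul (hp K hK)
  have hwq : ∀ K ∈ M.elems, (fun x => w x * q x) =ᵐ[volume.restrict (simplex K)]
      fun x => ρ K x * divg (p K) x := fun K hK => by
    filter_upwards [hq K hK, weakDiv_ae_eq hp hv hw hdiv hK] with y hy hy'
    rw [hy, hy', mul_comm]
  have i1 : ∀ K ∈ M.elems, IntegrableOn (fun x => ρ K x * divg (p K) x) (simplex K) :=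
    fun K hK => ((hρ K hK).continuous.mul
      (continuous_divg (hp K hK))).continuousOn.integrableOn_compact (isCompact_simplex K)
  have i2 : ∀ K ∈ M.elems, IntegrableOn (fun x => fderiv ℝ (ρ K) x (p K x)) (simplex K) :=
    fun K hK => (((hρ K hK).continuous_fderiv one_ne_zero).clm_apply
      (hp K hK).continuous).continuousOn.integrableOn_compact (isCompact_simplex K)
  have e2 : ∫ x in M.domain, w x * q x = ∑ K ∈ M.elems, ∫ x in simplex K, ρ K x * divg (p K) x := by
    rw [integral_domain fun K hK => (i1 K hK).congr (hwq K hK).symm]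
    exact Finset.sum_congr rfl fun K hK => integral_congr_ae (hwq K hK)
  have e3 : ∑ K ∈ M.elems, ∫ x in simplex K, divg (fun y => ρ K y • p K y) x =
      (∑ K ∈ M.elems, ∫ x in simplex K, ρ K x * divg (p K) x) +
      ∑ K ∈ M.elems, ∫ x in simplex K, fderiv ℝ (ρ K) x (p K x) := by
    rw [← Finset.sum_add_distrib]
    refine Finset.sum_congr rfl fun K hK => ?_
    rw [← integral_add (i1 K hK) (i2 K hK)]
    congr 1; funext x
    exact divg_smul (hρ K hK) (hp K hK) x
  have e4 : ∑ e ∈ M.intEdges, ∫ x in simplex e, inner ℝ (ρ (M.sides e).1 x • p (M.sides e).1 x -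
        ρ (M.sides e).2 x • p (M.sides e).2 x) (outN (M.sides e).1 e) ∂arcLength =
      ∑ e ∈ M.intEdges, ∫ x in simplex e, inner ℝ (p (M.sides e).1 x) (outN (M.sides e).1 e) *
          (ρ (M.sides e).1 x - ρ (M.sides e).2 x) ∂arcLength := by
    refine Finset.sum_congr rfl fun e he =>
      setIntegral_congr_fun (isCompact_simplex e).measurableSet fun x hx => ?_
    have := normal_continuity hp hv hw hdiv he hx
    rw [inner_sub_left, sub_eq_zero] at this
    simp only [inner_sub_left, real_inner_smul_left, ← this]
    ring
  rw [e3, e4] at e1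
  rw [e2]
  simp only [real_inner_smul_left, mul_comm (ρ _ _)] at e1 ⊢
  linarith

end weak
end TriMesh

/-! ### Polynomials: inverse estimates -/

/-- Smooth functions that restrict to polynomials of degree at most `m` on every line. This reduces
estimates for plane polynomials to one variable. -/
def LinePoly (m : ℕ) (f : Plane → ℝ) : Prop :=
  ContDiff ℝ ∞ f ∧
    ∀ x w : Plane, ∃ P : Polynomial ℝ, P.natDegree ≤ m ∧ ∀ t : ℝ, f (x + t • w) = P.eval t

/-- The polynomial function of an `MvPolynomial`. -/
def evalFn (p : MvPolynomial (Fin 2) ℝ) (x : Plane) : ℝ := MvPolynomial.eval (fun i => x i) p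

lemma contDiff_evalFn (p : MvPolynomial (Fin 2) ℝ) : ContDiff ℝ ∞ (evalFn p) := by
  unfold evalFn
  induction p using MvPolynomial.induction_on with
  | C a => simpa using contDiff_const
  | add p q hp hq => simpa using hp.add hq
  | mul_X p i hp => simp only [map_mul, MvPolynomial.eval_X]; exact hp.mul (by fun_prop)

lemma linePoly_evalFn {m : ℕ} {p : MvPolynomial (Fin 2) ℝ} (hp : p.totalDegree ≤ m) :
    LinePoly m (evalFn p) := by
  refine ⟨contDiff_evalFn p, fun x w => ?_⟩
  refine ⟨MvPolynomial.aeval (fun i => Polynomial.C (x i) + Polynomial.C (w i) * Polynomial.X) p,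
    ?_, fun t => ?_⟩
  · have := MvPolynomial.aeval_natDegree_le (n := 1) p hp
      (fun i => Polynomial.C (x i) + Polynomial.C (w i) * Polynomial.X) fun i => by
        rw [add_comm]; exact Polynomial.natDegree_linear_le
    simpa using this
  · unfold evalFn
    clear hp
    induction p using MvPolynomial.induction_on with
    | C a => simp
    | add p q hp hq => simp only [map_add, Polynomial.eval_add, hp, hq]
    | mul_X p i hp =>
      simp only [map_mul, Polynomial.eval_mul, hp, MvPolynomial.eval_X, MvPolynomial.aeval_X]
      simp only [PiLp.add_apply, PiLp.smul_apply, smul_eq_mul, Polynomial.eval_add,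
        Polynomial.eval_mul, Polynomial.eval_C, Polynomial.eval_X]
      ring

lemma fderiv_evalFn (p : MvPolynomial (Fin 2) ℝ) (x : Plane) (i : Fin 2) :
    fderiv ℝ (evalFn p) x (EuclideanSpace.single i 1) = evalFn (MvPolynomial.pderiv i p) x := by
  induction p using MvPolynomial.induction_on with
  | C a => 
    have : evalFn (MvPolynomial.C a) = fun _ => a := by funext y; simp [evalFn]
    simp [this, evalFn]
  | add p q hp hq =>
    have : evalFn (p + q) = fun y => evalFn p y + evalFn q y := by funext y; simp [evalFn]
    rw [this, fderiv_fun_add ((contDiff_evalFn p).differentiable (by simp) x)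
      ((contDiff_evalFn q).differentiable (by simp) x)]
    simp only [add_apply, hp, hq]
    simp [evalFn]
  | mul_X p j hp =>
    have : evalFn (p * MvPolynomial.X j) = fun y => evalFn p y * EuclideanSpace.proj (𝕜 := ℝ) j y := by
      funext y; simp [evalFn]
    rw [this, fderiv_fun_mul ((contDiff_evalFn p).differentiable (by simp) x)
      (EuclideanSpace.proj (𝕜 := ℝ) j).differentiableAt, ContinuousLinearMap.fderiv]
    simp only [add_apply, smul_apply, hp]
    by_cases hij : i = j
    · subst hij; simp [evalFn, MvPolynomial.pderiv_X]
    · simp [evalFn, MvPolynomial.pderiv_X, Ne.symm hij]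

lemma totalDegree_pderiv_le (p : MvPolynomial (Fin 2) ℝ) (i : Fin 2) :
    (MvPolynomial.pderiv i p).totalDegree ≤ p.totalDegree := by
  conv_lhs => rw [p.as_sum, map_sum]
  refine (MvPolynomial.totalDegree_finsetSum _ _).trans (Finset.sup_le fun s hs => ?_)
  rw [MvPolynomial.pderiv_monomial]
  refine (MvPolynomial.totalDegree_monomial_le _ _).trans (le_trans ?_ (MvPolynomial.le_totalDegree hs))
  rw [Finsupp.sum_fintype _ _ (by simp), Finsupp.sum_fintype _ _ (by simp)]
  exact Finset.sum_le_sum fun j _ => by simp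

lemma iteratedDeriv_polynomial (P : Polynomial ℝ) (j : ℕ) :
    iteratedDeriv j (fun t => P.eval t) 0 = j.factorial * P.coeff j := by
  have : ∀ j, iteratedDeriv j (fun t => P.eval t) = fun t => (Polynomial.derivative^[j] P).eval t := by
    intro j
    induction j with
    | zero => simp
    | succ j ih => rw [iteratedDeriv_succ, ih]; funext t; rw [Polynomial.deriv, Function.iterate_succ_apply']
  simp only [this]
  rw [← Polynomial.coeff_zero_eq_eval_zero, Polynomial.coeff_iterate_derivative]
  simp [Nat.descFactorial_self]

/-- The coefficients of a polynomial are controlled by its `L²` norm on an interval, by compactness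
of the unit sphere in the space of coefficients. -/
lemma exists_coeff_sq_le (m : ℕ) : ∃ C : ℝ, 0 < C ∧ ∀ P : Polynomial ℝ, P.natDegree ≤ m → ∀ j,
    P.coeff j ^ 2 ≤ C * ∫ t in (0 : ℝ)..(1 / 2), P.eval t ^ 2 := by
  set N : (Fin (m + 1) → ℝ) → ℝ := fun a =>
    ∫ t in (0 : ℝ)..(1 / 2), (∑ i, a i * t ^ (i : ℕ)) ^ 2 with hN
  have hNc : Continuous N := by
    refine intervalIntegral.continuous_parametric_intervalIntegral_of_continuous' ?_ 0 (1 / 2)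
    fun_prop
  have hpos : ∀ a, a ≠ 0 → 0 < N a := by
    intro a ha
    have hc : Continuous fun t : ℝ => (∑ i, a i * t ^ (i : ℕ)) ^ 2 := by fun_prop
    by_contra! hcon
    have hz : ∀ t ∈ Set.Icc (0 : ℝ) (1 / 2), ∑ i, a i * t ^ (i : ℕ) = 0 := by
      by_contra! hne
      obtain ⟨t, ht, hne⟩ := hne
      exact absurd (intervalIntegral.integral_pos (by norm_num) hc.continuousOn
        (fun _ _ => by positivity) ⟨t, ht, by positivity⟩) (not_lt.2 hcon)
    apply ha
    set Q : Polynomial ℝ := ∑ i : Fin (m + 1), Polynomial.C (a i) * Polynomial.X ^ (i : ℕ) with hQ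
    have hQ0 : Q = 0 := by
      refine Polynomial.eq_zero_of_infinite_isRoot Q
        ((Set.Icc_infinite (by norm_num : (0 : ℝ) < 1 / 2)).mono fun t ht => ?_)
      simpa [hQ, Polynomial.eval_finsetSum] using hz t ht
    funext i
    have := congrArg (fun Q => Polynomial.coeff Q i) hQ0
    simpa [hQ, Polynomial.finsetSum_coeff, Polynomial.coeff_C_mul, Polynomial.coeff_X_pow,
      Fin.val_inj] using this
  have hcpt : IsCompact (Metric.sphere (0 : Fin (m + 1) → ℝ) 1) := isCompact_sphere _ _
  obtain ⟨a₀, ha₀, hmin⟩ := hcpt.exists_isMinOn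
    (NormedSpace.sphere_nonempty.2 zero_le_one) hNc.continuousOn
  have hδ : 0 < N a₀ := hpos a₀ (by rintro rfl; simp at ha₀)
  have hscale : ∀ (r : ℝ) a, N (r • a) = r ^ 2 * N a := by
    intro r a
    simp only [hN, ← intervalIntegral.integral_const_mul, Pi.smul_apply, smul_eq_mul, mul_assoc,
      ← Finset.mul_sum, mul_pow]
  have hlow : ∀ a, ‖a‖ ^ 2 * N a₀ ≤ N a := by
    intro a
    by_cases ha : a = 0
    · subst ha; simp [hN]
    · have h1 : ‖a‖⁻¹ • a ∈ Metric.sphere (0 : Fin (m + 1) → ℝ) 1 := by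
        rw [mem_sphere_zero_iff_norm, norm_smul, norm_inv, norm_norm,
          inv_mul_cancel₀ (norm_ne_zero_iff.2 ha)]
      have h2 := hmin h1
      have h3 : a = ‖a‖ • ‖a‖⁻¹ • a := (smul_inv_smul₀ (norm_ne_zero_iff.2 ha) a).symm
      calc ‖a‖ ^ 2 * N a₀ ≤ ‖a‖ ^ 2 * N (‖a‖⁻¹ • a) := by gcongr; exact h2
        _ = N a := by rw [← hscale, ← h3]
  refine ⟨(N a₀)⁻¹, inv_pos.2 hδ, fun P hP j => ?_⟩
  rw [inv_mul_eq_div, le_div_iff₀ hδ]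
  have hNP : ∫ t in (0 : ℝ)..(1 / 2), P.eval t ^ 2 = N fun i => P.coeff i := by
    simp only [hN]
    congr 1; funext t
    rw [Polynomial.eval_eq_sum_range' (Nat.lt_succ_of_le hP), Finset.sum_range]
  rw [hNP]
  by_cases hj : j < m + 1
  · refine le_trans (mul_le_mul_of_nonneg_right ?_ hδ.le) (hlow _)
    rw [← sq_abs]
    exact pow_le_pow_left₀ (abs_nonneg _)
      (norm_le_pi_norm (fun i : Fin (m + 1) => P.coeff i) ⟨j, hj⟩) 2
  · rw [Polynomial.coeff_eq_zero_of_natDegree_lt (by omega)]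
    refine le_trans ?_ (hlow _)
    simp; positivity

/-- Values of a polynomial on `[-R, R]` are controlled by its `L²` norm on an interval. -/
lemma exists_eval_sq_le (m : ℕ) (R : ℝ) : ∃ C : ℝ, 0 < C ∧ ∀ P : Polynomial ℝ, P.natDegree ≤ m →
    ∀ s, |s| ≤ R → P.eval s ^ 2 ≤ C * ∫ t in (0 : ℝ)..(1 / 2), P.eval t ^ 2 := by
  obtain ⟨C, hC, h⟩ := exists_coeff_sq_le m
  set R' := max R 1
  have hR' : 1 ≤ R' := le_max_right _ _
  refine ⟨(m + 1) * ((m + 1) * (C * (R' ^ m) ^ 2)), by positivity, fun P hP s hs => ?_⟩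
  rw [Polynomial.eval_eq_sum_range' (Nat.lt_succ_of_le hP)]
  refine (sq_sum_le_card_mul_sum_sq).trans ?_
  simp only [Finset.card_range, Nat.cast_succ, mul_assoc]
  gcongr
  refine (Finset.sum_le_card_nsmul _ _ (C * (R' ^ m) ^ 2 * ∫ t in (0 : ℝ)..(1 / 2), P.eval t ^ 2)
    fun j hj => ?_).trans (le_of_eq (by simp [mul_assoc]))
  have h1 : |s ^ j| ≤ R' ^ m := by
    rw [abs_pow]
    calc |s| ^ j ≤ R' ^ j := by gcongr; exact hs.trans (le_max_left _ _)
      _ ≤ R' ^ m := pow_le_pow_right₀ hR' (Nat.lt_succ_iff.1 (Finset.mem_range.1 hj))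
  have h2 : (s ^ j) ^ 2 ≤ (R' ^ m) ^ 2 := by
    rw [← sq_abs]; gcongr
  have h3 := h P hP j
  calc (P.coeff j * s ^ j) ^ 2 = P.coeff j ^ 2 * (s ^ j) ^ 2 := by ring
    _ ≤ (C * ∫ t in (0 : ℝ)..(1 / 2), P.eval t ^ 2) * (R' ^ m) ^ 2 := by
        refine mul_le_mul h3 h2 (by positivity) ((sq_nonneg _).trans h3)
    _ = _ := by ring

/-- Pointwise inverse estimate: a polynomial is controlled on a large ball by its `L²` norm on any
set containing a comparable concentric ball. -/
lemma exists_sq_le_integral (m : ℕ) (R : ℝ) : ∃ C : ℝ, 0 < C ∧ ∀ f : Plane → ℝ, LinePoly m f →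
    ∀ (c : Plane) (r : ℝ), 0 < r → ∀ S : Set Plane, IsCompact S → Metric.closedBall c r ⊆ S →
    ∀ x ∈ Metric.closedBall c (R * r), f x ^ 2 ≤ C / r ^ 2 * ∫ y in S, f y ^ 2 := by
  obtain ⟨C, hC, h⟩ := exists_eval_sq_le m R
  refine ⟨C ^ 2, by positivity, fun f hf c r hr S hS hcS x hx => ?_⟩
  have hfc : Continuous f := hf.1.continuous
  set u : Plane := r • EuclideanSpace.single 0 1 with hu
  set w : Plane := r • EuclideanSpace.single 1 1 with hw
  set F : ℝ → ℝ → ℝ := fun s t => f (c + s • u + t • w) with hF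
  have hFc : Continuous fun p : ℝ × ℝ => F p.1 p.2 := by fun_prop
  set s₀ := (x - c) 0 / r with hs₀
  set t₀ := (x - c) 1 / r with ht₀
  have hxe : x = c + s₀ • u + t₀ • w := by
    have e0 : s₀ * r = (x - c) 0 := by rw [hs₀]; field_simp
    have e1 : t₀ * r = (x - c) 1 := by rw [ht₀]; field_simp
    rw [hu, hw, smul_smul, smul_smul, e0, e1, add_assoc]
    ext i; fin_cases i <;> simp
  have hxn : ‖x - c‖ ≤ R * r := by rw [← dist_eq_norm]; exact hx
  have hb : ∀ i, |(x - c) i / r| ≤ R := fun i => by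
    rw [abs_div, abs_of_pos hr, div_le_iff₀ hr]
    exact (PiLp.norm_apply_le (x - c) i).trans hxn
  -- The one-dimensional estimate is applied in each of the two coordinate directions.
  have h1 : F s₀ t₀ ^ 2 ≤ C * ∫ s in (0 : ℝ)..(1 / 2), F s t₀ ^ 2 := by
    obtain ⟨P, hP, hPe⟩ := hf.2 (c + t₀ • w) u
    have e : ∀ s, F s t₀ = P.eval s := fun s => by
      rw [← hPe]; simp only [hF]; congr 1; abel
    simp only [e]
    exact h P hP s₀ (hb 0)
  have h2 : ∀ s, F s t₀ ^ 2 ≤ C * ∫ t in (0 : ℝ)..(1 / 2), F s t ^ 2 := by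
    intro s
    obtain ⟨P, hP, hPe⟩ := hf.2 (c + s • u) w
    have e : ∀ t, F s t = P.eval t := fun t => by rw [← hPe]
    simp only [e]
    exact h P hP t₀ (hb 1)
  have hint : ∀ s a b, IntervalIntegrable (fun t => F s t ^ 2) volume a b := fun s a b =>
    Continuous.intervalIntegrable (by fun_prop) _ _
  have hcont1 : Continuous fun s => ∫ t in (0 : ℝ)..(1 / 2), F s t ^ 2 :=
    intervalIntegral.continuous_parametric_intervalIntegral_of_continuous' (by fun_prop) _ _
  have hcont2 : Continuous fun s => ∫ t in (0 : ℝ)..(1 - s), F s t ^ 2 :=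
    intervalIntegral.continuous_parametric_intervalIntegral_of_continuous (a₀ := 0)
      (by fun_prop) (by fun_prop)
  have h3 : ∫ s in (0 : ℝ)..(1 / 2), F s t₀ ^ 2 ≤
      ∫ s in (0 : ℝ)..(1 / 2), C * ∫ t in (0 : ℝ)..(1 / 2), F s t ^ 2 :=
    intervalIntegral.integral_mono_on (by norm_num)
      (Continuous.intervalIntegrable (by fun_prop) _ _)
      ((hcont1.const_mul C).intervalIntegrable _ _) fun s _ => h2 s
  -- The square of side `1 / 2` is part of the reference triangle.
  have h4 : ∫ s in (0 : ℝ)..(1 / 2), ∫ t in (0 : ℝ)..(1 / 2), F s t ^ 2 ≤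
      ∫ s in (0 : ℝ)..1, ∫ t in (0 : ℝ)..(1 - s), F s t ^ 2 := by
    calc _ ≤ ∫ s in (0 : ℝ)..(1 / 2), ∫ t in (0 : ℝ)..(1 - s), F s t ^ 2 := by
          refine intervalIntegral.integral_mono_on (by norm_num) (hcont1.intervalIntegrable _ _)
            (hcont2.intervalIntegrable _ _) fun s hs => ?_
          exact intervalIntegral.integral_mono_interval le_rfl (by norm_num) (by linarith [hs.2])
            (.of_forall fun t => sq_nonneg _) (hint _ _ _)
      _ ≤ _ := by
          refine intervalIntegral.integral_mono_interval le_rfl (by norm_num) (by norm_num)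
            ?_ (hcont2.intervalIntegrable _ _)
          filter_upwards [ae_restrict_mem measurableSet_Ioc] with s hs
          exact intervalIntegral.integral_nonneg (by linarith [hs.2]) fun t _ => sq_nonneg _
  have hcr : cross u w = r ^ 2 := by simp [cross, hu, hw]; ring
  have hn : ∀ i : Fin 2, ‖r • (EuclideanSpace.single i (1 : ℝ) : Plane)‖ = r := fun i => by
    rw [norm_smul]; simp [abs_of_pos hr]
  have h5 : ∫ y in convexHull ℝ {c, c + u, c + w}, f y ^ 2 =
      r ^ 2 * ∫ s in (0 : ℝ)..1, ∫ t in (0 : ℝ)..(1 - s), F s t ^ 2 := by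
    have := integral_triangle (a := c) (b := c + u) (c := c + w) (f := fun y => f y ^ 2)
      (by simp only [add_sub_cancel_left, hcr]; positivity) (by fun_prop)
    simpa only [add_sub_cancel_left, hcr, abs_of_pos (pow_pos hr 2)] using this
  have h6 : ∫ y in convexHull ℝ {c, c + u, c + w}, f y ^ 2 ≤ ∫ y in S, f y ^ 2 := by
    refine setIntegral_mono_set ((by fun_prop : ContinuousOn (fun y => f y ^ 2) S).integrableOn_compact hS)
      (.of_forall fun y => sq_nonneg _) (LE.le.eventuallyLE ?_)
    refine (convexHull_min ?_ (convex_closedBall c r)).trans hcS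
    rintro y (rfl | rfl | rfl)
    · exact Metric.mem_closedBall_self hr.le
    · simp [hu, hn]
    · simp [hw, hn]
  rw [intervalIntegral.integral_const_mul] at h3
  have h7 : f x = F s₀ t₀ := congrArg f hxe
  rw [h7, div_mul_eq_mul_div, le_div_iff₀ (by positivity)]
  calc F s₀ t₀ ^ 2 * r ^ 2 ≤ (C * (C * ∫ s in (0 : ℝ)..1, ∫ t in (0 : ℝ)..(1 - s), F s t ^ 2)) *
        r ^ 2 := by
        gcongr
        exact h1.trans (by gcongr; exact h3.trans (by gcongr))
    _ = C ^ 2 * (r ^ 2 * ∫ s in (0 : ℝ)..1, ∫ t in (0 : ℝ)..(1 - s), F s t ^ 2) := by ring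
    _ ≤ _ := by rw [← h5]; gcongr

/-- Inverse estimate for the derivatives of a polynomial in an arbitrary direction. -/
lemma exists_iteratedDeriv_le (m : ℕ) : ∃ C : ℝ, 0 < C ∧ ∀ f : Plane → ℝ, LinePoly m f →
    ∀ (x w : Plane) (h B : ℝ), ‖w‖ ≤ 1 → 0 < h → (∀ y ∈ Metric.closedBall x h, |f y| ≤ B) →
    ∀ j, |iteratedDeriv j (fun t : ℝ => f (x + t • w)) 0| ≤ j.factorial * (C * B / h ^ j) := by
  obtain ⟨C, hC, hcoef⟩ := exists_coeff_sq_le m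
  refine ⟨√C, by positivity, fun f hf x w h B hw hh hB j => ?_⟩
  have hB0 : 0 ≤ B := (abs_nonneg _).trans (hB x (Metric.mem_closedBall_self hh.le))
  obtain ⟨P, hP, hPe⟩ := hf.2 x w
  simp only [hPe, iteratedDeriv_polynomial, abs_mul, Nat.abs_cast]
  refine mul_le_mul_of_nonneg_left ?_ (by positivity)
  rw [le_div_iff₀ (by positivity)]
  -- `Q` is `P` rescaled so that radius `h` becomes radius `1`.
  set Q := P.comp (Polynomial.C h * Polynomial.X) with hQ
  have hQc : Q.coeff j = P.coeff j * h ^ j := by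
    rw [hQ, Polynomial.comp_C_mul_X_coeff]
  have hQd : Q.natDegree ≤ m := by
    refine Polynomial.natDegree_comp_le.trans ?_
    have : (Polynomial.C h * Polynomial.X).natDegree ≤ 1 :=
      (Polynomial.natDegree_C_mul_le _ _).trans Polynomial.natDegree_X_le
    nlinarith
  have h1 := hcoef Q hQd j
  have h2 : ∫ t in (0 : ℝ)..(1 / 2), Q.eval t ^ 2 ≤ ∫ t in (0 : ℝ)..(1 / 2), B ^ 2 := by
    refine intervalIntegral.integral_mono_on (by norm_num)
      (Continuous.intervalIntegrable (by fun_prop) _ _) (by simp) fun t ht => ?_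
    have : Q.eval t = f (x + (h * t) • w) := by rw [hPe, hQ]; simp
    rw [this, ← sq_abs]
    gcongr
    refine hB _ ?_
    rw [Metric.mem_closedBall, dist_eq_norm, add_sub_cancel_left, norm_smul, norm_mul,
      Real.norm_of_nonneg hh.le, Real.norm_of_nonneg ht.1]
    have : t ≤ 1 := by linarith [ht.2]
    nlinarith [mul_nonneg hh.le ht.1, norm_nonneg w, mul_nonneg hh.le (sub_nonneg.2 this)]
  have h3 : Q.coeff j ^ 2 ≤ (√C * B) ^ 2 := by
    rw [mul_pow, Real.sq_sqrt hC.le]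
    refine h1.trans (mul_le_mul_of_nonneg_left (h2.trans ?_) hC.le)
    simp
    nlinarith [sq_nonneg B]
  have := abs_le_of_sq_le_sq h3 (by positivity)
  rw [hQc, abs_mul, abs_pow, abs_of_pos hh] at this
  exact this

/-! ### Discrete functions on shape-regular elements -/

lemma LinePoly.mul_coord {m : ℕ} {f : Plane → ℝ} (hf : LinePoly m f) (i : Fin 2) :
    LinePoly (m + 1) fun x => f x * x i := by
  refine ⟨hf.1.mul (by fun_prop), fun x w => ?_⟩
  obtain ⟨P, hP, hPe⟩ := hf.2 x w
  refine ⟨P * (Polynomial.C (w i) * Polynomial.X + Polynomial.C (x i)), ?_, fun t => ?_⟩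
  · refine Polynomial.natDegree_mul_le.trans ?_
    have := Polynomial.natDegree_linear_le (a := w i) (b := x i)
    omega
  · simp only [hPe, PiLp.add_apply, PiLp.smul_apply, smul_eq_mul, Polynomial.eval_mul,
      Polynomial.eval_add, Polynomial.eval_C, Polynomial.eval_X]
    ring

lemma LinePoly.add {m n : ℕ} {f g : Plane → ℝ} (hf : LinePoly m f) (hg : LinePoly n g) :
    LinePoly (max m n) fun x => f x + g x := by
  refine ⟨hf.1.add hg.1, fun x w => ?_⟩
  obtain ⟨P, hP, hPe⟩ := hf.2 x w
  obtain ⟨Q, hQ, hQe⟩ := hg.2 x w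
  refine ⟨P + Q, ?_, fun t => by simp [hPe, hQe]⟩
  exact (Polynomial.natDegree_add_le _ _).trans (max_le_max hP hQ)

lemma eq_evalFn_of_mem {k : ℕ} {f : Plane → ℝ} (hf : f ∈ polySpace k) :
    ∃ p : MvPolynomial (Fin 2) ℝ, p.totalDegree ≤ k ∧ f = evalFn p := by
  obtain ⟨p, hp, h⟩ := hf
  exact ⟨p, hp, funext h⟩

lemma linePoly_of_mem {k : ℕ} {f : Plane → ℝ} (hf : f ∈ polySpace k) : LinePoly k f := by
  obtain ⟨p, hp, rfl⟩ := eq_evalFn_of_mem hf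
  exact linePoly_evalFn hp

lemma linePoly_gradient {k : ℕ} {f : Plane → ℝ} (hf : f ∈ polySpace k) (i : Fin 2) :
    LinePoly k fun x => gradient f x i := by
  obtain ⟨p, hp, rfl⟩ := eq_evalFn_of_mem hf
  have : (fun x => gradient (evalFn p) x i) = evalFn (MvPolynomial.pderiv i p) := by
    funext x
    rw [← fderiv_evalFn, ← inner_gradient_eq, EuclideanSpace.inner_single_left]
    simp
  rw [this]
  exact linePoly_evalFn ((totalDegree_pderiv_le p i).trans hp)

lemma linePoly_of_mem_rt {k : ℕ} {v : Plane → Plane} (hv : v ∈ rtSpace k) (i : Fin 2) :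
    LinePoly (k + 1) fun x => v x i := by
  obtain ⟨a, ha, b, hb, h⟩ := hv
  have := (linePoly_of_mem (ha i)).add ((linePoly_of_mem hb).mul_coord i)
  rw [max_eq_right (Nat.le_succ k)] at this
  convert this using 2 with x
  simp [h]

lemma contDiff_of_mem_rt {k : ℕ} {v : Plane → Plane} (hv : v ∈ rtSpace k) : ContDiff ℝ ∞ v :=
  contDiff_euclidean.2 fun i => (linePoly_of_mem_rt hv i).1

lemma piece_spec {F : Type} [Zero F] {P : Set (Plane → F)} {f : Plane → F} {K : Finset Plane}
    (h : RestrictsTo P f K) :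
    piece P f K ∈ P ∧ f =ᵐ[volume.restrict (simplex K)] piece P f K := by
  rw [piece, dif_pos h]; exact h.choose_spec

lemma norm_le_of_coord {x : Plane} {B : ℝ} (h : ∀ i, |x i| ≤ B) : ‖x‖ ≤ 2 * B := by
  have hB : 0 ≤ B := (abs_nonneg _).trans (h 0)
  have h0 := sq_le_sq' (abs_le.1 (h 0)).1 (abs_le.1 (h 0)).2
  have h1 := sq_le_sq' (abs_le.1 (h 1)).1 (abs_le.1 (h 1)).2
  have := norm_sq_coord x
  nlinarith [norm_nonneg x]

/-! ### The Taylor operator -/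

lemma iteratedDeriv_line {E : Type*} [NormedAddCommGroup E] [NormedSpace ℝ E] {f : Plane → E}
    (hf : ContDiff ℝ ∞ f) (j : ℕ) (x w : Plane) :
    iteratedDeriv j (fun t : ℝ => f (x + t • w)) 0 = iteratedFDeriv ℝ j f x fun _ => w := by
  have h1 : (fun t : ℝ => f (x + t • w)) =
      (fun z => f (x + z)) ∘ (ContinuousLinearMap.toSpanSingleton ℝ w) := by
    funext t; simp [ContinuousLinearMap.toSpanSingleton_apply]
  have h2 : ContDiff ℝ ∞ fun z => f (x + z) := hf.comp (contDiff_const.add contDiff_id)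
  rw [iteratedDeriv_eq_iteratedFDeriv, h1, ContinuousLinearMap.iteratedFDeriv_comp_right
    _ h2 _ (by exact_mod_cast le_top), iteratedFDeriv_comp_add_left]
  simp [ContinuousLinearMap.toSpanSingleton_apply]

lemma measurable_taylor {Mh ν : Plane → Plane} (hM : Measurable Mh) (hν : Measurable ν) (k : ℕ)
    {v : Plane → Plane} (hv : ContDiff ℝ ∞ v) : Measurable (TriMesh.taylor Mh ν k v) := by
  have hδ : Measurable (TriMesh.delta Mh) := (hM.sub measurable_id).norm
  unfold TriMesh.taylor
  refine Finset.measurable_sum _ fun j _ => ?_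
  refine Measurable.smul ((hδ.pow_const j).div_const _) ?_
  simp only [iteratedDeriv_line hv]
  have hc : Continuous fun p : Plane × Plane => iteratedFDeriv ℝ j v p.1 fun _ => p.2 := by
    have h1 : Continuous (iteratedFDeriv ℝ j v) :=
      hv.continuous_iteratedFDeriv (by exact_mod_cast le_top)
    have h2 : Continuous fun p : Plane × Plane => iteratedFDeriv ℝ j v p.1 := h1.comp continuous_fst
    have h3 : Continuous fun p : Plane × Plane => (fun _ : Fin j => p.2) := by fun_prop
    exact continuous_eval.comp (h2.prodMk h3)
  exact hc.measurable.comp (measurable_id.prodMk hν)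

lemma iteratedDeriv_coord {f : ℝ → Plane} (hf : ContDiff ℝ ∞ f) (j : ℕ) (t : ℝ) (i : Fin 2) :
    iteratedDeriv j f t i = iteratedDeriv j (fun s => f s i) t := by
  have := (EuclideanSpace.proj (𝕜 := ℝ) i).iteratedFDeriv_comp_left
    (x := t) hf.contDiffAt (i := j) (by exact_mod_cast le_top)
  rw [iteratedDeriv_eq_iteratedFDeriv, iteratedDeriv_eq_iteratedFDeriv]
  have h2 : (fun s => f s i) = (EuclideanSpace.proj (𝕜 := ℝ) i) ∘ f := rfl
  rw [h2, this]
  rfl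

/-- The Taylor operator differs from the identity by `O(h)`, relative to the size of the field. The
constant depends on the bound `H` for `h`. The `j`-th term of the remainder is bounded by a multiple
of `(δ_h / h)^j B`, and `δ_h / h = O(h)`. -/
lemma exists_taylor_sub_le (k m : ℕ) (A H : ℝ) : ∃ C : ℝ, 0 < C ∧
    ∀ v : Plane → Plane, (∀ i, LinePoly m fun x => v x i) → ∀ (Mh ν : Plane → Plane) (x : Plane)
      (h B : ℝ), ‖ν x‖ = 1 → 0 < h → h ≤ H → TriMesh.delta Mh x ≤ A * h ^ 2 →
      (∀ y ∈ Metric.closedBall x h, ‖v y‖ ≤ B) →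
      ‖TriMesh.taylor Mh ν k v x - v x‖ ≤ C * h * B := by
  obtain ⟨C, hC, hder⟩ := exists_iteratedDeriv_le m
  set D := max (|A| * |H|) 1 with hD
  have hD1 : 1 ≤ D := le_max_right _ _
  refine ⟨k * (2 * C * ((|A| + 1) * D ^ k)) + 1, by positivity,
    fun v hv Mh ν x h B hν hh hhH hδ hB => ?_⟩
  have hB0 : 0 ≤ B := (norm_nonneg _).trans (hB x (Metric.mem_closedBall_self hh.le))
  have hvc : ContDiff ℝ ∞ v := contDiff_euclidean.2 fun i => (hv i).1
  have hδ0 : 0 ≤ TriMesh.delta Mh x := norm_nonneg _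
  have hterm : ∀ j ∈ Finset.range k, ‖(TriMesh.delta Mh x ^ (j + 1) / ((j + 1).factorial : ℝ)) •
      iteratedDeriv (j + 1) (fun t : ℝ => v (x + t • ν x)) 0‖ ≤
      2 * C * ((|A| + 1) * D ^ k) * h * B := by
    intro j hj
    have h1 : ‖iteratedDeriv (j + 1) (fun t : ℝ => v (x + t • ν x)) 0‖ ≤
        2 * ((j + 1).factorial * (C * B / h ^ (j + 1))) := by
      refine norm_le_of_coord fun i => ?_
      have hl : ContDiff ℝ ∞ fun t : ℝ => v (x + t • ν x) := hvc.comp (by fun_prop)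
      rw [iteratedDeriv_coord hl]
      refine hder _ (hv i) x (ν x) h B hν.le hh (fun y hy => ?_) _
      exact (PiLp.norm_apply_le (v y) i).trans (hB y hy)
    have hA0 : TriMesh.delta Mh x ≤ |A| * h ^ 2 :=
      hδ.trans (mul_le_mul_of_nonneg_right (le_abs_self A) (by positivity))
    have h2 : TriMesh.delta Mh x / h ≤ |A| * h := by
      rw [div_le_iff₀ hh]; linarith [hA0]
    have h3 : (TriMesh.delta Mh x / h) ^ (j + 1) ≤ (|A| + 1) * D ^ k * h := by
      rw [pow_succ]
      have h4 : TriMesh.delta Mh x / h ≤ D := h2.trans (le_trans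
        (mul_le_mul_of_nonneg_left (hhH.trans (le_abs_self H)) (abs_nonneg A)) (le_max_left _ _))
      calc (TriMesh.delta Mh x / h) ^ j * (TriMesh.delta Mh x / h) ≤ D ^ j * (|A| * h) := by gcongr
        _ ≤ D ^ k * ((|A| + 1) * h) := by
            have := pow_le_pow_right₀ hD1 (Finset.mem_range.1 hj).le
            gcongr
            linarith
        _ = _ := by ring
    have hf : (0 : ℝ) < (j + 1).factorial := by exact_mod_cast (j + 1).factorial_pos
    rw [norm_smul, Real.norm_of_nonneg (by positivity)]
    calc _ ≤ TriMesh.delta Mh x ^ (j + 1) / ((j + 1).factorial : ℝ) *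
          (2 * ((j + 1).factorial * (C * B / h ^ (j + 1)))) := by gcongr
      _ = 2 * C * B * (TriMesh.delta Mh x / h) ^ (j + 1) := by
          rw [div_pow]; field_simp
      _ ≤ 2 * C * B * ((|A| + 1) * D ^ k * h) := by gcongr
      _ = _ := by ring
  have e : TriMesh.taylor Mh ν k v x - v x = ∑ j ∈ Finset.range k,
      (TriMesh.delta Mh x ^ (j + 1) / ((j + 1).factorial : ℝ)) •
        iteratedDeriv (j + 1) (fun t : ℝ => v (x + t • ν x)) 0 := by
    rw [TriMesh.taylor, Finset.sum_range_succ']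
    simp
  rw [e]
  refine (norm_sum_le_of_le _ hterm).trans ?_
  rw [Finset.sum_const, Finset.card_range, nsmul_eq_mul]
  have : 0 ≤ h * B := by positivity
  nlinarith

/-! ### Inscribed balls -/

namespace TriMesh
variable {M : TriMesh}

lemma hK_le_h {K : Finset Plane} (hK : K ∈ M.elems) : BVC.hK K ≤ M.h :=
  Finset.le_sup' BVC.hK hK

lemma bddAbove_inscribed (K : Finset Plane) : BddAbove {d : ℝ | ∃ (c : Plane) (r : ℝ), 0 ≤ r ∧
    Metric.closedBall c r ⊆ simplex K ∧ d = 2 * r} := by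
  refine ⟨BVC.hK K, ?_⟩
  rintro _ ⟨c, r, hr, hsub, rfl⟩
  have hn : ‖(EuclideanSpace.single 0 r : Plane)‖ = r := by simp [abs_of_nonneg hr]
  have h1 : c + EuclideanSpace.single 0 r ∈ simplex K := hsub (by simp [hn])
  have h2 : c - EuclideanSpace.single 0 r ∈ simplex K := hsub (by simp [hn])
  have := Metric.dist_le_diam_of_mem (isCompact_simplex K).isBounded h1 h2
  rw [dist_eq_norm, add_sub_sub_cancel, ← two_smul ℝ, norm_smul, hn] at this
  simpa [BVC.hK] using this

lemma exists_ball_subset {K : Finset Plane} (hK : K ∈ M.elems) :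
    ∃ c r, 0 < r ∧ Metric.closedBall c r ⊆ simplex K ∧ rhoK K < 4 * r ∧ 0 < rhoK K := by
  obtain ⟨x, hx⟩ := interior_simplex_nonempty hK
  obtain ⟨r, hr, hb⟩ := Metric.nhds_basis_closedBall.mem_iff.1 (mem_interior_iff_mem_nhds.1 hx)
  have hpos : 0 < rhoK K :=
    lt_of_lt_of_le (by positivity) (le_csSup (bddAbove_inscribed K) ⟨x, r, hr.le, hb, rfl⟩)
  obtain ⟨_, ⟨c, r', hr', hsub, rfl⟩, hlt⟩ := exists_lt_of_lt_csSup
    (s := {d : ℝ | ∃ (c : Plane) (r : ℝ), 0 ≤ r ∧ Metric.closedBall c r ⊆ simplex K ∧ d = 2 * r})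
    ⟨_, x, r, hr.le, hb, rfl⟩ (half_lt_self hpos)
  change rhoK K / 2 < 2 * r' at hlt
  exact ⟨c, r', by linarith, hsub, by linarith, hpos⟩

lemma h_pos : 0 < M.h := by
  obtain ⟨K, hK⟩ := M.nonempty
  obtain ⟨c, r, hr, hsub, -, -⟩ := exists_ball_subset hK
  refine lt_of_lt_of_le ?_ (hK_le_h hK)
  have hn : ‖(EuclideanSpace.single 0 r : Plane)‖ = r := by simp [abs_of_pos hr]
  have h1 : c + EuclideanSpace.single 0 r ∈ simplex K := hsub (by simp [hn])
  have h2 : c ∈ simplex K := hsub (by simp [hr.le])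
  have := Metric.dist_le_diam_of_mem (isCompact_simplex K).isBounded h1 h2
  rw [dist_eq_norm, add_sub_cancel_left, hn] at this
  exact hr.trans_le this

/-- Elements of a shape-regular quasi-uniform mesh contain balls of radius comparable to `h`. -/
lemma exists_ball_of_regular {σ τ : ℝ} (hσ : 0 < σ) (hreg : M.ShapeRegular σ)
    (hqu : M.QuasiUniform τ) {K : Finset Plane} (hK : K ∈ M.elems) :
    ∃ c, Metric.closedBall c (τ / (4 * σ) * M.h) ⊆ simplex K := by
  obtain ⟨c, r, hr, hsub, h1, h2⟩ := exists_ball_subset hK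
  refine ⟨c, (Metric.closedBall_subset_closedBall ?_).trans hsub⟩
  have h3 := hreg K hK
  rw [div_le_iff₀ h2] at h3
  have h4 := hqu K hK
  rw [div_mul_eq_mul_div, div_le_iff₀ (by positivity)]
  nlinarith

lemma dist_le_h {K : Finset Plane} (hK : K ∈ M.elems) {x y : Plane} (hx : x ∈ simplex K)
    (hy : y ∈ simplex K) : dist x y ≤ M.h :=
  (Metric.dist_le_diam_of_mem (isCompact_simplex K).isBounded hx hy).trans (hK_le_h hK)

/-- The inverse estimate `sup |f| ≤ C h⁻¹ ‖f‖_{0,K}`, on an `h`-neighbourhood of `K`. -/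
lemma exists_inverse_estimate (m : ℕ) {σ τ : ℝ} (hσ : 0 < σ) (hτ : 0 < τ) :
    ∃ C : ℝ, 0 < C ∧ ∀ M : TriMesh, M.ShapeRegular σ → M.QuasiUniform τ → ∀ K ∈ M.elems,
      ∀ f : Plane → ℝ, LinePoly m f → ∀ x ∈ simplex K, ∀ y ∈ Metric.closedBall x M.h,
        f y ^ 2 ≤ C / M.h ^ 2 * ∫ z in simplex K, f z ^ 2 := by
  obtain ⟨C, hC, hest⟩ := exists_sq_le_integral m (8 * σ / τ)
  refine ⟨C / (τ / (4 * σ)) ^ 2, by positivity, fun M hreg hqu K hK f hf x hx y hy => ?_⟩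
  have hh := M.h_pos
  obtain ⟨c, hc⟩ := exists_ball_of_regular hσ hreg hqu hK
  have hcK : c ∈ simplex K := hc (Metric.mem_closedBall_self (by positivity))
  have := hest f hf c _ (by positivity : 0 < τ / (4 * σ) * M.h) _ (isCompact_simplex K) hc y ?_
  · rwa [mul_pow, ← div_div] at this
  · rw [Metric.mem_closedBall] at hy ⊢
    rw [show 8 * σ / τ * (τ / (4 * σ) * M.h) = 2 * M.h by field_simp; ring]
    linarith [dist_triangle y x c, dist_le_h hK hx hcK]

/-- The inverse estimate for vector fields. -/
lemma exists_inverse_estimate_vec (m : ℕ) {σ τ : ℝ} (hσ : 0 < σ) (hτ : 0 < τ) :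
    ∃ C : ℝ, 0 < C ∧ ∀ M : TriMesh, M.ShapeRegular σ → M.QuasiUniform τ → ∀ K ∈ M.elems,
      ∀ v : Plane → Plane, (∀ i, LinePoly m fun x => v x i) →
        ∀ x ∈ simplex K, ∀ y ∈ Metric.closedBall x M.h,
        ‖v y‖ ^ 2 ≤ C / M.h ^ 2 * ∫ z in simplex K, ‖v z‖ ^ 2 := by
  obtain ⟨C, hC, hest⟩ := exists_inverse_estimate m hσ hτ
  refine ⟨C, hC, fun M hreg hqu K hK v hv x hx y hy => ?_⟩
  have hi : ∀ i, IntegrableOn (fun z => v z i ^ 2) (simplex K) := fun i =>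
    ((hv i).1.continuous.pow 2).continuousOn.integrableOn_compact (isCompact_simplex K)
  simp only [norm_sq_coord]
  rw [integral_add (hi 0) (hi 1), mul_add]
  exact add_le_add (hest M hreg hqu K hK _ (hv 0) x hx y hy)
    (hest M hreg hqu K hK _ (hv 1) x hx y hy)

end TriMesh

/-! ### Counting elements, and walks in the dual graph -/

/-- A Lipschitz curve is covered by `O(1/δ)` balls of radius `δ`. -/
lemma exists_cover_curve {γ : ℝ → Plane} {Λ α β δ : ℝ} (hΛ : 0 < Λ) (hδ : 0 < δ) (hαβ : α ≤ β)
    (hγ : ∀ s t, dist (γ s) (γ t) ≤ Λ * |s - t|) :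
    ∃ F : Finset Plane, (F.card : ℝ) ≤ Λ * (β - α) / δ + 1 ∧
      ∀ s ∈ Set.Icc α β, ∃ p ∈ F, dist (γ s) p ≤ δ := by
  classical
  refine ⟨(Finset.range (⌊Λ * (β - α) / δ⌋₊ + 1)).image fun i : ℕ => γ (α + i * (δ / Λ)), ?_, ?_⟩
  · refine (Nat.cast_le.2 Finset.card_image_le).trans ?_
    rw [Finset.card_range, Nat.cast_add, Nat.cast_one]
    gcongr
    have : 0 ≤ β - α := by linarith
    exact Nat.floor_le (by positivity)
  · intro s hs
    have h0 : 0 ≤ s - α := by linarith [hs.1]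
    have hx : 0 ≤ Λ * (s - α) / δ := by positivity
    set i := ⌊Λ * (s - α) / δ⌋₊
    refine ⟨_, Finset.mem_image.2 ⟨i, ?_, rfl⟩, ?_⟩
    · rw [Finset.mem_range, Nat.lt_succ_iff]
      refine Nat.floor_le_floor ?_
      gcongr
      exact hs.2
    · refine (hγ _ _).trans ?_
      have h1 : (i : ℝ) ≤ Λ * (s - α) / δ := Nat.floor_le hx
      have h2 : Λ * (s - α) / δ < i + 1 := Nat.lt_floor_add_one _
      have e : s - (α + i * (δ / Λ)) = δ / Λ * (Λ * (s - α) / δ - i) := by field_simp; ring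
      rw [e, abs_of_nonneg (mul_nonneg (by positivity) (by linarith))]
      calc Λ * (δ / Λ * (Λ * (s - α) / δ - i)) = δ * (Λ * (s - α) / δ - i) := by field_simp
        _ ≤ δ * 1 := by gcongr; linarith
        _ = δ := mul_one δ

lemma isPreconnected_ball_diff (x : Plane) {r : ℝ} (hr : 0 < r) {F : Set Plane}
    (hF : F.Countable) : IsPreconnected (Metric.ball x r \ F) := by
  have hrank : 1 < Module.rank ℝ Plane := by
    rw [← Module.finrank_eq_rank]; simp
  set Φ := OpenPartialHomeomorph.univBall x r
  have hinj : Function.Injective Φ := by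
    have := Φ.injOn
    rwa [OpenPartialHomeomorph.univBall_source, Set.injOn_univ] at this
  have h1 : IsConnected (Φ ⁻¹' F)ᶜ :=
    (hF.preimage hinj).isConnected_compl_of_one_lt_rank hrank
  have h2 : Metric.ball x r \ F = Φ '' (Φ ⁻¹' F)ᶜ := by
    ext y
    constructor
    · rintro ⟨hy, hyF⟩
      have hy' : y ∈ Φ.target := by rwa [OpenPartialHomeomorph.univBall_target x hr]
      refine ⟨Φ.symm y, ?_, Φ.right_inv hy'⟩
      simpa [Φ.right_inv hy'] using hyF
    · rintro ⟨z, hz, rfl⟩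
      refine ⟨?_, hz⟩
      rw [← OpenPartialHomeomorph.univBall_target x hr]
      exact Φ.map_source (by simp [Φ])
  rw [h2]
  exact (h1.image Φ (OpenPartialHomeomorph.continuous_univBall x r).continuousOn).isPreconnected

namespace TriMesh

variable {M : TriMesh}

/-- The number of elements that come `h`-close to a finite point set is bounded by a multiple of
its cardinality: the elements have disjoint interiors, contain balls of radius comparable to `h`, and
lie within distance `2 h` of the set. -/
lemma card_le_of_near {σ τ : ℝ} (hσ : 0 < σ) (hτ : 0 < τ) (hreg : M.ShapeRegular σ)
    (hqu : M.QuasiUniform τ) {F : Finset Plane} {S : Finset (Finset Plane)} (hS : S ⊆ M.elems)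
    (hF : ∀ K ∈ S, ∃ p ∈ F, ∃ x ∈ simplex K, dist x p ≤ M.h) :
    (S.card : ℝ) ≤ (8 * σ / τ) ^ 2 * F.card := by
  have hh := M.h_pos
  set r := τ / (4 * σ) * M.h with hr
  have hr0 : 0 < r := by positivity
  set c₀ := volume (Metric.closedBall (0 : Plane) 1) with hc₀
  have hc₀pos : c₀ ≠ 0 := (Metric.measure_closedBall_pos volume _ one_pos).ne'
  have hc₀top : c₀ ≠ ⊤ := measure_closedBall_lt_top.ne
  have hvol : ∀ (x : Plane) {ρ : ℝ}, 0 ≤ ρ →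
      volume (Metric.closedBall x ρ) = ENNReal.ofReal (ρ ^ 2) * c₀ := fun x ρ hρ => by
    rw [Measure.addHaar_closedBall' volume x hρ]; simp [hc₀]
  have h1 : ∑ K ∈ S, volume (simplex K) = volume (⋃ K ∈ S, simplex K) := by
    refine (measure_biUnion_finset₀ (fun K hK L hL hKL => ?_) fun K _ =>
      (isCompact_simplex K).measurableSet.nullMeasurableSet).symm
    exact volume_inter (hS hK) (hS hL) hKL
  have h2 : (S.card : ENNReal) * (ENNReal.ofReal (r ^ 2) * c₀) ≤ ∑ K ∈ S, volume (simplex K) := by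
    rw [← nsmul_eq_mul]
    refine Finset.card_nsmul_le_sum _ _ _ fun K hK => ?_
    obtain ⟨c, hc⟩ := exists_ball_of_regular hσ hreg hqu (hS hK)
    rw [← hvol c hr0.le]
    exact measure_mono hc
  have h3 : volume (⋃ K ∈ S, simplex K) ≤
      (F.card : ENNReal) * (ENNReal.ofReal ((2 * M.h) ^ 2) * c₀) := by
    calc volume (⋃ K ∈ S, simplex K) ≤ volume (⋃ p ∈ F, Metric.closedBall p (2 * M.h)) := by
          refine measure_mono fun y hy => ?_
          obtain ⟨K, hK, hyK⟩ := Set.mem_iUnion₂.1 hy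
          obtain ⟨p, hp, x, hx, hxp⟩ := hF K hK
          refine Set.mem_iUnion₂.2 ⟨p, hp, ?_⟩
          rw [Metric.mem_closedBall]
          linarith [dist_triangle y x p, dist_le_h (hS hK) hyK hx]
      _ ≤ ∑ p ∈ F, volume (Metric.closedBall p (2 * M.h)) := measure_biUnion_finset_le _ _
      _ = _ := by
          rw [Finset.sum_congr rfl fun p _ => hvol p (by positivity), Finset.sum_const,
            nsmul_eq_mul]
  have h4 := h2.trans (h1.le.trans h3)
  rw [← mul_assoc, ← mul_assoc, ENNReal.mul_le_mul_iff_left hc₀pos hc₀top] at h4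
  have h5 := ENNReal.toReal_mono (by finiteness) h4
  rw [ENNReal.toReal_mul, ENNReal.toReal_mul, ENNReal.toReal_ofReal (by positivity),
    ENNReal.toReal_ofReal (by positivity), ENNReal.toReal_natCast, ENNReal.toReal_natCast] at h5
  have e : (8 * σ / τ) ^ 2 * F.card * r ^ 2 = F.card * (2 * M.h) ^ 2 := by
    rw [hr]; field_simp; ring
  have hr2 : 0 < r ^ 2 := by positivity
  exact le_of_mul_le_mul_right (by linarith) hr2

variable (M) in
/-- The dual graph of a mesh: two elements are adjacent if they share an edge. -/
def dualGraph : SimpleGraph (Finset Plane) where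
  Adj K L := K ≠ L ∧ K ∈ M.elems ∧ L ∈ M.elems ∧ ∃ e ∈ M.intEdges, e ⊆ K ∧ e ⊆ L
  symm := ⟨fun _ _ ⟨h, hK, hL, e, he, h1, h2⟩ => ⟨h.symm, hL, hK, e, he, h2, h1⟩⟩
  loopless := ⟨fun _ h => h.1 rfl⟩

lemma mem_elems_of_walk {K L : Finset Plane} (p : M.dualGraph.Walk K L) (hK : K ∈ M.elems) :
    L ∈ M.elems := by
  induction p with
  | nil => exact hK
  | cons h _ ih => exact ih h.2.2.1

/-- A relation between elements that holds for elements with a common point in a preconnected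
set `U` holds for all elements that meet `U`. -/
lemma rel_of_preconnected {S : Finset (Finset Plane)} {U : Set Plane} (hU : IsPreconnected U)
    (hcov : ∀ x ∈ U, ∃ K ∈ S, x ∈ simplex K) {R : Finset Plane → Finset Plane → Prop}
    (htrans : ∀ K ∈ S, ∀ L ∈ S, ∀ T ∈ S, R K L → R L T → R K T)
    (hloc : ∀ x ∈ U, ∀ K ∈ S, ∀ L ∈ S, x ∈ simplex K → x ∈ simplex L → R K L)
    {K L : Finset Plane} (hK : K ∈ S) (hL : L ∈ S) (hKU : (simplex K ∩ U).Nonempty)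
    (hLU : (simplex L ∩ U).Nonempty) : R K L := by
  classical
  by_contra hcon
  have hcl : ∀ s : Finset (Finset Plane), IsClosed (⋃ T ∈ s, simplex T) := fun s =>
    s.finite_toSet.isClosed_biUnion fun T _ => (isCompact_simplex T).isClosed
  have h1 : U ⊆ (⋃ T ∈ S.filter (R K), simplex T) ∪ ⋃ T ∈ S.filter fun T => ¬ R K T, simplex T := by
    intro x hx
    obtain ⟨T, hT, hxT⟩ := hcov x hx
    by_cases h : R K T
    · exact Or.inl (Set.mem_biUnion (Finset.mem_filter.2 ⟨hT, h⟩) hxT)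
    · exact Or.inr (Set.mem_biUnion (Finset.mem_filter.2 ⟨hT, h⟩) hxT)
  have h2 : (U ∩ ⋃ T ∈ S.filter (R K), simplex T).Nonempty := by
    obtain ⟨x, hxK, hxU⟩ := hKU
    exact ⟨x, hxU, Set.mem_biUnion (Finset.mem_filter.2 ⟨hK, hloc x hxU K hK K hK hxK hxK⟩) hxK⟩
  have h3 : (U ∩ ⋃ T ∈ S.filter fun T => ¬ R K T, simplex T).Nonempty := by
    obtain ⟨x, hxL, hxU⟩ := hLU
    exact ⟨x, hxU, Set.mem_biUnion (Finset.mem_filter.2 ⟨hL, hcon⟩) hxL⟩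
  obtain ⟨x, hxU, hxA, hxB⟩ := isPreconnected_closed_iff.1 hU _ _ (hcl _) (hcl _) h1 h2 h3
  obtain ⟨T, hT, hxT⟩ := Set.mem_iUnion₂.1 hxA
  obtain ⟨T', hT', hxT'⟩ := Set.mem_iUnion₂.1 hxB
  rw [Finset.mem_filter] at hT hT'
  exact hT'.2 (htrans K hK T hT.1 T' hT'.1 hT.2 (hloc x hxU T hT.1 T' hT'.1 hxT hxT'))

/-- Elements that meet a connected open subset `U` of the domain are joined by a walk through
elements that meet `U`. Vertices are no obstruction: removing them does not disconnect a ball, and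
elements with a common point other than a vertex share an edge. -/
theorem exists_walk_of_preconnected {U : Set Plane} (hUo : IsOpen U) (hU : IsPreconnected U)
    (hUD : U ⊆ M.domain) {S : Finset (Finset Plane)} (hSM : S ⊆ M.elems)
    (hS : ∀ K ∈ M.elems, (simplex K ∩ U).Nonempty → K ∈ S) {K L : Finset Plane}
    (hK : K ∈ M.elems) (hL : L ∈ M.elems) (hKU : (simplex K ∩ U).Nonempty)
    (hLU : (simplex L ∩ U).Nonempty) :
    ∃ p : M.dualGraph.Walk K L, p.length ≤ S.card := by
  classical
  set R : Finset Plane → Finset Plane → Prop := fun K L =>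
    ∃ (hK : K ∈ (S : Set (Finset Plane))) (hL : L ∈ (S : Set (Finset Plane))),
      (M.dualGraph.induce (S : Set (Finset Plane))).Reachable ⟨K, hK⟩ ⟨L, hL⟩ with hR
  have htrans : ∀ K ∈ S, ∀ L ∈ S, ∀ T ∈ S, R K L → R L T → R K T :=
    fun K _ L _ T _ ⟨h1, h2, h3⟩ ⟨h1', h2', h3'⟩ => ⟨h1, h2', h3.trans h3'⟩
  have hcov : ∀ x ∈ U, ∃ K ∈ S, x ∈ simplex K := fun x hx => by
    obtain ⟨T, hT, hxT⟩ := Set.mem_iUnion₂.1 (M.domain_subset_cover (hUD hx))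
    exact ⟨T, hS T hT ⟨x, hxT, hx⟩, hxT⟩
  set W : Set Plane := ⋃ K ∈ M.elems, (K : Set Plane) with hW
  have hWc : W.Countable := (M.elems.finite_toSet.biUnion fun K _ => K.finite_toSet).countable
  have hloc : ∀ x ∈ U, ∀ K ∈ S, ∀ L ∈ S, x ∈ simplex K → x ∈ simplex L → R K L := by
    intro x hx K hK L hL hxK hxL
    obtain ⟨r, hr, hb⟩ := Metric.isOpen_iff.1 hUo x hx
    have hmeet : ∀ T ∈ S, x ∈ simplex T → (simplex T ∩ (Metric.ball x r \ W)).Nonempty := by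
      intro T hT hxT
      rw [simplex_eq_closure_interior (hSM hT)] at hxT
      obtain ⟨y, hyT, hy⟩ := Metric.mem_closure_iff.1 hxT r hr
      obtain ⟨z, hz, hzW⟩ := (hWc.dense_compl ℝ).inter_open_nonempty
        (interior (simplex T) ∩ Metric.ball x r) (isOpen_interior.inter Metric.isOpen_ball)
        ⟨y, hyT, Metric.mem_ball'.2 hy⟩
      exact ⟨z, interior_subset hz.1, hz.2, hzW⟩
    refine rel_of_preconnected (isPreconnected_ball_diff x hr hWc) (fun y hy => hcov y (hb hy.1))
      htrans ?_ hK hL (hmeet K hK hxK) (hmeet L hL hxL)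
    intro y hy T hT T' hT' hyT hyT'
    refine ⟨hT, hT', ?_⟩
    by_cases hne : T = T'
    · subst hne; exact SimpleGraph.Reachable.rfl
    · obtain ⟨e, he, h1, h2⟩ := edge_of_common_point (hSM hT) (hSM hT') hne hyT hyT'
        fun h => hy.2 (Set.mem_biUnion (hSM hT) h)
      exact SimpleGraph.Adj.reachable ⟨hne, hSM hT, hSM hT', e, he, h1, h2⟩
  obtain ⟨h1, h2, hreach⟩ := rel_of_preconnected hU hcov htrans hloc (hS K hK hKU) (hS L hL hLU)
    hKU hLU
  obtain ⟨p, hp⟩ := hreach.exists_isPath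
  have h3 := SimpleGraph.Walk.length_map (SimpleGraph.Embedding.induce _).toHom p
  have h4 : p.length ≤ S.card := by simpa using hp.length_lt.le
  exact ⟨p.map (SimpleGraph.Embedding.induce _).toHom, h3.le.trans h4⟩

/-- The elements near a segment of length at most `ℓ` inside the domain form a walk of length
`O(ℓ / h + 1)`. -/
lemma exists_walk_of_segment {σ τ : ℝ} (hσ : 0 < σ) (hτ : 0 < τ) (hreg : M.ShapeRegular σ)
    (hqu : M.QuasiUniform τ) {x y : Plane} {ℓ : ℝ} (hℓ : 0 < ℓ) (hxy : dist x y ≤ ℓ)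
    (hseg : segment ℝ x y ⊆ M.domain) {K L : Finset Plane} (hK : K ∈ M.elems) (hL : L ∈ M.elems)
    (hxK : x ∈ simplex K) (hyL : y ∈ simplex L) :
    ∃ p : M.dualGraph.Walk K L, (p.length : ℝ) ≤ (8 * σ / τ) ^ 2 * (2 * ℓ / M.h + 1) := by
  classical
  have hh := M.h_pos
  have hcpt : IsCompact (segment ℝ x y) := by
    rw [segment_eq_image']
    exact isCompact_Icc.image (by fun_prop)
  obtain ⟨ε, hε, hεD⟩ := hcpt.exists_thickening_subset_open M.isOpen_domain hseg
  set δ := min ε (M.h / 2)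
  have hδ : 0 < δ := lt_min hε (by positivity)
  set U := Metric.thickening δ (segment ℝ x y) with hU
  have hUD : U ⊆ M.domain := (Metric.thickening_mono (min_le_left _ _) _).trans hεD
  have hUpre : IsPreconnected U := ((convex_segment x y).thickening δ).isPreconnected
  have hsub : segment ℝ x y ⊆ U := Metric.self_subset_thickening hδ _
  obtain ⟨p, hp⟩ := exists_walk_of_preconnected Metric.isOpen_thickening hUpre hUD
    (S := M.elems.filter fun T => (simplex T ∩ U).Nonempty) (Finset.filter_subset _ _)
    (fun T hT h => Finset.mem_filter.2 ⟨hT, h⟩) hK hL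
    ⟨x, hxK, hsub (left_mem_segment ℝ x y)⟩ ⟨y, hyL, hsub (right_mem_segment ℝ x y)⟩
  refine ⟨p, (Nat.cast_le.2 hp).trans ?_⟩
  obtain ⟨F, hFc, hF⟩ := exists_cover_curve (γ := fun s => x + s • (y - x)) (α := 0) (β := 1) hℓ
    (half_pos hh) zero_le_one fun s t => by
      rw [dist_eq_norm, add_sub_add_left_eq_sub, ← sub_smul, norm_smul, Real.norm_eq_abs, mul_comm,
        ← dist_eq_norm, dist_comm y]
      gcongr
  refine (card_le_of_near hσ hτ hreg hqu (F := F) (Finset.filter_subset _ _) ?_).trans ?_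
  · intro T hT
    obtain ⟨z, hzT, hzU⟩ := (Finset.mem_filter.1 hT).2
    obtain ⟨w, hw, hzw⟩ := Metric.mem_thickening_iff.1 hzU
    rw [segment_eq_image'] at hw
    obtain ⟨s, hs, rfl⟩ := hw
    obtain ⟨p, hpF, hp⟩ := hF s hs
    refine ⟨p, hpF, z, hzT, ?_⟩
    have : δ ≤ M.h / 2 := min_le_right _ _
    linarith [dist_triangle z (x + s • (y - x)) p]
  · gcongr
    refine hFc.trans (le_of_eq ?_)
    field_simp
    ring

/-- A function on the elements varies along a path at most by the sum of its jumps over the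
crossed edges, each of which is crossed once. -/
lemma exists_edges_of_path (m : Finset Plane → ℝ) {K L : Finset Plane}
    (p : M.dualGraph.Walk K L) (hp : p.IsPath) :
    ∃ E ⊆ M.intEdges, E.card = p.length ∧ (∀ e ∈ E, ∀ T ∈ M.elems, e ⊆ T → T ∈ p.support) ∧
      |m K - m L| ≤ ∑ e ∈ E, |m (M.sides e).1 - m (M.sides e).2| := by
  classical
  induction p with
  | nil => exact ⟨∅, by simp, by simp, by simp, by simp⟩
  | @cons K K' L h p ih =>
    rw [SimpleGraph.Walk.cons_isPath_iff] at hp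
    obtain ⟨E, hE, hcard, hsup, hle⟩ := ih hp.1
    obtain ⟨hne, hK, hK', e, he, heK, heK'⟩ := id h
    have heE : e ∉ E := fun h => hp.2 (hsup e h K hK heK)
    obtain ⟨he2, hi⟩ := mem_intEdges.1 he
    obtain ⟨h1, h2, hne', he1, he2'⟩ := sides_spec hi
    refine ⟨insert e E, Finset.insert_subset he hE, by simp [heE, hcard], ?_, ?_⟩
    · intro e' he' T hT he'T
      rw [SimpleGraph.Walk.support_cons, List.mem_cons]
      rcases Finset.mem_insert.1 he' with rfl | he'
      · rcases eq_or_eq_of_edge hK hK' hT hne heK heK' he'T he2 with rfl | rfl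
        · exact Or.inl rfl
        · exact Or.inr p.start_mem_support
      · exact Or.inr (hsup e' he' T hT he'T)
    · rw [Finset.sum_insert heE]
      have e1 : |m K - m K'| = |m (M.sides e).1 - m (M.sides e).2| := by
        rcases eq_or_eq_of_edge h1 h2 hK hne' he1 he2' heK he2 with h | h <;>
        rcases eq_or_eq_of_edge h1 h2 hK' hne' he1 he2' heK' he2 with h' | h'
        · exact absurd (h.trans h'.symm) hne
        · rw [h, h']
        · rw [h, h', abs_sub_comm]
        · exact absurd (h.trans h'.symm) hne
      calc |m K - m L| ≤ |m K - m K'| + |m K' - m L| := abs_sub_le _ _ _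
        _ ≤ _ := by rw [e1]; gcongr

/-- If the elements fall into `J` classes, and elements of a class are joined by walks of length at
most `D`, then a shortest walk has at most `J (D + 1)` steps: of `J + 1` elements at distances
`D + 1` along it, two would be in one class, and the walk could be shortened between them. -/
lemma exists_walk_of_colouring {ι : Type*} (A : Finset ι) (col : Finset Plane → ι) (D : ℕ)
    (hcol : ∀ K ∈ M.elems, col K ∈ A)
    (hD : ∀ K ∈ M.elems, ∀ L ∈ M.elems, col K = col L →
      ∃ p : M.dualGraph.Walk K L, p.length ≤ D) {K L : Finset Plane} (hK : K ∈ M.elems)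
    (hr : M.dualGraph.Reachable K L) :
    ∃ p : M.dualGraph.Walk K L, p.length ≤ A.card * (D + 1) := by
  obtain ⟨p, hp⟩ := hr.exists_walk_length_eq_dist
  refine ⟨p, ?_⟩
  by_contra! hlt
  have hmaps : ∀ i ∈ Finset.range (A.card + 1), col (p.getVert (i * (D + 1))) ∈ A :=
    fun i _ => hcol _ (mem_elems_of_walk (p.take _) hK)
  have hlen : ∀ i ∈ Finset.range (A.card + 1), i * (D + 1) ≤ p.length := fun i hi =>
    (Nat.mul_le_mul_right _ (Nat.lt_succ_iff.1 (Finset.mem_range.1 hi))).trans hlt.le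
  have key : ∀ i ∈ Finset.range (A.card + 1), ∀ j ∈ Finset.range (A.card + 1), i < j →
      col (p.getVert (i * (D + 1))) ≠ col (p.getVert (j * (D + 1))) := by
    intro i hi j hj hij heq
    obtain ⟨q, hq⟩ := hD _ (mem_elems_of_walk (p.take _) hK) _
      (mem_elems_of_walk (p.take _) hK) heq
    have := SimpleGraph.dist_le ((p.take (i * (D + 1))).append (q.append (p.drop (j * (D + 1)))))
    rw [← hp, SimpleGraph.Walk.length_append, SimpleGraph.Walk.length_append,
      SimpleGraph.Walk.take_length, SimpleGraph.Walk.drop_length] at this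
    have h1 := hlen i hi
    have h2 := hlen j hj
    have h3 : i * (D + 1) + (D + 1) ≤ j * (D + 1) := by nlinarith
    rw [min_eq_left h1] at this
    omega
  obtain ⟨i, hi, j, hj, hne, heq⟩ := Finset.exists_ne_map_eq_of_card_lt_of_maps_to
    (by simp) hmaps
  rcases lt_or_gt_of_ne hne with h | h
  · exact key i hi j hj h heq
  · exact key j hj i hi h heq.symm

end TriMesh

/-! ### Lipschitz boundaries -/

/-- In the ball of radius `ε` about `x`, the set `Ω` is the region below the graph of the
`L`-Lipschitz function `ψ`, in the orthonormal coordinates `R`. -/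
def IsChart (Ω : Set Plane) (x : Plane) (R : Plane ≃ₗᵢ[ℝ] Plane) (ψ : ℝ → ℝ) (L : NNReal)
    (ε : ℝ) : Prop :=
  LipschitzWith L ψ ∧ 0 < ε ∧ ∀ y ∈ Metric.ball x ε, (y ∈ Ω ↔ (R y) 1 < ψ ((R y) 0))

/-- The upward direction of a chart. -/
def upDir (R : Plane ≃ₗᵢ[ℝ] Plane) : Plane := R.symm (EuclideanSpace.single 1 1)

lemma norm_upDir (R : Plane ≃ₗᵢ[ℝ] Plane) : ‖upDir R‖ = 1 := by simp [upDir]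

/-- The aperture parameter of the interior cones of an `L`-Lipschitz graph. The constant satisfies
`aperture L * (1 + L) = 1 / 2`, which is what the cone property needs. -/
def aperture (L : NNReal) : ℝ := 1 / (2 * (1 + L))

lemma aperture_pos (L : NNReal) : 0 < aperture L := by unfold aperture; positivity

lemma aperture_le (L : NNReal) : aperture L ≤ 1 / 2 := by
  unfold aperture
  gcongr
  have := L.coe_nonneg
  linarith

section chart
variable {Ω : Set Plane} {x₀ : Plane} {R : Plane ≃ₗᵢ[ℝ] Plane} {ψ : ℝ → ℝ} {L : NNReal} {ε : ℝ}

lemma IsChart.graph (hΩ : IsOpen Ω) (hc : IsChart Ω x₀ R ψ L ε) {z : Plane}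
    (hz : z ∈ frontier Ω) (hzb : z ∈ Metric.ball x₀ ε) : (R z) 1 = ψ ((R z) 0) := by
  obtain ⟨hψ, hε, h⟩ := hc
  have hzΩ : z ∉ Ω := fun h => by
    rw [hΩ.frontier_eq] at hz; exact hz.2 h
  refine le_antisymm ?_ (not_lt.1 fun h' => hzΩ ((h z hzb).2 h'))
  by_contra! hlt
  have hcψ := hψ.continuous
  have hopen : IsOpen ({y : Plane | ψ ((R y) 0) < (R y) 1} ∩ Metric.ball x₀ ε) :=
    (isOpen_lt (by fun_prop) (by fun_prop)).inter Metric.isOpen_ball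
  obtain ⟨y, ⟨hy1, hy2⟩, hyΩ⟩ := mem_closure_iff.1 (frontier_subset_closure hz) _ hopen ⟨hlt, hzb⟩
  exact lt_asymm hy1 ((h y hy2).1 hyΩ)

/-- The interior cone property: `Ω` contains, near the boundary point `z`, the points `z - t (d - w)`
with `d` the upward direction and `‖w‖` at most the aperture parameter. -/
lemma IsChart.cone (hΩ : IsOpen Ω) (hc : IsChart Ω x₀ R ψ L ε) {z w : Plane} {t : ℝ}
    (hz : z ∈ frontier Ω) (hzb : z ∈ Metric.ball x₀ ε) (ht : 0 < t) (hw : ‖w‖ ≤ aperture L)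
    (hb : z - t • (upDir R - w) ∈ Metric.ball x₀ ε) : z - t • (upDir R - w) ∈ Ω := by
  have hg := hc.graph hΩ hz hzb
  obtain ⟨hψ, hε, h⟩ := hc
  rw [h _ hb]
  have hRw : ∀ i, |(R w) i| ≤ aperture L := fun i =>
    (PiLp.norm_apply_le (R w) i).trans ((R.norm_map w).le.trans hw)
  have e : R (z - t • (upDir R - w)) = R z - t • (EuclideanSpace.single 1 1 - R w) := by
    simp [upDir]
  have e1 : (R (z - t • (upDir R - w))) 1 = (R z) 1 - t * (1 - (R w) 1) := by rw [e]; simp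
  have e0 : (R (z - t • (upDir R - w))) 0 = (R z) 0 + t * (R w) 0 := by rw [e]; simp
  rw [e1, e0, hg]
  have hlip := hψ.dist_le_mul ((R z) 0) ((R z) 0 + t * (R w) 0)
  rw [Real.dist_eq, Real.dist_eq, sub_add_cancel_left, abs_neg, abs_mul, abs_of_pos ht] at hlip
  have h1 := (abs_le.1 hlip).2
  have h2 : (L : ℝ) * (t * |(R w) 0|) ≤ L * (t * aperture L) := by
    gcongr; exact hRw 0
  have h3 := (abs_le.1 (hRw 1)).2
  have h4 : aperture L * (1 + L) = 1 / 2 := by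
    unfold aperture
    have : (0 : ℝ) < 1 + L := by positivity
    field_simp
  nlinarith

/-- Outward normals `n` point upwards, with a uniform lower bound: otherwise the interior cone would
contain the direction `aperture L • n - upDir R`, which has a positive component along `n`. -/
lemma IsChart.aperture_le_inner (hΩ : IsOpen Ω) (hc : IsChart Ω x₀ R ψ L ε) {z n : Plane}
    (hn : IsOutwardUnitNormal Ω z n) (hzb : z ∈ Metric.ball x₀ ε) :
    aperture L ≤ inner ℝ (upDir R) n := by
  obtain ⟨hz, hn1, hn2⟩ := hn
  by_contra! hlt
  set κ := aperture L - inner ℝ (upDir R) n with hκ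
  have hκ0 : 0 < κ := by linarith
  obtain ⟨r, hr, hball⟩ := hn2 (κ / 4) (by positivity)
  obtain ⟨r', hr', hball'⟩ := Metric.isOpen_iff.1 (Metric.isOpen_ball (x := x₀) (ε := ε)) z hzb
  set t := min r r' / 4
  have ht : 0 < t := by positivity
  have htr : 2 * t < r := by
    have : t ≤ r / 4 := by simp only [t]; gcongr; exact min_le_left _ _
    linarith
  have htr' : 2 * t < r' := by
    have : t ≤ r' / 4 := by simp only [t]; gcongr; exact min_le_right _ _
    linarith
  set w := aperture L • n with hw
  have hwn : ‖w‖ = aperture L := by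
    rw [hw, norm_smul, hn1, mul_one, Real.norm_of_nonneg (aperture_pos L).le]
  set y := z - t • (upDir R - w) with hy
  have hyz : ‖y - z‖ ≤ 2 * t := by
    rw [hy, sub_sub_cancel_left, norm_neg, norm_smul, Real.norm_of_nonneg ht.le, mul_comm]
    gcongr
    refine (norm_sub_le _ _).trans ?_
    rw [norm_upDir, hwn]
    linarith [aperture_le L]
  have hyΩ : y ∈ Ω := hc.cone hΩ hz hzb ht hwn.le
    (hball' (by rw [Metric.mem_ball, dist_eq_norm]; exact hyz.trans_lt htr'))
  refine (hball y (by rw [Metric.mem_ball, dist_eq_norm]; exact hyz.trans_lt htr)).2 ?_ hyΩ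
  have e : inner ℝ (y - z) n = t * κ := by
    rw [hy, sub_sub_cancel_left, inner_neg_left, real_inner_smul_left, inner_sub_left, hw,
      real_inner_smul_left, real_inner_self_eq_norm_sq, hn1, hκ]
    ring
  rw [e]
  nlinarith

/-- A point at depth `t` below the boundary has distance at least `aperture L * t` from it, because
it is the axis point of an interior cone. -/
lemma IsChart.le_dist (hΩ : IsOpen Ω) (hc : IsChart Ω x₀ R ψ L ε) {z : Plane} {t : ℝ}
    (hz : z ∈ frontier Ω) (ht : 0 < t) (hb : dist z x₀ + 2 * t < ε) {z' : Plane}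
    (hz' : z' ∈ frontier Ω) : aperture L * t ≤ dist z' (z - t • upDir R) := by
  by_contra! hlt
  rw [hΩ.frontier_eq] at hz'
  apply hz'.2
  set w := t⁻¹ • (z' - (z - t • upDir R)) with hw
  have e : z' = z - t • (upDir R - w) := by
    rw [hw, smul_sub, smul_inv_smul₀ ht.ne']; abel
  have hwn : ‖w‖ ≤ aperture L := by
    rw [hw, norm_smul, norm_inv, Real.norm_of_nonneg ht.le, inv_mul_le_iff₀ ht, ← dist_eq_norm,
      mul_comm]
    exact hlt.le
  rw [e]
  refine hc.cone hΩ hz ?_ ht hwn ?_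
  · rw [Metric.mem_ball]; linarith
  · rw [Metric.mem_ball, dist_eq_norm]
    have h1 : ‖t • (upDir R - w)‖ ≤ 2 * t := by
      rw [norm_smul, Real.norm_of_nonneg ht.le, mul_comm]
      gcongr
      refine (norm_sub_le _ _).trans ?_
      rw [norm_upDir]
      linarith [aperture_le L]
    calc ‖z - t • (upDir R - w) - x₀‖ = ‖(z - x₀) - t • (upDir R - w)‖ := by congr 1; abel
      _ ≤ ‖z - x₀‖ + ‖t • (upDir R - w)‖ := norm_sub_le _ _
      _ < ε := by rw [← dist_eq_norm]; linarith

end chart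

lemma exists_pos_le {ι : Type*} (T : Finset ι) (f : ι → ℝ) (hf : ∀ i ∈ T, 0 < f i) :
    ∃ δ : ℝ, 0 < δ ∧ ∀ i ∈ T, δ ≤ f i := by
  classical
  induction T using Finset.induction_on with
  | empty => exact ⟨1, one_pos, by simp⟩
  | insert i T _ ih =>
    obtain ⟨δ, hδ, h⟩ := ih fun j hj => hf j (Finset.mem_insert_of_mem hj)
    refine ⟨min δ (f i), lt_min hδ (hf i (Finset.mem_insert_self _ _)), fun j hj => ?_⟩
    rcases Finset.mem_insert.1 hj with rfl | hj
    · exact min_le_right _ _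
    · exact (min_le_left _ _).trans (h j hj)

/-- A bounded Lipschitz boundary is covered by finitely many charts of a common size. -/
lemma exists_finite_charts {Ω : Set Plane} (hbdd : Bornology.IsBounded Ω)
    (hlip : HasLipschitzBoundary Ω) :
    ∃ (T : Finset Plane) (R : Plane → Plane ≃ₗᵢ[ℝ] Plane) (ψ : Plane → ℝ → ℝ)
      (L : Plane → NNReal) (ε : Plane → ℝ),
      (∀ x ∈ T, IsChart Ω x (R x) (ψ x) (L x) (ε x)) ∧
      ∀ z ∈ frontier Ω, ∃ x ∈ T, dist z x < ε x / 4 := by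
  classical
  have hcpt : IsCompact (frontier Ω) := Metric.isCompact_of_isClosed_isBounded isClosed_frontier
    (hbdd.closure.subset frontier_subset_closure)
  have hl : ∀ x, ∃ (R : Plane ≃ₗᵢ[ℝ] Plane) (ψ : ℝ → ℝ) (L : NNReal) (ε : ℝ),
      x ∈ frontier Ω → IsChart Ω x R ψ L ε := fun x => by
    by_cases hx : x ∈ frontier Ω
    · obtain ⟨R, ψ, L, ε, h⟩ := hlip x hx
      exact ⟨R, ψ, L, ε, fun _ => h⟩
    · exact ⟨.refl ℝ _, 0, 0, 0, fun h => absurd h hx⟩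
  choose R ψ L ε h using hl
  obtain ⟨T, hT, hcov⟩ := hcpt.elim_nhds_subcover (fun x => Metric.ball x (ε x / 4)) fun x hx =>
    Metric.ball_mem_nhds x (by have := (h x hx).2.1; positivity)
  refine ⟨T, R, ψ, L, ε, fun x hx => h x (hT x hx), fun z hz => ?_⟩
  obtain ⟨x, hx, hzx⟩ := Set.mem_iUnion₂.1 (hcov hz)
  exact ⟨x, hx, hzx⟩

/-- A bounded Lipschitz boundary is covered by `O(1/h)` balls of radius `h`. -/
lemma exists_cover_frontier {Ω : Set Plane} (hΩ : IsOpen Ω) (hbdd : Bornology.IsBounded Ω)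
    (hlip : HasLipschitzBoundary Ω) (H : ℝ) :
    ∃ C : ℝ, 0 < C ∧ ∀ h, 0 < h → h ≤ H → ∃ F : Finset Plane, (F.card : ℝ) ≤ C / h ∧
      ∀ z ∈ frontier Ω, ∃ p ∈ F, dist z p ≤ h := by
  classical
  obtain ⟨T, R, ψ, L, ε, hch, hcov⟩ := exists_finite_charts hbdd hlip
  have hs : 0 ≤ ∑ x ∈ T, ((1 + (L x : ℝ)) * (2 * ε x) + |H|) := Finset.sum_nonneg fun x hx => by
    have := (hch x hx).2.1
    positivity
  refine ⟨∑ x ∈ T, ((1 + (L x : ℝ)) * (2 * ε x) + |H|) + 1, by positivity, fun h hh hhH => ?_⟩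
  set γ : Plane → ℝ → Plane := fun x s => (R x).symm !₂[s, ψ x s] with hγ
  have hF : ∀ x, ∃ F : Finset Plane, x ∈ T →
      (F.card : ℝ) ≤ (1 + (L x : ℝ)) * (2 * ε x) / h + 1 ∧
      ∀ s ∈ Set.Icc ((R x x) 0 - ε x) ((R x x) 0 + ε x), ∃ p ∈ F, dist (γ x s) p ≤ h := by
    intro x
    by_cases hx : x ∈ T
    · obtain ⟨F, h1, h2⟩ := exists_cover_curve (γ := γ x) (Λ := 1 + L x)
        (α := (R x x) 0 - ε x) (β := (R x x) 0 + ε x) (by positivity) hh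
        (by linarith [(hch x hx).2.1]) fun s t => by
          simp only [hγ]
          rw [(R x).symm.dist_map, dist_eq_norm]
          have hl := (hch x hx).1.dist_le_mul s t
          rw [Real.dist_eq, Real.dist_eq] at hl
          have hn := norm_sq_coord (!₂[s, ψ x s] - !₂[t, ψ x t])
          simp only [PiLp.sub_apply, Matrix.cons_val_zero, Matrix.cons_val_one] at hn
          refine abs_le_of_sq_le_sq' ?_ (by positivity) |>.2
          rw [hn, ← sq_abs (s - t), ← sq_abs (ψ x s - ψ x t)]
          have h0 := abs_nonneg (s - t)
          have h0' := abs_nonneg (ψ x s - ψ x t)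
          have hL := (L x).coe_nonneg
          nlinarith [mul_nonneg hL h0, mul_nonneg (mul_nonneg hL h0) h0]
      refine ⟨F, fun _ => ⟨h1.trans (le_of_eq (by ring)), h2⟩⟩
    · exact ⟨∅, fun h => absurd h hx⟩
  choose F hF using hF
  refine ⟨T.biUnion F, ?_, fun z hz => ?_⟩
  · refine (Nat.cast_le.2 Finset.card_biUnion_le).trans ?_
    push_cast
    rw [le_div_iff₀ hh, Finset.sum_mul]
    refine (Finset.sum_le_sum fun x hx => ?_).trans (le_add_of_nonneg_right zero_le_one)
    have := (hF x hx).1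
    calc ((F x).card : ℝ) * h ≤ ((1 + (L x : ℝ)) * (2 * ε x) / h + 1) * h := by gcongr
      _ = (1 + (L x : ℝ)) * (2 * ε x) + h := by field_simp
      _ ≤ _ := by gcongr; exact hhH.trans (le_abs_self H)
  · obtain ⟨x, hx, hzx⟩ := hcov z hz
    have hε := (hch x hx).2.1
    have hg := (hch x hx).graph hΩ hz (by rw [Metric.mem_ball]; linarith)
    have hzγ : z = γ x ((R x z) 0) := by
      rw [hγ]
      simp only
      rw [← hg, LinearIsometryEquiv.eq_symm_apply]
      ext i; fin_cases i <;> simp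
    have hd : |(R x z) 0 - (R x x) 0| ≤ ε x := by
      have h1 := PiLp.norm_apply_le (R x z - R x x) 0
      rw [← dist_eq_norm, (R x).dist_map, PiLp.sub_apply, Real.norm_eq_abs] at h1
      linarith
    obtain ⟨p, hp, hzp⟩ := (hF x hx).2 ((R x z) 0)
      ⟨by linarith [(abs_le.1 hd).1], by linarith [(abs_le.1 hd).2]⟩
    exact ⟨p, Finset.mem_biUnion.2 ⟨x, hx, hp⟩, by rwa [← hzγ] at hzp⟩

/-! ### Body-fitted meshes near a Lipschitz boundary -/

namespace TriMesh

variable {M : TriMesh} {Ω : Set Plane} {R₀ : ℝ}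

lemma IsBodyFitted.mem_frontier (hM : M.IsBodyFitted Ω) {e : Finset Plane}
    (he : e ∈ M.bdryEdges) {a : Plane} (ha : a ∈ e) : a ∈ frontier Ω := by
  obtain ⟨h1, h2⟩ := elem_spec (mem_bdryEdges.1 he).1
  exact hM.vertices _ h1 a (h2 ha) (Set.mem_biUnion he (subset_convexHull ℝ _ ha))

lemma IsBodyFitted.bdry_subset (hM : M.IsBodyFitted Ω)
    (hR : frontier Ω ⊆ Metric.closedBall 0 R₀) : M.bdry ⊆ Metric.closedBall 0 R₀ :=
  Set.iUnion₂_subset fun _ he => convexHull_min (fun _ ha => hR (hM.mem_frontier he ha))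
    (convex_closedBall _ _)

/-- A point of the domain outside of the ball could be moved radially to infinity without crossing
the boundary. -/
lemma IsBodyFitted.domain_subset (hM : M.IsBodyFitted Ω) (hR₀ : 0 ≤ R₀)
    (hR : frontier Ω ⊆ Metric.closedBall 0 R₀) : M.domain ⊆ Metric.closedBall 0 R₀ := by
  intro x hx
  by_contra hcon
  rw [mem_closedBall_zero_iff, not_le] at hcon
  have hx0 : 0 < ‖x‖ := hR₀.trans_lt hcon
  obtain ⟨R₁, hR₁⟩ := M.isCompact_cover.isBounded.subset_closedBall 0
  have hy : (1 + |R₁| / ‖x‖) • x ∈ M.domain := by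
    refine mem_domain_of_avoids hx fun z hz hzb => ?_
    rw [segment_eq_image'] at hz
    obtain ⟨θ, hθ, rfl⟩ := hz
    have h1 := hM.bdry_subset hR hzb
    have e : x + θ • ((1 + |R₁| / ‖x‖) • x - x) = (1 + θ * (|R₁| / ‖x‖)) • x := by module
    have h2 : 0 ≤ θ * (|R₁| / ‖x‖) := mul_nonneg hθ.1 (by positivity)
    simp only [e] at h1
    rw [mem_closedBall_zero_iff, norm_smul, Real.norm_of_nonneg (by linarith)] at h1
    nlinarith
  have h1 := hR₁ (M.domain_subset_cover hy)
  rw [mem_closedBall_zero_iff, norm_smul, Real.norm_of_nonneg (by positivity), add_mul,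
    div_mul_cancel₀ _ hx0.ne'] at h1
  linarith [le_abs_self R₁]

lemma IsBodyFitted.simplex_subset (hM : M.IsBodyFitted Ω) (hR₀ : 0 ≤ R₀)
    (hR : frontier Ω ⊆ Metric.closedBall 0 R₀) {K : Finset Plane} (hK : K ∈ M.elems) :
    simplex K ⊆ Metric.closedBall 0 R₀ := by
  rw [simplex_eq_closure_interior hK]
  exact closure_minimal ((interior_simplex_subset_domain hK).trans (hM.domain_subset hR₀ hR))
    Metric.isClosed_closedBall

lemma IsBodyFitted.h_le (hM : M.IsBodyFitted Ω) (hR₀ : 0 ≤ R₀)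
    (hR : frontier Ω ⊆ Metric.closedBall 0 R₀) : M.h ≤ 2 * R₀ :=
  Finset.sup'_le _ _ fun _ hK =>
    (Metric.diam_mono (hM.simplex_subset hR₀ hR hK) Metric.isBounded_closedBall).trans
      (Metric.diam_closedBall hR₀)

/-- On a fine mesh, every point of the domain can be moved inside the domain by at most `t₀` to a
point at distance at least `η` from the boundary: near `∂Ω` the downward direction of a chart is
used, which no boundary edge can obstruct because the normals of the mesh are close to those
of `Ω`. -/
theorem exists_descent (hΩ : IsOpen Ω) (hbdd : Bornology.IsBounded Ω)
    (hlip : HasLipschitzBoundary Ω) (Cδ Cn : ℝ) :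
    ∃ η t₀ h₀ : ℝ, 0 < η ∧ 0 < t₀ ∧ 0 < h₀ ∧ ∀ (M : TriMesh) (Mh ν : Plane → Plane),
      M.IsBoundaryMap Ω Mh ν Cδ Cn → M.h ≤ h₀ → ∀ x ∈ M.domain, ∃ x' : Plane,
        dist x x' ≤ t₀ ∧ segment ℝ x x' ⊆ M.domain ∧ Metric.ball x' η ⊆ M.domain := by
  obtain ⟨T, R, ψ, L, ε, hch, hcov⟩ := exists_finite_charts hbdd hlip
  obtain ⟨ε₀, hε₀, hε⟩ := exists_pos_le T ε fun x hx => (hch x hx).2.1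
  obtain ⟨c₁, hc₁, hc₁'⟩ := exists_pos_le T (fun x => aperture (L x)) fun x _ => aperture_pos _
  set c₀ := min c₁ (1 / 2) with hc₀def
  have hc₀ : 0 < c₀ := lt_min hc₁ (by norm_num)
  have hc₀' : c₀ ≤ 1 / 2 := min_le_right _ _
  have hcL : ∀ x ∈ T, c₀ ≤ aperture (L x) := fun x hx => (min_le_left _ _).trans (hc₁' x hx)
  set t₀ := ε₀ / 8 with ht₀def
  set η := c₀ * t₀ / 4 with hηdef
  have ht₀ : 0 < t₀ := by positivity
  have hη : 0 < η := by positivity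
  have hηt : η ≤ t₀ / 8 := by rw [hηdef]; nlinarith
  refine ⟨η, t₀, min 1 (min (η / (|Cδ| + 1)) (c₀ / (|Cn| + 1))), hη, ht₀, by positivity,
    fun M Mh ν hBM hh x hx => ?_⟩
  -- The bound for `M.h` makes `δ_h ≤ η` and `Cn h ≤ c₀`.
  have hh0 := M.h_pos
  have hh1 : M.h ≤ 1 := hh.trans (min_le_left _ _)
  have hh2 : M.h ≤ η / (|Cδ| + 1) := hh.trans ((min_le_right _ _).trans (min_le_left _ _))
  have hh3 : M.h ≤ c₀ / (|Cn| + 1) := hh.trans ((min_le_right _ _).trans (min_le_right _ _))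
  rw [le_div_iff₀ (by positivity)] at hh2 hh3
  have hδ : ∀ y ∈ M.bdry, dist (Mh y) y ≤ η := fun y hy => by
    have h1 := hBM.delta_le y hy
    rw [delta, ← dist_eq_norm] at h1
    refine h1.trans (le_trans ?_ hh2)
    have : Cδ * M.h ^ 2 ≤ |Cδ| * M.h ^ 2 := by gcongr; exact le_abs_self _
    nlinarith [abs_nonneg Cδ, mul_nonneg (abs_nonneg Cδ) hh0.le]
  have hn : Cn * M.h ≤ c₀ := by
    have : Cn * M.h ≤ |Cn| * M.h := by gcongr; exact le_abs_self _
    nlinarith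
  -- Points far from `∂Ω` are far from the boundary of the mesh as well.
  have hfar : ∀ x' ∈ M.domain, (∀ z ∈ frontier Ω, 2 * η ≤ dist z x') →
      Metric.ball x' η ⊆ M.domain := fun x' hx' hz => by
    refine ball_subset_domain (M.domain_subset_cover hx') hη fun y hy hyb => ?_
    have h1 := hz _ (hBM.maps_to y hyb)
    have h2 := hδ y hyb
    rw [Metric.mem_ball] at hy
    linarith [dist_triangle (Mh y) y x']
  by_cases hall : ∀ z ∈ frontier Ω, 2 * η ≤ dist z x
  · refine ⟨x, by simpa using ht₀.le, by simpa using hx, hfar x hx hall⟩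
  push Not at hall
  obtain ⟨z, hz, hzx⟩ := hall
  -- `x` is close to `z ∈ ∂Ω`: it is moved down in a chart around `z`.
  obtain ⟨x₀, hx₀, hzx₀⟩ := hcov z hz
  have hε' := hε x₀ hx₀
  have hc := hch x₀ hx₀
  set d := upDir (R x₀) with hd
  have hd1 : ‖d‖ = 1 := norm_upDir _
  have hmem : ∀ t ∈ Set.Icc 0 t₀, x - t • d ∈ M.domain := by
    intro t ht
    refine mem_domain_of_segment (U := Metric.ball x₀ (ε x₀ / 2)) Metric.isOpen_ball ?_ hx ht.1 ?_
    · intro e he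
      filter_upwards [hBM.normal_le e he, ae_restrict_mem (isCompact_simplex e).measurableSet]
        with y hy hye hyU
      obtain ⟨hex, hyn⟩ := hy
      have hyb : y ∈ M.bdry := Set.mem_biUnion he hye
      have hout : IsOutwardUnitNormal Ω (Mh y) (pullNormal Ω Mh y) := by
        rw [pullNormal, outwardNormal, dif_pos hex]
        exact hex.choose_spec
      have h1 := hδ y hyb
      rw [Metric.mem_ball] at hyU
      have h2 := hc.aperture_le_inner hΩ hout (by
        rw [Metric.mem_ball]
        linarith [dist_triangle (Mh y) y x₀])
      have h3 := real_inner_le_norm d (pullNormal Ω Mh y - M.normal e)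
      rw [inner_sub_right, hd1, one_mul] at h3
      linarith [hcL x₀ hx₀]
    · intro s hs
      rw [Metric.mem_ball, dist_eq_norm]
      have hs1 : ‖s • d‖ ≤ t₀ := by
        rw [norm_smul, hd1, mul_one, Real.norm_of_nonneg hs.1]; exact hs.2.trans ht.2
      calc ‖x - s • d - x₀‖ = ‖(x - z) + (z - x₀) - s • d‖ := by congr 1; abel
        _ ≤ ‖x - z‖ + ‖z - x₀‖ + ‖s • d‖ := (norm_sub_le _ _).trans (by gcongr; exact norm_add_le _ _)
        _ < ε x₀ / 2 := by rw [← dist_eq_norm, ← dist_eq_norm, dist_comm x z]; linarith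
  refine ⟨x - t₀ • d, ?_, ?_, hfar _ (hmem t₀ ⟨ht₀.le, le_rfl⟩) fun z' hz' => ?_⟩
  · rw [dist_eq_norm, sub_sub_cancel, norm_smul, hd1, mul_one, Real.norm_of_nonneg ht₀.le]
  · rw [segment_eq_image']
    rintro _ ⟨θ, hθ, rfl⟩
    have := hmem (θ * t₀) ⟨mul_nonneg hθ.1 ht₀.le, mul_le_of_le_one_left ht₀.le hθ.2⟩
    convert this using 1
    module
  · have h1 := hc.le_dist hΩ hz ht₀ (by linarith) hz'
    have h2 : dist (z - t₀ • d) (x - t₀ • d) = dist z x := by simp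
    have h3 : c₀ * t₀ ≤ aperture (L x₀) * t₀ := by gcongr; exact hcL x₀ hx₀
    have h4 := dist_triangle z' (x - t₀ • d) (z - t₀ • d)
    rw [dist_comm (x - t₀ • d), h2] at h4
    linarith

/-- Any two elements are joined by a walk of length `O(1/h)` in the dual graph. On fine meshes, an
element is classified by a ball of a fixed finite cover, into which a point of the element can be
moved away from the boundary; elements of one class are joined by three segments. On coarse meshes
the number of elements is bounded. -/
theorem exists_walk_length_le (hΩ : IsOpen Ω) (hbdd : Bornology.IsBounded Ω)
    (hlip : HasLipschitzBoundary Ω) {σ τ : ℝ} (hσ : 0 < σ) (hτ : 0 < τ) (Cδ Cn : ℝ) :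
    ∃ C : ℝ, 0 < C ∧ ∀ M : TriMesh, M.IsBodyFitted Ω → M.ShapeRegular σ → M.QuasiUniform τ →
      ∀ Mh ν, M.IsBoundaryMap Ω Mh ν Cδ Cn → ∀ K ∈ M.elems, ∀ L ∈ M.elems,
        ∃ p : M.dualGraph.Walk K L, (p.length : ℝ) ≤ C / M.h := by
  classical
  obtain ⟨R₁, hR₁⟩ := (hbdd.closure.subset frontier_subset_closure).subset_closedBall
    (0 : Plane)
  set R₀ := max R₁ 0
  have hR₀ : 0 ≤ R₀ := le_max_right _ _
  have hR : frontier Ω ⊆ Metric.closedBall 0 R₀ :=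
    hR₁.trans (Metric.closedBall_subset_closedBall (le_max_left _ _))
  obtain ⟨η, t₀, h₀, hη, ht₀, hh₀, hdesc⟩ := exists_descent hΩ hbdd hlip Cδ Cn
  have hcpt : IsCompact (Metric.closedBall (0 : Plane) R₀) := isCompact_closedBall _ _
  obtain ⟨N', -, hN'f, hN'⟩ := hcpt.finite_cover_balls (half_pos hη)
  obtain ⟨F', -, hF'f, hF'⟩ := hcpt.finite_cover_balls hh₀
  lift N' to Finset Plane using hN'f
  lift F' to Finset Plane using hF'f
  set A := (8 * σ / τ) ^ 2 with hA
  have hA0 : 0 < A := by positivity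
  set D₀ := A * (4 * t₀ + 2 * η + 3 * (2 * R₀)) with hD₀
  refine ⟨N'.card * (D₀ + 2 * R₀) + A * F'.card * (2 * R₀) + 1, by positivity,
    fun M hM hreg hqu Mh ν hBM K hK L hL => ?_⟩
  have hh := M.h_pos
  have hhR : M.h ≤ 2 * R₀ := hM.h_le hR₀ hR
  have hreach : ∃ p : M.dualGraph.Walk K L, p.length ≤ M.elems.card := by
    have hmeet : ∀ T ∈ M.elems, (simplex T ∩ M.domain).Nonempty := fun T hT => by
      obtain ⟨x, hx⟩ := interior_simplex_nonempty hT
      exact ⟨x, interior_subset hx, interior_simplex_subset_domain hT hx⟩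
    exact exists_walk_of_preconnected M.isOpen_domain hM.connected.isPreconnected subset_rfl
      subset_rfl (fun T hT _ => hT) hK hL (hmeet K hK) (hmeet L hL)
  rcases le_or_gt M.h h₀ with hle | hgt
  -- `x T` is moved to `x' T`, which lies in the element `T' T` and in the ball around `p T`.
  · have hpt : ∀ T ∈ M.elems, ∃ x x' p T', x ∈ simplex T ∧ dist x x' ≤ t₀ ∧
        segment ℝ x x' ⊆ M.domain ∧ Metric.ball x' η ⊆ M.domain ∧ p ∈ N' ∧ dist x' p < η / 2 ∧
        T' ∈ M.elems ∧ x' ∈ simplex T' := fun T hT => by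
      obtain ⟨x, hx⟩ := interior_simplex_nonempty hT
      obtain ⟨x', h1, h2, h3⟩ := hdesc M Mh ν hBM hle x (interior_simplex_subset_domain hT hx)
      have hx'D := h3 (Metric.mem_ball_self hη)
      obtain ⟨p, hp, hx'p⟩ := Set.mem_iUnion₂.1 (hN' (hM.domain_subset hR₀ hR hx'D))
      obtain ⟨T', hT', hx'T'⟩ := Set.mem_iUnion₂.1 (M.domain_subset_cover hx'D)
      exact ⟨x, x', p, T', interior_subset hx, h1, h2, h3, hp, hx'p, hT', hx'T'⟩
    choose! x x' p T' hx hxx' hseg hball hp hx'p hT' hx'T' using hpt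
    have hsame : ∀ K ∈ M.elems, ∀ L ∈ M.elems, p K = p L →
        ∃ w : M.dualGraph.Walk K L, w.length ≤ ⌊D₀ / M.h⌋₊ := by
      intro K hK L hL hKL
      obtain ⟨w₁, hw₁⟩ := exists_walk_of_segment hσ hτ hreg hqu ht₀ (hxx' K hK) (hseg K hK) hK
        (hT' K hK) (hx K hK) (hx'T' K hK)
      obtain ⟨w₃, hw₃⟩ := exists_walk_of_segment hσ hτ hreg hqu ht₀ (hxx' L hL) (hseg L hL) hL
        (hT' L hL) (hx L hL) (hx'T' L hL)
      have hd : dist (x' K) (x' L) < η := by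
        have h1 := hx'p K hK
        have h2 := hx'p L hL
        rw [← hKL, dist_comm] at h2
        linarith [dist_triangle (x' K) (p K) (x' L)]
      obtain ⟨w₂, hw₂⟩ := exists_walk_of_segment hσ hτ hreg hqu hη hd.le
        (((convex_ball _ _).segment_subset (Metric.mem_ball_self hη)
          (Metric.mem_ball'.2 hd)).trans (hball K hK)) (hT' K hK)
        (hT' L hL) (hx'T' K hK) (hx'T' L hL)
      refine ⟨w₁.append (w₂.append w₃.reverse), Nat.le_floor ?_⟩
      rw [SimpleGraph.Walk.length_append, SimpleGraph.Walk.length_append,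
        SimpleGraph.Walk.length_reverse]
      push_cast
      rw [← hA] at hw₁ hw₂ hw₃
      calc (w₁.length : ℝ) + (w₂.length + w₃.length)
          ≤ A * (2 * t₀ / M.h + 1) + (A * (2 * η / M.h + 1) + A * (2 * t₀ / M.h + 1)) := by gcongr
        _ = A * (4 * t₀ + 2 * η + 3 * M.h) / M.h := by field_simp; ring
        _ ≤ D₀ / M.h := by rw [hD₀]; gcongr
    obtain ⟨w, hw⟩ := exists_walk_of_colouring N' p _ hp hsame hK ⟨hreach.choose⟩
    refine ⟨w, (Nat.cast_le.2 hw).trans ?_⟩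
    push_cast
    calc (N'.card : ℝ) * ((⌊D₀ / M.h⌋₊ : ℝ) + 1) ≤ N'.card * (D₀ / M.h + 1) := by
          gcongr; exact Nat.floor_le (by positivity)
      _ = N'.card * (D₀ + M.h) / M.h := by field_simp
      _ ≤ _ := by
          gcongr
          have : (N'.card : ℝ) * (D₀ + M.h) ≤ N'.card * (D₀ + 2 * R₀) := by gcongr
          have : 0 ≤ A * F'.card * (2 * R₀) := by positivity
          linarith
  · obtain ⟨w, hw⟩ := hreach
    refine ⟨w, (Nat.cast_le.2 hw).trans ?_⟩
    have hcard := card_le_of_near hσ hτ hreg hqu (F := F') subset_rfl fun T hT => by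
      obtain ⟨x, hx⟩ := interior_simplex_nonempty hT
      obtain ⟨p, hp, hxp⟩ := Set.mem_iUnion₂.1
        (hF' (hM.simplex_subset hR₀ hR hT (interior_subset hx)))
      exact ⟨p, hp, x, interior_subset hx, (Metric.mem_ball.1 hxp).le.trans hgt.le⟩
    rw [le_div_iff₀ hh]
    have h1 : (M.elems.card : ℝ) * M.h ≤ A * F'.card * (2 * R₀) := by gcongr
    have : (0 : ℝ) ≤ N'.card * (D₀ + 2 * R₀) := by positivity
    linarith

/-- There are `O(1/h)` boundary edges, since their end points lie on the curve `∂Ω`, which is covered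
by `O(1/h)` balls of radius `h`. -/
theorem exists_card_bdryEdges_le (hΩ : IsOpen Ω) (hbdd : Bornology.IsBounded Ω)
    (hlip : HasLipschitzBoundary Ω) {σ τ : ℝ} (hσ : 0 < σ) (hτ : 0 < τ) :
    ∃ C : ℝ, 0 < C ∧ ∀ M : TriMesh, M.IsBodyFitted Ω → M.ShapeRegular σ → M.QuasiUniform τ →
      (M.bdryEdges.card : ℝ) ≤ C / M.h := by
  classical
  obtain ⟨R₁, hR₁⟩ := (hbdd.closure.subset frontier_subset_closure).subset_closedBall
    (0 : Plane)
  obtain ⟨C, hC, hcov⟩ := exists_cover_frontier hΩ hbdd hlip (2 * max R₁ 0)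
  refine ⟨3 * ((8 * σ / τ) ^ 2 * C), by positivity, fun M hM hreg hqu => ?_⟩
  obtain ⟨F, hF, hFcov⟩ := hcov M.h M.h_pos (hM.h_le (le_max_right _ _)
    (hR₁.trans (Metric.closedBall_subset_closedBall (le_max_left _ _))))
  have h1 : M.bdryEdges.card ≤ 3 * (M.bdryEdges.image M.elem).card := by
    refine Finset.card_le_mul_card_image _ _ fun K hK => ?_
    obtain ⟨e, he, rfl⟩ := Finset.mem_image.1 hK
    obtain ⟨hK, -⟩ := elem_spec (mem_bdryEdges.1 he).1
    have h3 : ((M.elem e).powersetCard 2).card = 3 := by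
      rw [Finset.card_powersetCard, M.card_eq _ hK]; rfl
    rw [← h3]
    refine Finset.card_le_card fun e' he' => ?_
    rw [Finset.mem_filter] at he'
    have he'M := (mem_bdryEdges.1 he'.1).1
    exact Finset.mem_powersetCard.2 ⟨he'.2 ▸ (elem_spec he'M).2, card_of_mem_edges he'M⟩
  have h2 := card_le_of_near hσ hτ hreg hqu (F := F) (S := M.bdryEdges.image M.elem)
    (fun K hK => by
      obtain ⟨e, he, rfl⟩ := Finset.mem_image.1 hK
      exact (elem_spec (mem_bdryEdges.1 he).1).1) fun K hK => by
      obtain ⟨e, he, rfl⟩ := Finset.mem_image.1 hK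
      have heM := (mem_bdryEdges.1 he).1
      obtain ⟨a, ha⟩ : e.Nonempty := Finset.card_pos.1 (by rw [card_of_mem_edges heM]; norm_num)
      obtain ⟨p, hp, hap⟩ := hFcov a (hM.mem_frontier he ha)
      exact ⟨p, hp, a, subset_convexHull ℝ _ ((elem_spec heM).2 ha), hap⟩
  calc (M.bdryEdges.card : ℝ) ≤ 3 * (M.bdryEdges.image M.elem).card := by exact_mod_cast h1
    _ ≤ 3 * ((8 * σ / τ) ^ 2 * (C / M.h)) := by
        gcongr
        exact h2.trans (by gcongr)
    _ = _ := by ring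

end TriMesh

/-! ### Cauchy-Schwarz inequalities -/

lemma sum_sqrt_mul_sqrt_le_of_mem {ι : Type*} {s : Finset ι} {f g : ι → ℝ}
    (hf : ∀ i ∈ s, 0 ≤ f i) (hg : ∀ i ∈ s, 0 ≤ g i) :
    ∑ i ∈ s, √(f i) * √(g i) ≤ √(∑ i ∈ s, f i) * √(∑ i ∈ s, g i) := by
  refine (Real.sum_mul_le_sqrt_mul_sqrt s _ _).trans (le_of_eq ?_)
  rw [Finset.sum_congr rfl fun i hi => Real.sq_sqrt (hf i hi),
    Finset.sum_congr rfl fun i hi => Real.sq_sqrt (hg i hi)]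

lemma sum_sqrt_le {ι : Type*} {s : Finset ι} {f : ι → ℝ} (hf : ∀ i ∈ s, 0 ≤ f i) :
    ∑ i ∈ s, √(f i) ≤ √s.card * √(∑ i ∈ s, f i) := by
  simpa using sum_sqrt_mul_sqrt_le_of_mem (s := s) (f := fun _ => (1 : ℝ)) (fun _ _ => zero_le_one)
    hf

lemma sqrt_mul_sqrt_add_le {a b c d : ℝ} (ha : 0 ≤ a) (hb : 0 ≤ b) (hc : 0 ≤ c) (hd : 0 ≤ d) :
    √a * √b + √c * √d ≤ √(a + c) * √(b + d) := by
  have := sum_sqrt_mul_sqrt_le_of_mem (s := Finset.univ) (f := ![a, c]) (g := ![b, d])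
    (by simp [Fin.forall_fin_two, ha, hc]) (by simp [Fin.forall_fin_two, hb, hd])
  simpa [Fin.sum_univ_two] using this

lemma integral_norm_mul_norm_le {α E F : Type*} [MeasurableSpace α] {μ : Measure α}
    [NormedAddCommGroup E] [NormedAddCommGroup F] {f : α → E} {g : α → F} (hf : MemLp f 2 μ)
    (hg : MemLp g 2 μ) :
    ∫ x, ‖f x‖ * ‖g x‖ ∂μ ≤ √(∫ x, ‖f x‖ ^ 2 ∂μ) * √(∫ x, ‖g x‖ ^ 2 ∂μ) := by
  have h2 : ENNReal.ofReal 2 = 2 := by simp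
  have := integral_mul_norm_le_Lp_mul_Lq (μ := μ) (f := fun x => ‖f x‖) (g := fun x => ‖g x‖)
    Real.HolderConjugate.two_two (by rw [h2]; exact hf.norm) (by rw [h2]; exact hg.norm)
  simpa only [norm_norm, Real.rpow_two, ← Real.sqrt_eq_rpow] using this

lemma abs_integral_mul_le {α : Type*} [MeasurableSpace α] {μ : Measure α} {f g : α → ℝ}
    (hf : MemLp f 2 μ) (hg : MemLp g 2 μ) :
    |∫ x, f x * g x ∂μ| ≤ √(∫ x, f x ^ 2 ∂μ) * √(∫ x, g x ^ 2 ∂μ) := by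
  refine (abs_integral_le_integral_abs).trans ?_
  simpa [abs_mul] using integral_norm_mul_norm_le hf hg

lemma memLp_simplex_of_continuous {E : Type*} [NormedAddCommGroup E] [SecondCountableTopology E]
    {μ : Measure Plane} {K : Finset Plane} (hK : μ (simplex K) ≠ ⊤) {f : Plane → E}
    (hf : Continuous f) : MemLp f 2 (μ.restrict (simplex K)) := by
  have : IsFiniteMeasure (μ.restrict (simplex K)) := ⟨by simpa using hK.lt_top⟩
  obtain ⟨C, hC⟩ := (isCompact_simplex K).exists_bound_of_continuousOn hf.continuousOn
  exact MemLp.of_bound hf.aestronglyMeasurable C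
    (ae_restrict_of_forall_mem (isCompact_simplex K).measurableSet hC)

lemma volume_simplex_ne_top (K : Finset Plane) : volume (simplex K) ≠ ⊤ :=
  (isCompact_simplex K).measure_lt_top.ne

/-! ### Lengths of edges -/

lemma arcLength_simplex_pair [DecidableEq Plane] {a b : Plane} (hab : a ≠ b) :
    arcLength (simplex {a, b}) ≠ ⊤ ∧ arcLength.real (simplex {a, b}) = ‖b - a‖ := by
  have hi := integrableOn_edge_of_continuous (Finset.card_pair hab)
    (continuous_const (y := (1 : ℝ)))
  refine ⟨?_, ?_⟩
  · have := (integrable_const_iff.1 hi).resolve_left one_ne_zero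
    simpa using this.measure_univ_lt_top.ne
  · have := integral_edge hab fun _ => (1 : ℝ)
    simpa using this

lemma arcLength_ne_top {e : Finset Plane} (he : e.card = 2) : arcLength (simplex e) ≠ ⊤ := by
  classical
  obtain ⟨a, b, hab, rfl⟩ := Finset.card_eq_two.1 he
  exact (arcLength_simplex_pair hab).1

namespace TriMesh

variable {M : TriMesh}

lemma arcLength_le_h {K e : Finset Plane} (hK : K ∈ M.elems) (he : e ⊆ K) (he2 : e.card = 2) :
    arcLength.real (simplex e) ≤ M.h := by
  classical
  obtain ⟨a, b, hab, rfl⟩ := Finset.card_eq_two.1 he2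
  rw [(arcLength_simplex_pair hab).2, ← dist_eq_norm]
  exact dist_le_h hK (subset_convexHull ℝ _ (he (by simp))) (subset_convexHull ℝ _ (he (by simp)))

/-- The inscribed ball bounds the length of an edge `ab` from below: its width orthogonal to another
edge `ac` is at most the width of the triangle in that direction, which is at most `|b - a|`. -/
lemma le_arcLength {σ τ : ℝ} (hσ : 0 < σ) (hτ : 0 < τ) (hreg : M.ShapeRegular σ)
    (hqu : M.QuasiUniform τ) {K e : Finset Plane} (hK : K ∈ M.elems) (he : e ⊆ K)
    (he2 : e.card = 2) : τ / (4 * σ) * M.h ≤ arcLength.real (simplex e) := by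
  classical
  obtain ⟨a, b, c, rfl, rfl, h⟩ := exists_label (M.card_eq K hK) (M.indep K hK) he he2
  have hab : a ≠ b := by rintro rfl; simp [cross] at h
  have hac : a ≠ c := by rintro rfl; simp [cross] at h
  rw [(arcLength_simplex_pair hab).2]
  obtain ⟨z, hz⟩ := exists_ball_of_regular hσ hreg hqu hK
  have hh := M.h_pos
  set r := τ / (4 * σ) * M.h
  have hr : 0 < r := by positivity
  obtain ⟨hn1, hn2, -⟩ := isOutN_outN hK (e := {a, c}) (by
    intro x; simp only [Finset.mem_insert, Finset.mem_singleton]; tauto) (Finset.card_pair hac)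
  set n := outN {a, b, c} {a, c}
  have hn : inner ℝ (c - a) n = 0 := hn2 a (by simp) c (by simp)
  have hmem : ∀ y ∈ simplex {a, b, c}, ∃ s : ℝ, 0 ≤ s ∧ s ≤ 1 ∧
      inner ℝ y n = inner ℝ a n + s * inner ℝ (b - a) n := fun y hy => by
    rw [simplex, Finset.coe_insert, Finset.coe_pair] at hy
    obtain ⟨s, t, hs, ht, hst, rfl⟩ := mem_triangle.1 hy
    refine ⟨s, hs, by linarith, ?_⟩
    rw [inner_add_left, inner_add_left, real_inner_smul_left, real_inner_smul_left, hn]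
    ring
  obtain ⟨s, hs0, hs1, hs⟩ := hmem z (hz (Metric.mem_closedBall_self hr.le))
  obtain ⟨s', hs0', hs1', hs'⟩ := hmem (z + r • n) (hz (by
    rw [mem_closedBall_iff_norm, add_sub_cancel_left, norm_smul, hn1, mul_one,
      Real.norm_of_nonneg hr.le]))
  rw [inner_add_left, real_inner_smul_left, real_inner_self_eq_norm_sq, hn1] at hs'
  have h1 : r = (s' - s) * inner ℝ (b - a) n := by linarith
  have h2 := abs_real_inner_le_norm (b - a) n
  rw [hn1, mul_one] at h2
  calc r = |(s' - s) * inner ℝ (b - a) n| := by rw [← h1, abs_of_pos hr]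
    _ ≤ 1 * ‖b - a‖ := by
        rw [abs_mul]
        gcongr
        exact abs_le.2 ⟨by linarith, by linarith⟩
    _ = ‖b - a‖ := one_mul _

/-- Summing a function of the elements over the edges counts each element at most three times. -/
lemma sum_edges_le (G : Finset Plane → ℝ) (hG : ∀ K ∈ M.elems, 0 ≤ G K) :
    ∑ e ∈ M.bdryEdges, G (M.elem e) ≤ 3 * ∑ K ∈ M.elems, G K ∧
      ∑ e ∈ M.intEdges, (G (M.sides e).1 + G (M.sides e).2) ≤ 3 * ∑ K ∈ M.elems, G K := by
  have h := M.sum_elems_edges fun K _ => G K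
  have h1 : ∑ K ∈ M.elems, ∑ _e ∈ K.powersetCard 2, G K = 3 * ∑ K ∈ M.elems, G K := by
    rw [Finset.mul_sum]
    refine Finset.sum_congr rfl fun K hK => ?_
    rw [Finset.sum_const, Finset.card_powersetCard, M.card_eq K hK, nsmul_eq_mul]
    norm_num [Nat.choose]
  have h2 : 0 ≤ ∑ e ∈ M.bdryEdges, G (M.elem e) :=
    Finset.sum_nonneg fun e he => hG _ (elem_spec (mem_bdryEdges.1 he).1).1
  have h3 : 0 ≤ ∑ e ∈ M.intEdges, (G (M.sides e).1 + G (M.sides e).2) :=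
    Finset.sum_nonneg fun e he => by
      have := sides_spec (mem_intEdges.1 he).2
      exact add_nonneg (hG _ this.1) (hG _ this.2.1)
  rw [h1] at h
  constructor <;> linarith

/-! ### A discrete maximum estimate for piecewise polynomials -/

lemma norm_fderiv_eq (f : Plane → ℝ) (x : Plane) : ‖fderiv ℝ f x‖ = ‖gradient f x‖ := by
  rw [gradient, LinearIsometryEquiv.norm_map]

lemma continuous_gradient_of_mem {k : ℕ} {f : Plane → ℝ} (hf : f ∈ polySpace k) :
    Continuous (gradient f) :=
  (contDiff_euclidean.2 fun i => (linePoly_gradient hf i).1).continuous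

/-- The oscillation of a polynomial on an element, by the mean value theorem and the inverse estimate
for the gradient. -/
lemma exists_oscillation_le (k : ℕ) {σ τ : ℝ} (hσ : 0 < σ) (hτ : 0 < τ) :
    ∃ C : ℝ, 0 < C ∧ ∀ M : TriMesh, M.ShapeRegular σ → M.QuasiUniform τ → ∀ K ∈ M.elems,
      ∀ f ∈ polySpace k, ∀ x ∈ simplex K, ∀ y ∈ simplex K,
        (f x - f y) ^ 2 ≤ C * ∫ z in simplex K, ‖gradient f z‖ ^ 2 := by
  obtain ⟨C, hC, hest⟩ := exists_inverse_estimate_vec k hσ hτ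
  refine ⟨C, hC, fun M hreg hqu K hK f hf x hx y hy => ?_⟩
  have hh := M.h_pos
  set I := ∫ z in simplex K, ‖gradient f z‖ ^ 2
  have hI : 0 ≤ I := integral_nonneg fun z => by positivity
  have hb : ∀ z ∈ simplex K, ‖fderiv ℝ f z‖ ≤ √(C / M.h ^ 2 * I) := fun z hz => by
    rw [norm_fderiv_eq]
    exact Real.le_sqrt_of_sq_le (hest M hreg hqu K hK _ (linePoly_gradient hf) z hz z
      (Metric.mem_closedBall_self hh.le))
  have h1 := (convex_convexHull ℝ (K : Set Plane)).norm_image_sub_le_of_norm_fderiv_le (𝕜 := ℝ)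
    (fun z _ => (linePoly_of_mem hf).1.differentiable (by simp) z) hb hy hx
  rw [← dist_eq_norm x y, Real.norm_eq_abs] at h1
  have h2 : |f x - f y| ≤ √(C / M.h ^ 2 * I) * M.h :=
    h1.trans (by gcongr; exact dist_le_h hK hx hy)
  calc (f x - f y) ^ 2 = |f x - f y| ^ 2 := (sq_abs _).symm
    _ ≤ (√(C / M.h ^ 2 * I) * M.h) ^ 2 := by gcongr
    _ = C * I := by
        rw [mul_pow, Real.sq_sqrt (by positivity)]; field_simp

/-- The square of the broken `H¹` seminorm of a piecewise polynomial `ρ`, including its jumps. -/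
def brokenSq (M : TriMesh) (ρ : Finset Plane → Plane → ℝ) : ℝ :=
  (∑ K ∈ M.elems, ∫ x in simplex K, ‖gradient (ρ K) x‖ ^ 2) +
    ∑ e ∈ M.intEdges, M.h⁻¹ * ∫ x in simplex e,
      (ρ (M.sides e).1 x - ρ (M.sides e).2 x) ^ 2 ∂arcLength

lemma brokenSq_terms (M : TriMesh) (ρ : Finset Plane → Plane → ℝ) :
    0 ≤ ∑ K ∈ M.elems, ∫ x in simplex K, ‖gradient (ρ K) x‖ ^ 2 ∧
    0 ≤ ∑ e ∈ M.intEdges, M.h⁻¹ * ∫ x in simplex e,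
      (ρ (M.sides e).1 x - ρ (M.sides e).2 x) ^ 2 ∂arcLength := by
  have := M.h_pos
  exact ⟨Finset.sum_nonneg fun K _ => integral_nonneg fun x => by positivity,
    Finset.sum_nonneg fun e _ => mul_nonneg (by positivity) (integral_nonneg fun x => sq_nonneg _)⟩

lemma exists_sq_mul_arcLength_le {e : Finset Plane} (he : e.card = 2)
    (hpos : 0 < arcLength.real (simplex e)) {f : Plane → ℝ} (hf : Continuous f) :
    ∃ x ∈ simplex e, f x ^ 2 * arcLength.real (simplex e) ≤
      ∫ x in simplex e, f x ^ 2 ∂arcLength := by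
  classical
  obtain ⟨x, hx, h⟩ := exists_le_setAverage (μ := arcLength) (s := simplex e)
    (f := fun x => f x ^ 2) (fun h0 => by simp [Measure.real, h0] at hpos) (arcLength_ne_top he)
    (integrableOn_edge_of_continuous he (hf.pow 2))
  refine ⟨x, hx, ?_⟩
  rwa [setAverage_eq, smul_eq_mul, inv_mul_eq_div, le_div_iff₀ hpos] at h

/-- Point values in neighbouring elements, compared through a point of the common edge where the
jump is at most its quadratic mean. -/
lemma exists_neighbour_le (k : ℕ) {σ τ : ℝ} (hσ : 0 < σ) (hτ : 0 < τ) :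
    ∃ C : ℝ, 0 < C ∧ ∀ M : TriMesh, M.ShapeRegular σ → M.QuasiUniform τ →
      ∀ ρ : Finset Plane → Plane → ℝ, (∀ K ∈ M.elems, ρ K ∈ polySpace k) →
      ∀ e ∈ M.intEdges, ∀ x ∈ simplex (M.sides e).1, ∀ y ∈ simplex (M.sides e).2,
        (ρ (M.sides e).1 x - ρ (M.sides e).2 y) ^ 2 ≤
          C * (((∫ z in simplex (M.sides e).1, ‖gradient (ρ (M.sides e).1) z‖ ^ 2) +
            ∫ z in simplex (M.sides e).2, ‖gradient (ρ (M.sides e).2) z‖ ^ 2) +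
            M.h⁻¹ * ∫ z in simplex e, (ρ (M.sides e).1 z - ρ (M.sides e).2 z) ^ 2 ∂arcLength) := by
  obtain ⟨C, hC, hosc⟩ := exists_oscillation_le k hσ hτ
  refine ⟨3 * (C + 4 * σ / τ), by positivity, fun M hreg hqu ρ hρ e he x hx y hy => ?_⟩
  have hh := M.h_pos
  obtain ⟨he2, hi⟩ := mem_intEdges.1 he
  obtain ⟨h1, h2, -, h3, h4⟩ := sides_spec hi
  have hlen := le_arcLength hσ hτ hreg hqu h1 h3 he2
  obtain ⟨z, hz, hzle⟩ := exists_sq_mul_arcLength_le he2 (lt_of_lt_of_le (by positivity) hlen)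
    ((linePoly_of_mem (hρ _ h1)).1.continuous.sub (linePoly_of_mem (hρ _ h2)).1.continuous)
  have o1 := hosc M hreg hqu _ h1 _ (hρ _ h1) x hx z (convexHull_mono (by exact_mod_cast h3) hz)
  have o2 := hosc M hreg hqu _ h2 _ (hρ _ h2) z (convexHull_mono (by exact_mod_cast h4) hz) y hy
  set J := ∫ z in simplex e, (ρ (M.sides e).1 z - ρ (M.sides e).2 z) ^ 2 ∂arcLength
  set I₁ := ∫ z in simplex (M.sides e).1, ‖gradient (ρ (M.sides e).1) z‖ ^ 2
  set I₂ := ∫ z in simplex (M.sides e).2, ‖gradient (ρ (M.sides e).2) z‖ ^ 2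
  have hI₁ : 0 ≤ I₁ := integral_nonneg fun z => by positivity
  have hI₂ : 0 ≤ I₂ := integral_nonneg fun z => by positivity
  have hJ : 0 ≤ J := integral_nonneg fun z => sq_nonneg _
  have o3 : (ρ (M.sides e).1 z - ρ (M.sides e).2 z) ^ 2 ≤ 4 * σ / τ * (M.h⁻¹ * J) := by
    have : (ρ (M.sides e).1 z - ρ (M.sides e).2 z) ^ 2 * (τ / (4 * σ) * M.h) ≤ J :=
      (mul_le_mul_of_nonneg_left hlen (sq_nonneg _)).trans hzle
    rw [← le_div_iff₀ (by positivity)] at this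
    refine this.trans (le_of_eq ?_)
    field_simp
  have hs : 0 ≤ 4 * σ / τ := by positivity
  have hJ' : 0 ≤ M.h⁻¹ * J := by positivity
  set A := ρ (M.sides e).1 x - ρ (M.sides e).1 z
  set B := ρ (M.sides e).1 z - ρ (M.sides e).2 z
  set D := ρ (M.sides e).2 z - ρ (M.sides e).2 y
  have e1 : ρ (M.sides e).1 x - ρ (M.sides e).2 y = A + B + D := by simp only [A, B, D]; ring
  rw [e1]
  have h5 : (A + B + D) ^ 2 ≤ 3 * (A ^ 2 + B ^ 2 + D ^ 2) := by
    nlinarith [sq_nonneg (A - B), sq_nonneg (A - D), sq_nonneg (B - D)]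
  nlinarith [mul_nonneg hC.le hJ', mul_nonneg hs hI₁, mul_nonneg hs hI₂]

/-- Functions with total mean zero are somewhere nonpositive. -/
lemma exists_nonpos {f : Finset Plane → Plane → ℝ} (hf : ∀ K ∈ M.elems, Continuous (f K))
    (h0 : ∑ K ∈ M.elems, ∫ x in simplex K, f K x = 0) :
    ∃ K ∈ M.elems, ∃ x ∈ simplex K, f K x ≤ 0 := by
  obtain ⟨K, hK, hle⟩ := Finset.exists_le_of_sum_le (f := fun K => ∫ x in simplex K, f K x)
    (g := fun _ => (0 : ℝ)) M.nonempty (by simp [h0])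
  have hpos : volume (simplex K) ≠ 0 := fun h =>
    (isOpen_interior.measure_pos volume (interior_simplex_nonempty hK)).ne'
      (measure_mono_null interior_subset h)
  obtain ⟨x, hx, h⟩ := exists_le_setAverage hpos (volume_simplex_ne_top K)
    ((hf K hK).continuousOn.integrableOn_compact (isCompact_simplex K))
  refine ⟨K, hK, x, hx, h.trans ?_⟩
  rw [setAverage_eq, smul_eq_mul]
  exact mul_nonpos_of_nonneg_of_nonpos (by positivity) hle

lemma exists_h_le {Ω : Set Plane} (hbdd : Bornology.IsBounded Ω) :
    ∃ H : ℝ, 0 < H ∧ ∀ M : TriMesh, M.IsBodyFitted Ω → M.h ≤ H := by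
  obtain ⟨R, hR⟩ := (hbdd.closure.subset frontier_subset_closure).subset_closedBall (0 : Plane)
  refine ⟨2 * max R 1, by positivity, fun M hM => hM.h_le (by positivity)
    (hR.trans (Metric.closedBall_subset_closedBall (le_max_left _ _)))⟩

/-- A piecewise polynomial with mean zero is bounded by `C h^{-1/2}` times its broken `H¹` seminorm:
two point values are compared along a walk of `O(1/h)` elements, with the Cauchy-Schwarz inequality
for the sum of the differences. -/
theorem exists_sq_le_brokenSq {Ω : Set Plane} (hΩ : IsOpen Ω) (hbdd : Bornology.IsBounded Ω)
    (hlip : HasLipschitzBoundary Ω) (k : ℕ) {σ τ : ℝ} (hσ : 0 < σ) (hτ : 0 < τ) (Cδ Cn : ℝ) :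
    ∃ C : ℝ, 0 < C ∧ ∀ M : TriMesh, M.IsBodyFitted Ω → M.ShapeRegular σ → M.QuasiUniform τ →
      ∀ Mh ν, M.IsBoundaryMap Ω Mh ν Cδ Cn → ∀ ρ : Finset Plane → Plane → ℝ,
      (∀ K ∈ M.elems, ρ K ∈ polySpace k) → ∑ K ∈ M.elems, ∫ x in simplex K, ρ K x = 0 →
      ∀ K ∈ M.elems, ∀ x ∈ simplex K, ρ K x ^ 2 ≤ C / M.h * M.brokenSq ρ := by
  obtain ⟨C₁, hC₁, hosc⟩ := exists_oscillation_le k hσ hτ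
  obtain ⟨C₂, hC₂, hnb⟩ := exists_neighbour_le k hσ hτ
  obtain ⟨C₃, hC₃, hwalk⟩ := exists_walk_length_le hΩ hbdd hlip hσ hτ Cδ Cn
  obtain ⟨H, hH, hHle⟩ := exists_h_le hbdd
  refine ⟨3 * (2 * C₁ * H + C₃ * (C₂ * 3)), by positivity,
    fun M hM hreg hqu Mh ν hBM ρ hρ hmean => ?_⟩
  have hh := M.h_pos
  have hhH := hHle M hM
  set N := M.brokenSq ρ with hN
  set G : Finset Plane → ℝ := fun K => ∫ x in simplex K, ‖gradient (ρ K) x‖ ^ 2 with hGdef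
  set J : Finset Plane → ℝ := fun e => M.h⁻¹ * ∫ x in simplex e,
    (ρ (M.sides e).1 x - ρ (M.sides e).2 x) ^ 2 ∂arcLength with hJdef
  have hG : ∀ K, 0 ≤ G K := fun K => integral_nonneg fun x => by positivity
  have hJ : ∀ e, 0 ≤ J e := fun e => mul_nonneg (by positivity) (integral_nonneg fun x => sq_nonneg _)
  have hNe : N = ∑ K ∈ M.elems, G K + ∑ e ∈ M.intEdges, J e := rfl
  have hsG : 0 ≤ ∑ K ∈ M.elems, G K := Finset.sum_nonneg fun K _ => hG K
  have hsJ : 0 ≤ ∑ e ∈ M.intEdges, J e := Finset.sum_nonneg fun e _ => hJ e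
  have hGN : ∀ K ∈ M.elems, G K ≤ N := fun K hK => by
    have := Finset.single_le_sum (fun K _ => hG K) hK
    linarith
  have hN0 : 0 ≤ N := by linarith
  -- Any two point values are compared along a path from `K` to `L`.
  have hcmp : ∀ K ∈ M.elems, ∀ x ∈ simplex K, ∀ L ∈ M.elems, ∀ y ∈ simplex L,
      (ρ K x - ρ L y) ^ 2 ≤ 3 * (2 * C₁ * H + C₃ * (C₂ * 3)) / M.h * N := by
    intro K hK x hx L hL y hy
    obtain ⟨w, hw⟩ := hwalk M hM hreg hqu Mh ν hBM K hK L hL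
    classical
    have hpt : ∀ T : Finset Plane, ∃ z, T ∈ M.elems → z ∈ simplex T := fun T => by
      by_cases hT : T ∈ M.elems
      · obtain ⟨z, hz⟩ := interior_simplex_nonempty hT
        exact ⟨z, fun _ => interior_subset hz⟩
      · exact ⟨0, fun h => absurd h hT⟩
    choose z hz using hpt
    obtain ⟨E, hE, hcard, -, hle⟩ := exists_edges_of_path (fun T => ρ T (z T)) w.bypass
      w.bypass_isPath
    have hEcard : (E.card : ℝ) ≤ C₃ / M.h := by
      rw [hcard]
      exact (Nat.cast_le.2 w.length_bypass_le_length).trans hw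
    have h1 : (ρ K (z K) - ρ L (z L)) ^ 2 ≤ C₃ / M.h * (C₂ * (3 * N)) := by
      have hsum : ∑ e ∈ E, |ρ (M.sides e).1 (z (M.sides e).1) -
          ρ (M.sides e).2 (z (M.sides e).2)| ^ 2 ≤ C₂ * (3 * N) := by
        calc _ ≤ ∑ e ∈ E, C₂ * (G (M.sides e).1 + G (M.sides e).2 + J e) := by
              refine Finset.sum_le_sum fun e he => ?_
              have hs := sides_spec (mem_intEdges.1 (hE he)).2
              rw [sq_abs]
              exact hnb M hreg hqu ρ hρ e (hE he) _ (hz _ hs.1) _ (hz _ hs.2.1)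
          _ ≤ ∑ e ∈ M.intEdges, C₂ * (G (M.sides e).1 + G (M.sides e).2 + J e) := by
              refine Finset.sum_le_sum_of_subset_of_nonneg hE fun e _ _ => ?_
              have := hG (M.sides e).1
              have := hG (M.sides e).2
              have := hJ e
              positivity
          _ ≤ C₂ * (3 * N) := by
              rw [← Finset.mul_sum, Finset.sum_add_distrib]
              have := (M.sum_edges_le G fun K _ => hG K).2
              gcongr
              linarith
      calc (ρ K (z K) - ρ L (z L)) ^ 2 = |ρ K (z K) - ρ L (z L)| ^ 2 := (sq_abs _).symm
        _ ≤ (∑ e ∈ E, |ρ (M.sides e).1 (z (M.sides e).1) -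
            ρ (M.sides e).2 (z (M.sides e).2)|) ^ 2 := by gcongr
        _ ≤ E.card * ∑ e ∈ E, |ρ (M.sides e).1 (z (M.sides e).1) -
            ρ (M.sides e).2 (z (M.sides e).2)| ^ 2 := sq_sum_le_card_mul_sum_sq
        _ ≤ _ := by gcongr
    have h2 := (hosc M hreg hqu K hK _ (hρ K hK) x hx _ (hz K hK)).trans
      (mul_le_mul_of_nonneg_left (hGN K hK) hC₁.le)
    have h3 := (hosc M hreg hqu L hL _ (hρ L hL) _ (hz L hL) y hy).trans
      (mul_le_mul_of_nonneg_left (hGN L hL) hC₁.le)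
    set a := ρ K x - ρ K (z K)
    set b := ρ K (z K) - ρ L (z L)
    set c := ρ L (z L) - ρ L y
    have e1 : ρ K x - ρ L y = a + b + c := by simp only [a, b, c]; ring
    have h4 : (a + b + c) ^ 2 ≤ 3 * (a ^ 2 + b ^ 2 + c ^ 2) := by
      nlinarith [sq_nonneg (a - b), sq_nonneg (a - c), sq_nonneg (b - c)]
    have h5 : C₁ * N ≤ C₁ * H / M.h * N := by
      gcongr
      rw [le_div_iff₀ hh]
      gcongr
    rw [e1]
    calc (a + b + c) ^ 2 ≤ 3 * (C₁ * H / M.h * N + C₃ / M.h * (C₂ * (3 * N)) +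
          C₁ * H / M.h * N) := by linarith
      _ = _ := by ring
  -- Somewhere `ρ` has a value of the opposite sign, so `ρ K x` is smaller than the difference.
  intro K hK x hx
  rcases le_total 0 (ρ K x) with h0 | h0
  · obtain ⟨L, hL, y, hy, hle⟩ := exists_nonpos
      (fun K hK => (linePoly_of_mem (hρ K hK)).1.continuous) hmean
    refine le_trans ?_ (hcmp K hK x hx L hL y hy)
    gcongr
    linarith
  · obtain ⟨L, hL, y, hy, hle⟩ := exists_nonpos (f := fun K x => -ρ K x)
      (fun K hK => (linePoly_of_mem (hρ K hK)).1.continuous.neg)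
      (by simp only [integral_neg, Finset.sum_neg_distrib, hmean, neg_zero])
    refine le_trans ?_ (hcmp K hK x hx L hL y hy)
    rw [← neg_sq, ← neg_sq (ρ K x - ρ L y)]
    have : 0 ≤ -ρ K x := by linarith
    gcongr
    linarith

end TriMesh

/-! ### Fluxes through the boundary edges -/

lemma integral_abs_edge_le {e : Finset Plane} (he : e.card = 2) {f : Plane → ℝ}
    (hf : MemLp f 2 (arcLength.restrict (simplex e))) :
    ∫ x in simplex e, |f x| ∂arcLength ≤
      √(∫ x in simplex e, f x ^ 2 ∂arcLength) * √(arcLength.real (simplex e)) := by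
  have h1 : MemLp (fun _ : Plane => (1 : ℝ)) 2 (arcLength.restrict (simplex e)) :=
    memLp_simplex_of_continuous (arcLength_ne_top he) continuous_const
  simpa using integral_norm_mul_norm_le hf h1

lemma abs_integral_le_of_abs_le {α : Type*} [MeasurableSpace α] {μ : Measure α} {f g : α → ℝ}
    (hg : Integrable g μ) (h : ∀ᵐ x ∂μ, |f x| ≤ g x) : |∫ x, f x ∂μ| ≤ ∫ x, g x ∂μ := by
  rw [← Real.norm_eq_abs]
  exact norm_integral_le_of_norm_le hg h

lemma abs_integral_le_of_abs_le_norm_mul {α E F : Type*} [MeasurableSpace α] {μ : Measure α}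
    [NormedAddCommGroup E] [NormedAddCommGroup F] {f : α → ℝ} {u : α → E} {v : α → F}
    (hu : MemLp u 2 μ) (hv : MemLp v 2 μ) (h : ∀ x, |f x| ≤ ‖u x‖ * ‖v x‖) :
    |∫ x, f x ∂μ| ≤ √(∫ x, ‖u x‖ ^ 2 ∂μ) * √(∫ x, ‖v x‖ ^ 2 ∂μ) :=
  (abs_integral_le_of_abs_le (hu.norm.integrable_mul hv.norm) (.of_forall h)).trans
    (integral_norm_mul_norm_le hu hv)

/-- Comparison of the flux of `P` in direction `n` with that of a nearby vector `T` in a nearby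
direction `N`. -/
lemma abs_inner_le_of_unit {P T N n : Plane} (hN : ‖N‖ = 1) :
    |inner ℝ P n| ≤ |inner ℝ T N| + ‖T - P‖ + ‖P‖ * ‖N - n‖ := by
  have e1 : inner ℝ P n = inner ℝ T N - inner ℝ (T - P) N - inner ℝ P (N - n) := by
    rw [inner_sub_left, inner_sub_right]; ring
  have b1 := abs_real_inner_le_norm (T - P) N
  have b2 := abs_real_inner_le_norm P (N - n)
  rw [hN, mul_one] at b1
  rw [e1]
  linarith [abs_sub (inner ℝ T N - inner ℝ (T - P) N) (inner ℝ P (N - n)),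
    abs_sub (inner ℝ T N) (inner ℝ (T - P) N)]

namespace TriMesh

variable {M : TriMesh} {Ω : Set Plane} {Mh ν : Plane → Plane} {Cδ Cn : ℝ} {k : ℕ}
  {v : Plane → Plane}

lemma piece_mem_rt (hv : v ∈ M.V k) {K : Finset Plane} (hK : K ∈ M.elems) :
    piece (rtSpace k) v K ∈ rtSpace k := (piece_spec (hv.2 K hK)).1

lemma continuous_piece_rt (hv : v ∈ M.V k) {K : Finset Plane} (hK : K ∈ M.elems) :
    Continuous (piece (rtSpace k) v K) := (contDiff_of_mem_rt (piece_mem_rt hv hK)).continuous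

lemma integral_norm_sq_eq (hv : v ∈ M.V k) : ∫ x in M.domain, ‖v x‖ ^ 2 =
    ∑ K ∈ M.elems, ∫ x in simplex K, ‖piece (rtSpace k) v K x‖ ^ 2 := by
  have hae : ∀ K ∈ M.elems, (fun x => ‖v x‖ ^ 2) =ᵐ[volume.restrict (simplex K)]
      fun x => ‖piece (rtSpace k) v K x‖ ^ 2 := fun K hK => by
    filter_upwards [(piece_spec (hv.2 K hK)).2] with x hx
    rw [hx]
  rw [integral_domain fun K hK => ?_]
  · exact Finset.sum_congr rfl fun K hK => integral_congr_ae (hae K hK)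
  · have := ((continuous_piece_rt hv hK).norm.pow 2).continuousOn.integrableOn_compact
      (isCompact_simplex K) (μ := volume)
    exact Integrable.congr this (hae K hK).symm

/-- Values of a Raviart-Thomas function, and of its Taylor remainder, on a boundary edge. -/
lemma exists_taylor_edge_le (hbdd : Bornology.IsBounded Ω) (k : ℕ) {σ τ : ℝ} (hσ : 0 < σ)
    (hτ : 0 < τ) (Cδ Cn : ℝ) :
    ∃ C : ℝ, 0 < C ∧ ∀ M : TriMesh, M.IsBodyFitted Ω → M.ShapeRegular σ → M.QuasiUniform τ →
      ∀ Mh ν, M.IsBoundaryMap Ω Mh ν Cδ Cn → ∀ e ∈ M.bdryEdges, ∀ p ∈ rtSpace k, ∀ x ∈ simplex e,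
        ‖p x‖ ≤ C / M.h * √(∫ z in simplex (M.elem e), ‖p z‖ ^ 2) ∧
        ‖taylor Mh ν k p x - p x‖ ≤ C * √(∫ z in simplex (M.elem e), ‖p z‖ ^ 2) := by
  obtain ⟨C₁, hC₁, hinv⟩ := exists_inverse_estimate_vec (k + 1) hσ hτ
  obtain ⟨H, hH, hHle⟩ := exists_h_le hbdd
  obtain ⟨C₂, hC₂, htay⟩ := exists_taylor_sub_le k (k + 1) Cδ H
  refine ⟨√C₁ * (1 + C₂), by positivity, fun M hM hreg hqu Mh ν hBM e he p hp x hx => ?_⟩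
  have hh := M.h_pos
  obtain ⟨hK, heK⟩ := elem_spec (mem_bdryEdges.1 he).1
  set I := ∫ z in simplex (M.elem e), ‖p z‖ ^ 2
  have hI : 0 ≤ I := integral_nonneg fun z => by positivity
  have hxb : x ∈ M.bdry := Set.mem_biUnion he hx
  have hB : ∀ y ∈ Metric.closedBall x M.h, ‖p y‖ ≤ √C₁ / M.h * √I := fun y hy => by
    refine (abs_le_of_sq_le_sq' ?_ (by positivity)).2
    rw [mul_pow, div_pow, Real.sq_sqrt hC₁.le, Real.sq_sqrt hI]
    exact hinv M hreg hqu _ hK p (linePoly_of_mem_rt hp) x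
      (convexHull_mono (by exact_mod_cast heK) hx) y hy
  have hx' := hB x (Metric.mem_closedBall_self hh.le)
  constructor
  · refine hx'.trans ?_
    gcongr
    exact le_mul_of_one_le_right (by positivity) (by linarith)
  · refine (htay p (linePoly_of_mem_rt hp) Mh ν x M.h _ (hBM.norm_dir x hxb) hh (hHle M hM)
      (hBM.delta_le x hxb) hB).trans ?_
    have e1 : C₂ * M.h * (√C₁ / M.h * √I) = √C₁ * C₂ * √I := by field_simp
    rw [e1]
    gcongr
    linarith

/-- The pulled back normal is a unit normal almost everywhere on the boundary edges. -/
lemma IsBoundaryMap.ae_norm_pullNormal (hBM : M.IsBoundaryMap Ω Mh ν Cδ Cn) {e : Finset Plane}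
    (he : e ∈ M.bdryEdges) : ∀ᵐ x ∂(arcLength.restrict (simplex e)), ‖pullNormal Ω Mh x‖ = 1 ∧
      ‖pullNormal Ω Mh x - M.normal e‖ ≤ Cn * M.h := by
  filter_upwards [hBM.normal_le e he] with x hx
  refine ⟨?_, hx.2⟩
  rw [pullNormal, outwardNormal, dif_pos hx.1]
  exact hx.1.choose_spec.2.1

lemma memLp_taylorFlux (hbdd : Bornology.IsBounded Ω) {σ τ : ℝ} (hσ : 0 < σ) (hτ : 0 < τ)
    (hM : M.IsBodyFitted Ω) (hreg : M.ShapeRegular σ) (hqu : M.QuasiUniform τ)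
    (hBM : M.IsBoundaryMap Ω Mh ν Cδ Cn) (hv : v ∈ M.V k) {e : Finset Plane}
    (he : e ∈ M.bdryEdges) :
    MemLp (M.taylorFlux Ω Mh ν k v e) 2 (arcLength.restrict (simplex e)) := by
  obtain ⟨C, hC, hest⟩ := exists_taylor_edge_le hbdd k hσ hτ Cδ Cn
  have heM := (mem_bdryEdges.1 he).1
  obtain ⟨hK, heK⟩ := elem_spec heM
  have hp := piece_mem_rt hv hK
  have : IsFiniteMeasure (arcLength.restrict (simplex e)) :=
    ⟨by simpa using (arcLength_ne_top (card_of_mem_edges heM)).lt_top⟩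
  have hmeas : AEStronglyMeasurable (M.taylorFlux Ω Mh ν k v e)
      (arcLength.restrict (simplex e)) := by
    have h1 := (measurable_taylor hBM.measurable_map hBM.measurable_dir k
      (contDiff_of_mem_rt hp)).aestronglyMeasurable (μ := arcLength.restrict (simplex e))
    have h2 := hBM.measurable_normal.mono_measure (Measure.restrict_mono
      (Set.subset_biUnion_of_mem (u := fun e => simplex e) he) le_rfl)
    exact h1.inner h2
  set B := √(∫ z in simplex (M.elem e), ‖piece (rtSpace k) v (M.elem e) z‖ ^ 2)
  refine MemLp.of_bound hmeas (C * B + C / M.h * B) ?_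
  filter_upwards [hBM.ae_norm_pullNormal he, ae_restrict_mem (isCompact_simplex e).measurableSet]
    with x hx hxe
  obtain ⟨h1, h2⟩ := hest M hM hreg hqu Mh ν hBM e he _ hp x hxe
  refine (norm_inner_le_norm _ _).trans ?_
  rw [hx.1, mul_one]
  have := norm_add_le (taylor Mh ν k (piece (rtSpace k) v (M.elem e)) x -
    piece (rtSpace k) v (M.elem e) x) (piece (rtSpace k) v (M.elem e) x)
  rw [sub_add_cancel] at this
  linarith

lemma sq_inv_sqrt_hK (K : Finset Plane) : (√(hK K))⁻¹ ^ 2 = (hK K)⁻¹ := by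
  rw [inv_pow, Real.sq_sqrt (show 0 ≤ hK K from Metric.diam_nonneg)]

/-- The term of `‖v‖_{0,h}²` that belongs to the boundary edge `e`. -/
def bdrySq (M : TriMesh) (Ω : Set Plane) (Mh ν : Plane → Plane) (k : ℕ) (v : Plane → Plane)
    (e : Finset Plane) : ℝ :=
  ∫ x in simplex e, ((√(hK (M.elem e)))⁻¹ * M.taylorFlux Ω Mh ν k v e x) ^ 2 ∂arcLength

lemma bdrySq_nonneg (e : Finset Plane) : 0 ≤ M.bdrySq Ω Mh ν k v e :=
  integral_nonneg fun _ => sq_nonneg _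

lemma normV_sq : M.normV Ω Mh ν k v ^ 2 =
    (∫ x in M.domain, ‖v x‖ ^ 2) + ∑ e ∈ M.bdryEdges, M.bdrySq Ω Mh ν k v e :=
  Real.sq_sqrt (add_nonneg (integral_nonneg fun _ => by positivity)
    (Finset.sum_nonneg fun e _ => bdrySq_nonneg e))

lemma integral_norm_sq_le : ∫ x in M.domain, ‖v x‖ ^ 2 ≤ M.normV Ω Mh ν k v ^ 2 := by
  rw [normV_sq]
  exact le_add_of_nonneg_right (Finset.sum_nonneg fun e _ => bdrySq_nonneg e)

lemma sum_bdrySq_le :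
    ∑ e ∈ M.bdryEdges, M.bdrySq Ω Mh ν k v e ≤ M.normV Ω Mh ν k v ^ 2 := by
  rw [normV_sq]
  exact le_add_of_nonneg_left (integral_nonneg fun _ => by positivity)

lemma integral_taylorFlux_sq_le {e : Finset Plane} (he : e ∈ M.bdryEdges) {τ : ℝ} (hτ : 0 < τ)
    (hqu : M.QuasiUniform τ) :
    ∫ x in simplex e, M.taylorFlux Ω Mh ν k v e x ^ 2 ∂arcLength ≤
      M.h * M.bdrySq Ω Mh ν k v e := by
  obtain ⟨hK, -⟩ := elem_spec (mem_bdryEdges.1 he).1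
  have hpos : 0 < BVC.hK (M.elem e) := lt_of_lt_of_le (mul_pos hτ M.h_pos) (hqu _ hK)
  have e1 : M.bdrySq Ω Mh ν k v e = (BVC.hK (M.elem e))⁻¹ *
      ∫ x in simplex e, M.taylorFlux Ω Mh ν k v e x ^ 2 ∂arcLength := by
    simp only [bdrySq, mul_pow, sq_inv_sqrt_hK]
    rw [integral_const_mul]
  rw [e1, ← mul_assoc]
  refine le_mul_of_one_le_left (integral_nonneg fun _ => sq_nonneg _) ?_
  rw [← div_eq_mul_inv, one_le_div hpos]
  exact hK_le_h hK

/-! ### The form `a_h` -/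

lemma a_self : M.a Ω Mh ν k v v = M.normV Ω Mh ν k v ^ 2 := by
  rw [normV_sq, a]
  congr 1
  · simp only [real_inner_self_eq_norm_sq]
  · refine Finset.sum_congr rfl fun e _ => integral_congr_ae (.of_forall fun x => ?_)
    simp only [mul_pow, sq_inv_sqrt_hK]
    ring

lemma abs_a_le {u : Plane → Plane} (hu : MemLp u 2 (volume.restrict M.domain))
    (hv : MemLp v 2 (volume.restrict M.domain))
    (hu' : ∀ e ∈ M.bdryEdges,
      MemLp (M.taylorFlux Ω Mh ν k u e) 2 (arcLength.restrict (simplex e)))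
    (hv' : ∀ e ∈ M.bdryEdges,
      MemLp (M.taylorFlux Ω Mh ν k v e) 2 (arcLength.restrict (simplex e))) :
    |M.a Ω Mh ν k u v| ≤ M.normV Ω Mh ν k u * M.normV Ω Mh ν k v := by
  have h1 : |∫ x in M.domain, inner ℝ (u x) (v x)| ≤
      √(∫ x in M.domain, ‖u x‖ ^ 2) * √(∫ x in M.domain, ‖v x‖ ^ 2) :=
    abs_integral_le_of_abs_le_norm_mul hu hv fun x => abs_real_inner_le_norm _ _
  have h2 : ∀ e ∈ M.bdryEdges, |∫ x in simplex e, (hK (M.elem e))⁻¹ *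
      M.taylorFlux Ω Mh ν k u e x * M.taylorFlux Ω Mh ν k v e x ∂arcLength| ≤
      √(M.bdrySq Ω Mh ν k u e) * √(M.bdrySq Ω Mh ν k v e) := fun e he => by
    refine Eq.trans_le ?_ (abs_integral_mul_le ((hu' e he).const_mul (√(hK (M.elem e)))⁻¹)
      ((hv' e he).const_mul (√(hK (M.elem e)))⁻¹))
    congr 2
    funext x
    rw [← sq_inv_sqrt_hK]
    ring
  calc |M.a Ω Mh ν k u v| ≤ √(∫ x in M.domain, ‖u x‖ ^ 2) * √(∫ x in M.domain, ‖v x‖ ^ 2) +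
        ∑ e ∈ M.bdryEdges, √(M.bdrySq Ω Mh ν k u e) * √(M.bdrySq Ω Mh ν k v e) :=
        (abs_add_le _ _).trans (add_le_add h1 ((Finset.abs_sum_le_sum_abs _ _).trans
          (Finset.sum_le_sum h2)))
    _ ≤ √(∫ x in M.domain, ‖u x‖ ^ 2) * √(∫ x in M.domain, ‖v x‖ ^ 2) +
        √(∑ e ∈ M.bdryEdges, M.bdrySq Ω Mh ν k u e) *
          √(∑ e ∈ M.bdryEdges, M.bdrySq Ω Mh ν k v e) := by
        gcongr
        exact sum_sqrt_mul_sqrt_le_of_mem (fun e _ => bdrySq_nonneg e) fun e _ => bdrySq_nonneg e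
    _ ≤ _ := sqrt_mul_sqrt_add_le (integral_nonneg fun _ => by positivity)
        (integral_nonneg fun _ => by positivity)
        (Finset.sum_nonneg fun e _ => bdrySq_nonneg e)
        (Finset.sum_nonneg fun e _ => bdrySq_nonneg e)

/-! ### The forms `b_{h1}` and `b_{h0}` -/

lemma normQ_sq (q : Plane → ℝ) : M.normQ k q ^ 2 = M.brokenSq (piece (polySpace k) q) :=
  Real.sq_sqrt (add_nonneg (M.brokenSq_terms _).1 (M.brokenSq_terms _).2)

lemma b1_eq (hv : v ∈ M.V k) {q : Plane → ℝ} (hq : ∀ K ∈ M.elems, RestrictsTo (polySpace k) q K) :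
    M.b1 k v q = (∑ K ∈ M.elems, ∫ x in simplex K,
        fderiv ℝ (piece (polySpace k) q K) x (piece (rtSpace k) v K x)) -
      ∑ e ∈ M.intEdges, ∫ x in simplex e,
        inner ℝ (piece (rtSpace k) v (M.sides e).1 x) (outN (M.sides e).1 e) *
          M.jump k q e x ∂arcLength := by
  have hw : MemLp (weakDiv M.domain v) 2 (volume.restrict M.domain) ∧
      HasWeakDiv M.domain v (weakDiv M.domain v) := by
    rw [weakDiv, dif_pos hv.1.2]
    exact hv.1.2.choose_spec
  exact green_identity (fun K hK => (contDiff_of_mem_rt (piece_mem_rt hv hK)).of_le (by simp))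
    (fun K hK => (piece_spec (hv.2 K hK)).2) hw.1 hw.2
    (fun K hK => (linePoly_of_mem (piece_spec (hq K hK)).1).1.of_le (by simp))
    fun K hK => (piece_spec (hq K hK)).2

/-- Continuity of `b_{h1}`: after integration by parts, the inverse estimate bounds the normal
components on the interior edges. -/
theorem exists_abs_b1_le (k : ℕ) {σ τ : ℝ} (hσ : 0 < σ) (hτ : 0 < τ) :
    ∃ C : ℝ, 0 < C ∧ ∀ M : TriMesh, M.ShapeRegular σ → M.QuasiUniform τ →
      ∀ (Ω : Set Plane) (Mh ν : Plane → Plane), ∀ v ∈ M.V k, ∀ q : Plane → ℝ,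
        (∀ K ∈ M.elems, RestrictsTo (polySpace k) q K) →
        |M.b1 k v q| ≤ C * (M.normV Ω Mh ν k v * M.normQ k q) := by
  obtain ⟨C, hC, hinv⟩ := exists_inverse_estimate_vec (k + 1) hσ hτ
  refine ⟨1 + √C * 2, by positivity, fun M hreg hqu Ω Mh ν v hv q hq => ?_⟩
  have hh := M.h_pos
  set p := piece (rtSpace k) v
  set ρ := piece (polySpace k) q
  have hp : ∀ K ∈ M.elems, p K ∈ rtSpace k := fun K hK => piece_mem_rt hv hK
  have hpc : ∀ K ∈ M.elems, Continuous (p K) := fun K hK => continuous_piece_rt hv hK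
  have hρ : ∀ K ∈ M.elems, ρ K ∈ polySpace k := fun K hK => (piece_spec (hq K hK)).1
  have hρc : ∀ K ∈ M.elems, Continuous (ρ K) := fun K hK => (linePoly_of_mem (hρ K hK)).1.continuous
  set A : Finset Plane → ℝ := fun K => ∫ x in simplex K, ‖p K x‖ ^ 2 with hA
  set G : Finset Plane → ℝ := fun K => ∫ x in simplex K, ‖gradient (ρ K) x‖ ^ 2 with hG
  set J : Finset Plane → ℝ := fun e => M.h⁻¹ * ∫ x in simplex e, M.jump k q e x ^ 2 ∂arcLength
    with hJ
  have hA0 : ∀ K, 0 ≤ A K := fun K => integral_nonneg fun x => by positivity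
  have hG0 : ∀ K, 0 ≤ G K := fun K => integral_nonneg fun x => by positivity
  have hJ0 : ∀ e, 0 ≤ J e := fun e => mul_nonneg (by positivity)
    (integral_nonneg fun x => sq_nonneg _)
  have hNV : 0 ≤ M.normV Ω Mh ν k v := Real.sqrt_nonneg _
  have hNQ : 0 ≤ M.normQ k q := Real.sqrt_nonneg _
  have hsA : ∑ K ∈ M.elems, A K ≤ M.normV Ω Mh ν k v ^ 2 :=
    (integral_norm_sq_eq hv).symm.le.trans integral_norm_sq_le
  have hN : M.normQ k q ^ 2 = ∑ K ∈ M.elems, G K + ∑ e ∈ M.intEdges, J e := normQ_sq q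
  have hsG0 : 0 ≤ ∑ K ∈ M.elems, G K := Finset.sum_nonneg fun K _ => hG0 K
  have hsJ0 : 0 ≤ ∑ e ∈ M.intEdges, J e := Finset.sum_nonneg fun e _ => hJ0 e
  have hel : ∀ K ∈ M.elems, |∫ x in simplex K, fderiv ℝ (ρ K) x (p K x)| ≤ √(A K) * √(G K) :=
    fun K hK => by
      have m1 := memLp_simplex_of_continuous (volume_simplex_ne_top K) (hpc K hK)
      have m2 := memLp_simplex_of_continuous (volume_simplex_ne_top K)
        (continuous_gradient_of_mem (hρ K hK))
      refine abs_integral_le_of_abs_le_norm_mul m1 m2 fun x => ?_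
      rw [← inner_gradient_eq]
      exact abs_real_inner_le_norm _ _
  have hed : ∀ e ∈ M.intEdges, |∫ x in simplex e,
      inner ℝ (p (M.sides e).1 x) (outN (M.sides e).1 e) * M.jump k q e x ∂arcLength| ≤
      √C * (√(A (M.sides e).1) * √(J e)) := fun e he => by
    obtain ⟨he2, hi⟩ := mem_intEdges.1 he
    obtain ⟨h1, h2, -, h3, -⟩ := sides_spec hi
    have hjc : Continuous (M.jump k q e) := (hρc _ h1).sub (hρc _ h2)
    have hjL := memLp_simplex_of_continuous (arcLength_ne_top he2) hjc
    have hb : ∀ x ∈ simplex e, ‖p (M.sides e).1 x‖ ≤ √C / M.h * √(A (M.sides e).1) :=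
      fun x hx => by
        refine (abs_le_of_sq_le_sq' ?_ (by positivity)).2
        rw [mul_pow, div_pow, Real.sq_sqrt hC.le, Real.sq_sqrt (hA0 _)]
        exact hinv M hreg hqu _ h1 _ (linePoly_of_mem_rt (hp _ h1)) x
          (convexHull_mono (by exact_mod_cast h3) hx) x (Metric.mem_closedBall_self hh.le)
    have hJe : ∫ x in simplex e, M.jump k q e x ^ 2 ∂arcLength = M.h * J e := by
      simp only [hJ]; field_simp
    calc _ ≤ ∫ x in simplex e, √C / M.h * √(A (M.sides e).1) * |M.jump k q e x| ∂arcLength := by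
          refine abs_integral_le_of_abs_le
            (integrableOn_edge_of_continuous he2 (continuous_const.mul hjc.abs)) ?_
          filter_upwards [ae_restrict_mem (isCompact_simplex e).measurableSet] with x hx
          rw [abs_mul]
          gcongr
          refine (abs_real_inner_le_norm _ _).trans ?_
          rw [(isOutN_outN h1 h3 he2).1, mul_one]
          exact hb x hx
      _ ≤ √C / M.h * √(A (M.sides e).1) * (√(M.h * J e) * √M.h) := by
          rw [integral_const_mul, ← hJe]
          gcongr
          refine (integral_abs_edge_le he2 hjL).trans ?_
          gcongr
          exact arcLength_le_h h1 h3 he2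
      _ = √C * (√(A (M.sides e).1) * √(J e)) := by
          rw [Real.sqrt_mul hh.le]
          have := Real.mul_self_sqrt hh.le
          calc _ = √C / M.h * √(A (M.sides e).1) * (√M.h * √M.h) * √(J e) := by ring
            _ = _ := by rw [this]; field_simp
  have hsA' : ∑ e ∈ M.intEdges, A (M.sides e).1 ≤ (2 * M.normV Ω Mh ν k v) ^ 2 := by
    have h1 := (M.sum_edges_le A fun K _ => hA0 K).2
    rw [Finset.sum_add_distrib] at h1
    have h2 : 0 ≤ ∑ e ∈ M.intEdges, A (M.sides e).2 := Finset.sum_nonneg fun e _ => hA0 _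
    nlinarith [sq_nonneg (M.normV Ω Mh ν k v)]
  rw [b1_eq hv hq]
  calc _ ≤ ∑ K ∈ M.elems, √(A K) * √(G K) +
        ∑ e ∈ M.intEdges, √C * (√(A (M.sides e).1) * √(J e)) :=
        (abs_sub _ _).trans (add_le_add
          ((Finset.abs_sum_le_sum_abs _ _).trans (Finset.sum_le_sum hel))
          ((Finset.abs_sum_le_sum_abs _ _).trans (Finset.sum_le_sum hed)))
    _ ≤ √(∑ K ∈ M.elems, A K) * √(∑ K ∈ M.elems, G K) +
        √C * (√(∑ e ∈ M.intEdges, A (M.sides e).1) * √(∑ e ∈ M.intEdges, J e)) := by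
        rw [← Finset.mul_sum]
        gcongr
        · exact sum_sqrt_mul_sqrt_le_of_mem (fun K _ => hA0 K) fun K _ => hG0 K
        · exact sum_sqrt_mul_sqrt_le_of_mem (fun e _ => hA0 _) fun e _ => hJ0 e
    _ ≤ M.normV Ω Mh ν k v * M.normQ k q +
        √C * ((2 * M.normV Ω Mh ν k v) * M.normQ k q) := by
        gcongr
        · exact (Real.sqrt_le_left hNV).2 hsA
        · exact (Real.sqrt_le_left hNQ).2 (by linarith)
        · exact (Real.sqrt_le_left (by positivity)).2 hsA'
        · exact (Real.sqrt_le_left hNQ).2 (by linarith)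
    _ = _ := by ring

/-- The flux through one boundary edge, weighted with a function bounded by `B`. -/
lemma exists_abs_edge_le (hbdd : Bornology.IsBounded Ω) (k : ℕ) {σ τ : ℝ} (hσ : 0 < σ)
    (hτ : 0 < τ) (Cδ Cn : ℝ) :
    ∃ D : ℝ, 0 < D ∧ ∀ M : TriMesh, M.IsBodyFitted Ω → M.ShapeRegular σ → M.QuasiUniform τ →
      ∀ Mh ν, M.IsBoundaryMap Ω Mh ν Cδ Cn → ∀ v ∈ M.V k, ∀ e ∈ M.bdryEdges,
      ∀ (ρ : Plane → ℝ) (B : ℝ), 0 ≤ B → (∀ x ∈ simplex e, |ρ x| ≤ B) →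
        |∫ x in simplex e, inner ℝ (piece (rtSpace k) v (M.elem e) x) (M.normal e) *
          ρ x ∂arcLength| ≤ M.h * B * (√(M.bdrySq Ω Mh ν k v e) +
            D * √(∫ x in simplex (M.elem e), ‖piece (rtSpace k) v (M.elem e) x‖ ^ 2)) := by
  obtain ⟨C, hC, htay⟩ := exists_taylor_edge_le hbdd k hσ hτ Cδ Cn
  refine ⟨C * (1 + |Cn|), by positivity,
    fun M hM hreg hqu Mh ν hBM v hv e he ρ B hB0 hρB => ?_⟩
  have hh := M.h_pos
  have heM := (mem_bdryEdges.1 he).1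
  have he2 := card_of_mem_edges heM
  obtain ⟨hK, heK⟩ := elem_spec heM
  have hfL := memLp_taylorFlux hbdd hσ hτ hM hreg hqu hBM hv he
  have hp := piece_mem_rt hv hK
  set p := piece (rtSpace k) v (M.elem e)
  set S := C * (1 + |Cn|) * √(∫ x in simplex (M.elem e), ‖p x‖ ^ 2) with hS
  have : IsFiniteMeasure (arcLength.restrict (simplex e)) :=
    ⟨by simpa using (arcLength_ne_top he2).lt_top⟩
  have hfI : IntegrableOn (fun x => |M.taylorFlux Ω Mh ν k v e x|) (simplex e) arcLength :=
    (hfL.integrable (by norm_num)).abs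
  have hcI : IntegrableOn (fun _ => S) (simplex e) arcLength := integrable_const _
  have hpt : ∀ᵐ x ∂(arcLength.restrict (simplex e)), |inner ℝ (p x) (M.normal e) * ρ x| ≤
      (|M.taylorFlux Ω Mh ν k v e x| + S) * B := by
    filter_upwards [hBM.ae_norm_pullNormal he,
      ae_restrict_mem (isCompact_simplex e).measurableSet] with x hx hxe
    obtain ⟨t1, t2⟩ := htay M hM hreg hqu Mh ν hBM e he p hp x hxe
    have h1 : |inner ℝ (p x) (M.normal e)| ≤ |M.taylorFlux Ω Mh ν k v e x| +
        ‖taylor Mh ν k p x - p x‖ + ‖p x‖ * ‖pullNormal Ω Mh x - M.normal e‖ :=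
      abs_inner_le_of_unit hx.1
    have h2 : ‖p x‖ * ‖pullNormal Ω Mh x - M.normal e‖ ≤
        C / M.h * √(∫ x in simplex (M.elem e), ‖p x‖ ^ 2) * (|Cn| * M.h) := by
      gcongr
      exact hx.2.trans (by gcongr; exact le_abs_self _)
    have h3 : C / M.h * √(∫ x in simplex (M.elem e), ‖p x‖ ^ 2) * (|Cn| * M.h) =
        C * |Cn| * √(∫ x in simplex (M.elem e), ‖p x‖ ^ 2) := by field_simp
    have h4 : S = C * √(∫ x in simplex (M.elem e), ‖p x‖ ^ 2) +
        C * |Cn| * √(∫ x in simplex (M.elem e), ‖p x‖ ^ 2) := by rw [hS]; ring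
    rw [abs_mul]
    refine mul_le_mul ?_ (hρB x hxe) (abs_nonneg _) (by positivity)
    linarith
  have hlen := arcLength_le_h hK heK he2
  have hflux : ∫ x in simplex e, |M.taylorFlux Ω Mh ν k v e x| ∂arcLength ≤
      M.h * √(M.bdrySq Ω Mh ν k v e) := by
    calc _ ≤ √(M.h * M.bdrySq Ω Mh ν k v e) * √M.h := by
          refine (integral_abs_edge_le he2 hfL).trans ?_
          gcongr
          exact integral_taylorFlux_sq_le he hτ hqu
      _ = √M.h * √M.h * √(M.bdrySq Ω Mh ν k v e) := by rw [Real.sqrt_mul hh.le]; ring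
      _ = _ := by rw [Real.mul_self_sqrt hh.le]
  calc _ ≤ ∫ x in simplex e, (|M.taylorFlux Ω Mh ν k v e x| + S) * B ∂arcLength :=
        abs_integral_le_of_abs_le ((hfI.add hcI).mul_const B) hpt
    _ = ((∫ x in simplex e, |M.taylorFlux Ω Mh ν k v e x| ∂arcLength) +
        arcLength.real (simplex e) * S) * B := by
        rw [integral_mul_const, integral_add hfI hcI, setIntegral_const, smul_eq_mul]
    _ ≤ (M.h * √(M.bdrySq Ω Mh ν k v e) + M.h * S) * B := by gcongr
    _ = _ := by ring

/-- The boundary term that distinguishes `b_{h1}` from `b_{h0}`. The loss `h^{-1/2}` of the maximum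
estimate for `q`, and the number `O(1/h)` of boundary edges, are compensated by the factor `h` from
the edge lengths. -/
theorem exists_abs_sum_bdry_le (hΩ : IsOpen Ω) (hbdd : Bornology.IsBounded Ω)
    (hlip : HasLipschitzBoundary Ω) (k : ℕ) {σ τ : ℝ} (hσ : 0 < σ) (hτ : 0 < τ) (Cδ Cn : ℝ) :
    ∃ C : ℝ, 0 < C ∧ ∀ M : TriMesh, M.IsBodyFitted Ω → M.ShapeRegular σ → M.QuasiUniform τ →
      ∀ Mh ν, M.IsBoundaryMap Ω Mh ν Cδ Cn → ∀ v ∈ M.V k, ∀ q ∈ M.Q0 k,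
        |∑ e ∈ M.bdryEdges, ∫ x in simplex e,
          inner ℝ (piece (rtSpace k) v (M.elem e) x) (M.normal e) *
            piece (polySpace k) q (M.elem e) x ∂arcLength| ≤
          C * (M.normV Ω Mh ν k v * M.normQ k q) := by
  obtain ⟨C₁, hC₁, hmax⟩ := exists_sq_le_brokenSq hΩ hbdd hlip k hσ hτ Cδ Cn
  obtain ⟨C₂, hC₂, hcard⟩ := exists_card_bdryEdges_le hΩ hbdd hlip hσ hτ
  obtain ⟨D, hD, hedge⟩ := exists_abs_edge_le hbdd k hσ hτ Cδ Cn
  refine ⟨√C₁ * √C₂ * (1 + D * 2), by positivity, fun M hM hreg hqu Mh ν hBM v hv q hq => ?_⟩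
  have hh := M.h_pos
  set p := piece (rtSpace k) v
  set ρ := piece (polySpace k) q
  have hp : ∀ K ∈ M.elems, p K ∈ rtSpace k := fun K hK => piece_mem_rt hv hK
  have hρ : ∀ K ∈ M.elems, ρ K ∈ polySpace k := fun K hK => (piece_spec (hq.2.1 K hK)).1
  have hρc : ∀ K ∈ M.elems, Continuous (ρ K) := fun K hK => (linePoly_of_mem (hρ K hK)).1.continuous
  set A : Finset Plane → ℝ := fun K => ∫ x in simplex K, ‖p K x‖ ^ 2 with hA
  have hA0 : ∀ K, 0 ≤ A K := fun K => integral_nonneg fun x => by positivity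
  have hNV : 0 ≤ M.normV Ω Mh ν k v := Real.sqrt_nonneg _
  have hNQ : 0 ≤ M.normQ k q := Real.sqrt_nonneg _
  set B := √C₁ / √M.h * M.normQ k q with hB
  have hB0 : 0 ≤ B := by positivity
  have hmean : ∑ K ∈ M.elems, ∫ x in simplex K, ρ K x = 0 := by
    rw [← hq.2.2, integral_domain fun K hK => MemLp.integrable_simplex hq.1 hK]
    exact Finset.sum_congr rfl fun K hK =>
      integral_congr_ae (piece_spec (hq.2.1 K hK)).2.symm
  have hρB : ∀ K ∈ M.elems, ∀ x ∈ simplex K, |ρ K x| ≤ B := fun K hK x hx => by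
    refine abs_le_of_sq_le_sq ?_ hB0
    rw [hB, mul_pow, div_pow, Real.sq_sqrt hC₁.le, Real.sq_sqrt hh.le, normQ_sq]
    exact hmax M hM hreg hqu Mh ν hBM ρ hρ hmean K hK x hx
  have hed : ∀ e ∈ M.bdryEdges, |∫ x in simplex e,
      inner ℝ (p (M.elem e) x) (M.normal e) * ρ (M.elem e) x ∂arcLength| ≤
      M.h * B * (√(M.bdrySq Ω Mh ν k v e) + D * √(A (M.elem e))) := fun e he => by
    obtain ⟨hK, heK⟩ := elem_spec (mem_bdryEdges.1 he).1
    exact hedge M hM hreg hqu Mh ν hBM v hv e he _ B hB0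
      fun x hx => hρB _ hK x (convexHull_mono (by exact_mod_cast heK) hx)
  have hsA : ∑ e ∈ M.bdryEdges, A (M.elem e) ≤ (2 * M.normV Ω Mh ν k v) ^ 2 := by
    have h1 := (M.sum_edges_le A fun K _ => hA0 K).1
    have h2 : ∑ K ∈ M.elems, A K ≤ M.normV Ω Mh ν k v ^ 2 :=
      (integral_norm_sq_eq hv).symm.le.trans integral_norm_sq_le
    nlinarith [sq_nonneg (M.normV Ω Mh ν k v)]
  have hn : √(M.bdryEdges.card : ℝ) ≤ √C₂ / √M.h := by
    rw [← Real.sqrt_div hC₂.le]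
    exact Real.sqrt_le_sqrt (hcard M hM hreg hqu)
  calc _ ≤ ∑ e ∈ M.bdryEdges, M.h * B * (√(M.bdrySq Ω Mh ν k v e) + D * √(A (M.elem e))) :=
        (Finset.abs_sum_le_sum_abs _ _).trans (Finset.sum_le_sum hed)
    _ = M.h * B * (∑ e ∈ M.bdryEdges, √(M.bdrySq Ω Mh ν k v e) +
        D * ∑ e ∈ M.bdryEdges, √(A (M.elem e))) := by
        rw [← Finset.mul_sum, Finset.sum_add_distrib, Finset.mul_sum]
    _ ≤ M.h * B * (√C₂ / √M.h * M.normV Ω Mh ν k v +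
        D * (√C₂ / √M.h * (2 * M.normV Ω Mh ν k v))) := by
        gcongr
        · refine (sum_sqrt_le fun e _ => bdrySq_nonneg e).trans ?_
          gcongr
          exact (Real.sqrt_le_left hNV).2 sum_bdrySq_le
        · refine (sum_sqrt_le fun e _ => hA0 _).trans ?_
          gcongr
          exact (Real.sqrt_le_left (by positivity)).2 hsA
    _ = M.h / (√M.h * √M.h) *
        (√C₁ * √C₂ * (1 + D * 2) * (M.normV Ω Mh ν k v * M.normQ k q)) := by
        rw [hB]; field_simp
    _ = _ := by rw [Real.mul_self_sqrt hh.le, div_self hh.ne', one_mul]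

end TriMesh

end BVC

end

theorem mainTheorem5 (Ω : Set BVC.Plane) (hΩ_open : IsOpen Ω) (hΩ_conn : IsConnected Ω)
    (hΩ_bdd : Bornology.IsBounded Ω) (hΩ_lip : BVC.HasLipschitzBoundary Ω)
    (k : ℕ) (hk : 1 ≤ k) (σ τ Cδ Cn : ℝ) (hσ : 0 < σ) (hτ : 0 < τ) :
    ∃ C : ℝ, 0 < C ∧ ∀ (M : BVC.TriMesh), M.IsBodyFitted Ω → M.ShapeRegular σ →
      M.QuasiUniform τ → ∀ Mh ν : BVC.Plane → BVC.Plane, M.IsBoundaryMap Ω Mh ν Cδ Cn →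
      ∀ u ∈ M.V k, ∀ v ∈ M.V k, ∀ q ∈ M.Q0 k,
        |M.a Ω Mh ν k u v| ≤ M.normV Ω Mh ν k u * M.normV Ω Mh ν k v ∧
        M.a Ω Mh ν k v v = M.normV Ω Mh ν k v ^ 2 ∧
        |M.b1 k v q| ≤ C * (M.normV Ω Mh ν k v * M.normQ k q) ∧
        |M.b0 v q| ≤ C * (M.normV Ω Mh ν k v * M.normQ k q) := by
  obtain ⟨C₁, hC₁, h1⟩ := BVC.TriMesh.exists_abs_b1_le k hσ hτ
  obtain ⟨C₂, hC₂, h2⟩ :=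
    BVC.TriMesh.exists_abs_sum_bdry_le hΩ_open hΩ_bdd hΩ_lip k hσ hτ Cδ Cn
  refine ⟨C₁ + C₂, by positivity, fun M hM hreg hqu Mh ν hBM u hu v hv q hq => ?_⟩
  have hN : 0 ≤ M.normV Ω Mh ν k v * M.normQ k q :=
    mul_nonneg (Real.sqrt_nonneg _) (Real.sqrt_nonneg _)
  have hb1 := h1 M hreg hqu Ω Mh ν v hv q hq.2.1
  have hb := h2 M hM hreg hqu Mh ν hBM v hv q hq
  refine ⟨BVC.TriMesh.abs_a_le hu.1.1 hv.1.1
    (fun e he => BVC.TriMesh.memLp_taylorFlux hΩ_bdd hσ hτ hM hreg hqu hBM hu he)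
    (fun e he => BVC.TriMesh.memLp_taylorFlux hΩ_bdd hσ hτ hM hreg hqu hBM hv he),
    BVC.TriMesh.a_self, ?_, ?_⟩
  · rw [add_mul]
    exact hb1.trans (le_add_of_nonneg_right (mul_nonneg hC₂.le hN))
  -- `b_{h0}` is `b_{h1}` without the boundary term.
  · have e : M.b0 v q = M.b1 k v q - ∑ e ∈ M.bdryEdges, ∫ x in BVC.simplex e,
        inner ℝ (BVC.piece (BVC.rtSpace k) v (M.elem e) x) (M.normal e) *
          BVC.piece (BVC.polySpace k) q (M.elem e) x ∂BVC.arcLength := by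
      rw [BVC.TriMesh.b0, BVC.TriMesh.b1, add_sub_cancel_right]
    rw [e, add_mul]
    exact (abs_sub _ _).trans (add_le_add hb1 hb)
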